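/- **Tannaka reconstruction for bialgebroids.** *Conventions.* Let $k$ be a commutative ring and $R$ a $k$-algebra (associative, unital). ${}_R\mathcal M_R$ is the monoidal category, under $\otimes_R$, of $R$-$R$-bimodules over $k$, i.e. of left modules over $R^e=R\otimes_k R^{op}$. A monoidal functor is a lax monoidal functor whose structure maps are isomorphisms. Equalities of (lax) monoidal functors are strict: the functors and their structure maps coincide. A (left) bialgebroid $A$ over $R$ is a $k$-algebra $A$ with a $k$-algebra map $R\otimes_k R^{op}\to A$, $r\otimes r'\mapsto s(r)t(r')$, and a comonoid structure $\Delta\colon A\to A\otimes_R A$, $\varepsilon\colon A\to R$ on the bimodule $A$ with actions $r\cdot a\cdot r'=s(r)t(r')a$, such that $\Delta(a)(t(r)\otimes 1)=\Delta(a)(1\otimes s(r))$, $\Delta(1)=1\otimes 1$, $\Delta(ab)=\Delta(a)\Delta(b)$, $\varepsilon(1)=1$ and $\varepsilon(a\,t(\varepsilon(b)))=\varepsilon(ab)=\varepsilon(a\,s(\varepsilon(b)))$ for all $a,b\in A$, $r\in R$. The category ${}_A\mathcal M$ of left $A$-modules is monoidal, with $a(v\otimes w)=a_{(1)}v\otimes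 a_{(2)}w$ on $V\otimes_R W$ and $a\cdot r=\varepsilon(a\,s(r))$ on the unit $R$, and the forgetful functor $U_A\colon{}_A\mathcal M\to{}_R\mathcal M_R$ is (strict) monoidal. The functor $T_A=A\otimes_{R^e}(-)$ on ${}_R\mathcal M_R$ is a monad, with $a\otimes(b\otimes x)\mapsto ab\otimes x$ and $x\mapsto 1\otimes x$, and it is lax comonoidal, with $a\otimes(x\otimes y)\mapsto(a_{(1)}\otimes x)\otimes(a_{(2)}\otimes y)$ and $a\otimes r\mapsto\varepsilon(a\,s(r))$. For bialgebroids $A$ over $R$ and $B$ over $S$ and a $k$-linear lax monoidal functor $G=(G,G_2,G_0)\colon{}_R\mathcal M_R\to{}_S\mathcal M_S$, a bialgebroid morphism $\langle G,\varphi\rangle\colon A\to B$ is a natural transformation $\varphi\colon T_BG\to GT_A$ which is a monad morphism, $$\varphi_X\circ\mu^B_{GX}=G\mu^A_X\circ\varphi_{T_AX}\circ T_B\varphi_X,\qquad \varphi_X\circ\eta^B_{GX}=G\eta^A_X,$$ and is ambimonoidal: writing $(T^2,T^0)$ for the comonoidal structure maps, $$G(T_A^2)\circ\varphi_{X\otimes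 Y}\circ T_B(G_2)=G_2\circ(\varphi_X\otimes\varphi_Y)\circ T_B^2,\qquad G(T_A^0)\circ\varphi_{R}\circ T_B(G_0)=G_0\circ T_B^0 .$$ It induces the functor $G^\varphi\colon{}_A\mathcal M\to{}_B\mathcal M$ sending an $A$-module with action $\alpha\colon T_AX\to X$ to the $B$-module $GX$ with action $G\alpha\circ\varphi_X$, with lax monoidal structure given by that of $G$; so $U_BG^\varphi=GU_A$. *Theorem.* Let $\mathcal C$ be a $k$-linear category with a monoidal structure and let $U\colon\mathcal C\to{}_R\mathcal M_R$ be a $k$-linear monoidal functor having both a left and a right adjoint. Then there are a bialgebroid $A$ over $R$ and a $k$-linear monoidal functor $K\colon\mathcal C\to{}_A\mathcal M$ such that 1. $U=U_AK$ as monoidal functors; 2. for every bialgebroid $B$ over a $k$-algebra $S$, every lax monoidal functor $F\colon\mathcal C\to{}_B\mathcal M$ and every $k$-linear lax monoidal functor $G\colon{}_R\mathcal M_R\to{}_S\mathcal M_S$ with $GU=U_BF$ as lax monoidal functors, there is a unique bialgebroid morphism $\langle G,\varphi\rangle\colon A\to B$ with $G^\varphi K=F$ as lax monoidal functors. In particular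 this holds whenever $F$ and $G$ are monoidal. The bialgebroid $A$ is unique up to isomorphism: if a bialgebroid $A'$ over $R$ and a monoidal functor $K'\colon\mathcal C\to{}_{A'}\mathcal M$ satisfy $U=U_{A'}K'$ and have property 2 for monoidal $F$ and $G$, then there is an isomorphism $i\colon A'\to A$ of bialgebroids over $R$ such that $\varphi_X(a\otimes x)=i(a)\otimes x$ defines a bialgebroid morphism $\langle\mathrm{id},\varphi\rangle\colon A\to A'$ with $\mathrm{id}^{\varphi}K=K'$. -/

import Mathlib

open CategoryTheory MonoidalCategory TensorProduct MulOpposite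

universe w u v₁ u₁

noncomputable section

namespace Bgd

section Balanced

variable {k M N M' N' : Type*} {ι : Type*} [CommRing k]
  [AddCommGroup M] [Module k M] [AddCommGroup N] [Module k N]
  [AddCommGroup M'] [Module k M'] [AddCommGroup N'] [Module k N']

/-- The quotient of `M ⊗[k] N` by the relations `ρ e m ⊗ n = m ⊗ l e n`. -/
def BalTensor (ρ : ι → Module.End k M) (l : ι → Module.End k N) : Type _ :=
  (M ⊗[k] N) ⧸ Submodule.span k {z : M ⊗[k] N | ∃ e m n, z = ρ e m ⊗ₜ n - m ⊗ₜ l e n}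

variable (ρ : ι → Module.End k M) (l : ι → Module.End k N)
  (ρ' : ι → Module.End k M') (l' : ι → Module.End k N')

instance : AddCommGroup (BalTensor ρ l) := inferInstanceAs (AddCommGroup (_ ⧸ _))

instance : Module k (BalTensor ρ l) := inferInstanceAs (Module k (_ ⧸ _))

namespace BalTensor

/-- The universal balanced bilinear map. -/
def mk : M →ₗ[k] N →ₗ[k] BalTensor ρ l :=
  (TensorProduct.mk k M N).compr₂ (Submodule.mkQ _)

variable {ρ l}

theorem mk_balanced (e : ι) (m : M) (n : N) : mk ρ l (ρ e m) n = mk ρ l m (l e n) :=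
  (Submodule.Quotient.eq _).2 (Submodule.subset_span ⟨e, m, n, rfl⟩)

@[elab_as_elim]
theorem ind {P : BalTensor ρ l → Prop} (zero : P 0) (add : ∀ x y, P x → P y → P (x + y))
    (tmul : ∀ m n, P (mk ρ l m n)) (z : BalTensor ρ l) : P z := by
  obtain ⟨z, rfl⟩ := Submodule.Quotient.mk_surjective _ z
  induction z using TensorProduct.induction_on with
  | zero => exact zero
  | add x y hx hy => exact add _ _ hx hy
  | tmul m n => exact tmul m n

variable {P : Type*} [AddCommGroup P] [Module k P]

/-- The linear map induced by a balanced bilinear map. -/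
def lift (f : M →ₗ[k] N →ₗ[k] P) (hf : ∀ e m n, f (ρ e m) n = f m (l e n)) :
    BalTensor ρ l →ₗ[k] P :=
  Submodule.liftQ _ (TensorProduct.lift f) (Submodule.span_le.2 (by
    rintro _ ⟨e, m, n, rfl⟩
    simp [hf]))

@[simp]
theorem lift_mk (f : M →ₗ[k] N →ₗ[k] P) (hf : ∀ e m n, f (ρ e m) n = f m (l e n)) (m : M) (n : N) :
    lift f hf (mk ρ l m n) = f m n := by
  exact (Submodule.liftQ_apply _ _ _).trans (TensorProduct.lift.tmul _ _)

/-- The additive map induced by a balanced biadditive map. -/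
def liftAdd {P : Type*} [AddCommGroup P] (f : M →+ N →+ P)
    (hk : ∀ (c : k) m n, f (c • m) n = f m (c • n))
    (hf : ∀ e m n, f (ρ e m) n = f m (l e n)) : BalTensor ρ l →+ P :=
  QuotientAddGroup.lift _ (TensorProduct.liftAddHom f hk) (fun z hz => by
    suffices h : ∀ c : k, TensorProduct.liftAddHom f hk (c • z) = 0 by simpa using h 1
    refine Submodule.span_induction (p := fun z _ => ∀ c : k,
      TensorProduct.liftAddHom f hk (c • z) = 0) ?_ ?_ ?_ ?_ hz
    · rintro _ ⟨e, m, n, rfl⟩ c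
      rw [smul_sub, TensorProduct.smul_tmul', TensorProduct.smul_tmul', map_sub,
        TensorProduct.liftAddHom_tmul, TensorProduct.liftAddHom_tmul, ← map_smul, hf, sub_self]
    · simp
    · intro x y _ _ hx hy c
      rw [smul_add, map_add, hx, hy, add_zero]
    · intro a x _ hx c
      rw [smul_smul, hx])

@[simp]
theorem liftAdd_mk {P : Type*} [AddCommGroup P] (f : M →+ N →+ P)
    (hk : ∀ (c : k) m n, f (c • m) n = f m (c • n))
    (hf : ∀ e m n, f (ρ e m) n = f m (l e n)) (m : M) (n : N) :
    liftAdd f hk hf (mk ρ l m n) = f m n := rfl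

theorem hom_ext {f g : BalTensor ρ l →ₗ[k] P} (h : ∀ m n, f (mk ρ l m n) = g (mk ρ l m n)) :
    f = g := by
  ext z
  induction z using ind with
  | zero => simp
  | add x y hx hy => simp [hx, hy]
  | tmul m n => exact h m n

/-- The map `m ⊗ n ↦ f m ⊗ g n`. -/
def map (f : M →ₗ[k] M') (g : N →ₗ[k] N') (hf : ∀ e m, f (ρ e m) = ρ' e (f m))
    (hg : ∀ e n, g (l e n) = l' e (g n)) : BalTensor ρ l →ₗ[k] BalTensor ρ' l' :=
  lift ((mk ρ' l').compl₁₂ f g) (fun e m n => by simp [hf, hg, mk_balanced])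

@[simp]
theorem map_mk (f : M →ₗ[k] M') (g : N →ₗ[k] N') (hf : ∀ e m, f (ρ e m) = ρ' e (f m))
    (hg : ∀ e n, g (l e n) = l' e (g n)) (m : M) (n : N) :
    map ρ' l' f g hf hg (mk ρ l m n) = mk ρ' l' (f m) (g n) :=
  lift_mk _ _ _ _

end BalTensor

end Balanced

/-! ### Bimodules -/

section Bimodules

variable (k : Type w) [CommRing k] (R : Type u) [Ring R] [Algebra k R]

/-- The enveloping algebra `R ⊗ Rᵒᵖ`. -/
abbrev Env : Type u := R ⊗[k] Rᵐᵒᵖ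

/-- The category of `R`-`R`-bimodules over `k`, that is, of left modules over `R ⊗ Rᵒᵖ`. -/
abbrev BimoduleCat : Type (u + 1) := ModuleCat.{u} (Env k R)

variable {R}

instance instModuleBase (X : BimoduleCat k R) : Module k X :=
  Module.compHom X (algebraMap k (Env k R))

theorem base_smul (X : BimoduleCat k R) (c : k) (x : X) :
    c • x = algebraMap k (Env k R) c • x := rfl

instance (X : BimoduleCat k R) : IsScalarTower k (Env k R) X :=
  ⟨fun c e x => by rw [base_smul, (Algebra.smul_def c e : c • e = _), mul_smul]⟩

instance (X : BimoduleCat k R) : SMulCommClass (Env k R) k X :=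
  ⟨fun e c x => by rw [base_smul, base_smul, ← mul_smul, ← mul_smul, Algebra.commutes]⟩

variable {k}

/-- The left action `r · x` as an endomorphism. -/
def lact (X : BimoduleCat k R) (r : R) : Module.End k X :=
  Algebra.lsmul k k X (r ⊗ₜ[k] (1 : Rᵐᵒᵖ) : Env k R)

/-- The right action `x · r` as an endomorphism. -/
def ract (X : BimoduleCat k R) (r : R) : Module.End k X :=
  Algebra.lsmul k k X ((1 : R) ⊗ₜ[k] op r : Env k R)

theorem lact_apply (X : BimoduleCat k R) (r : R) (x : X) :
    lact X r x = (r ⊗ₜ[k] (1 : Rᵐᵒᵖ) : Env k R) • x := rfl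

theorem ract_apply (X : BimoduleCat k R) (r : R) (x : X) :
    ract X r x = ((1 : R) ⊗ₜ[k] op r : Env k R) • x := rfl

theorem tmul_smul' (X : BimoduleCat k R) (r : R) (r' : Rᵐᵒᵖ) (x : X) :
    (r ⊗ₜ[k] r' : Env k R) • x = lact X r (ract X (unop r') x) := by
  rw [lact_apply, ract_apply, ← mul_smul]; simp

theorem lact_ract (X : BimoduleCat k R) (r r' : R) (x : X) :
    lact X r (ract X r' x) = ract X r' (lact X r x) := by
  rw [lact_apply, ract_apply, lact_apply, ract_apply, ← mul_smul, ← mul_smul]; simp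

theorem hom_lact {X Y : BimoduleCat k R} (f : X ⟶ Y) (r : R) (x : X) :
    f.hom (lact X r x) = lact Y r (f.hom x) := f.hom.map_smul _ _

theorem hom_ract {X Y : BimoduleCat k R} (f : X ⟶ Y) (r : R) (x : X) :
    f.hom (ract X r x) = ract Y r (f.hom x) := f.hom.map_smul _ _

/-- A morphism of bimodules viewed as a `k`-linear map. -/
def homk {X Y : BimoduleCat k R} (f : X ⟶ Y) : X →ₗ[k] Y :=
  f.hom.restrictScalars k

/-- An additive map commuting with the two actions is a morphism of bimodules. -/
def mkHom {X Y : BimoduleCat k R} (f : X →+ Y) (hl : ∀ r x, f (lact X r x) = lact Y r (f x))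
    (hr : ∀ r x, f (ract X r x) = ract Y r (f x)) : X ⟶ Y :=
  ModuleCat.ofHom
    { f with
      map_smul' := fun e x => show f (e • x) = e • f x by
        induction e using TensorProduct.induction_on with
        | zero =>
          have h1 : (0 : Env k R) • x = 0 := Module.zero_smul x
          have h2 : (0 : Env k R) • f x = 0 := Module.zero_smul (f x)
          exact ((congrArg f h1).trans (map_zero f)).trans h2.symm
        | add a b ha hb => rw [add_smul, add_smul, map_add, ha, hb]
        | tmul r r' => rw [tmul_smul', tmul_smul', hl, hr] }

@[simp]
theorem mkHom_apply {X Y : BimoduleCat k R} (f : X →+ Y) (hl hr) (x : X) :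
    (mkHom f hl hr).hom x = f x := rfl

/-! The tensor product `X ⊗_R Y` of bimodules. -/

/-- The `k`-module `X ⊗_R Y`. -/
abbrev tensorCarrier (X Y : BimoduleCat k R) : Type u :=
  BalTensor (ι := R) (ract X) (lact Y)

theorem lact_mul (X : BimoduleCat k R) (r r' : R) : lact X (r * r') = lact X r * lact X r' := by
  rw [lact, lact, lact, ← map_mul, Algebra.TensorProduct.tmul_mul_tmul, one_mul]

theorem ract_mul (X : BimoduleCat k R) (r r' : R) : ract X (r * r') = ract X r' * ract X r := by
  rw [ract, ract, ract, ← map_mul, Algebra.TensorProduct.tmul_mul_tmul, one_mul, MulOpposite.op_mul]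

theorem lact_one (X : BimoduleCat k R) : lact X 1 = 1 :=
  map_one (Algebra.lsmul k k X (A := Env k R))

theorem ract_one (X : BimoduleCat k R) : ract X 1 = 1 :=
  map_one (Algebra.lsmul k k X (A := Env k R))

theorem lact_add (X : BimoduleCat k R) (r r' : R) : lact X (r + r') = lact X r + lact X r' := by
  rw [lact, lact, lact, ← map_add, TensorProduct.add_tmul]

theorem ract_add (X : BimoduleCat k R) (r r' : R) : ract X (r + r') = ract X r + ract X r' := by
  rw [ract, ract, ract, ← map_add, MulOpposite.op_add, TensorProduct.tmul_add]

theorem lact_base (X : BimoduleCat k R) (c : k) (r : R) : lact X (c • r) = c • lact X r := by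
  rw [lact, lact, ← map_smul, TensorProduct.smul_tmul']

theorem ract_base (X : BimoduleCat k R) (c : k) (r : R) : ract X (c • r) = c • ract X r := by
  rw [ract, ract, ← map_smul, MulOpposite.op_smul, TensorProduct.tmul_smul]

/-- The left action on `X ⊗_R Y`, `r · (x ⊗ y) = r·x ⊗ y`. -/
def tensorActL (X Y : BimoduleCat k R) : R →ₐ[k] Module.End k (tensorCarrier X Y) :=
  AlgHom.ofLinearMap
    { toFun := fun r => BalTensor.map _ _ (lact X r) LinearMap.id
        (fun e m => lact_ract _ _ _ _) (fun _ _ => rfl)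
      map_add' := fun r r' => BalTensor.hom_ext fun x y => by simp [lact_add]
      map_smul' := fun c r => BalTensor.hom_ext fun x y => by simp [lact_base] }
    (BalTensor.hom_ext fun x y => by simp [lact_one])
    (fun r r' => BalTensor.hom_ext fun x y => by simp [lact_mul])

/-- The right action on `X ⊗_R Y`, `(x ⊗ y) · r = x ⊗ y·r`. -/
def tensorActR (X Y : BimoduleCat k R) : Rᵐᵒᵖ →ₐ[k] Module.End k (tensorCarrier X Y) :=
  AlgHom.ofLinearMap
    { toFun := fun r => BalTensor.map _ _ LinearMap.id (ract Y (unop r))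
        (fun _ _ => rfl) (fun e m => (lact_ract _ _ _ _).symm)
      map_add' := fun r r' => BalTensor.hom_ext fun x y => by simp [ract_add]
      map_smul' := fun c r => BalTensor.hom_ext fun x y => by simp [ract_base] }
    (BalTensor.hom_ext fun x y => by simp [ract_one])
    (fun r r' => BalTensor.hom_ext fun x y => by simp [ract_mul])

/-- The action `(r ⊗ r') · (x ⊗ y) = r·x ⊗ y·r'` of the enveloping algebra on `X ⊗_R Y`. -/
def tensorAct (X Y : BimoduleCat k R) : Env k R →ₐ[k] Module.End k (tensorCarrier X Y) :=
  Algebra.TensorProduct.lift (tensorActL X Y) (tensorActR X Y)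
    (fun r r' => (BalTensor.hom_ext fun x y => by simp [tensorActL, tensorActR] :
      tensorActL X Y r * tensorActR X Y r' = tensorActR X Y r' * tensorActL X Y r))

/-- The bimodule `X ⊗_R Y`. -/
def tensorObj (X Y : BimoduleCat k R) : BimoduleCat k R :=
  letI : Module (Env k R) (tensorCarrier X Y) := Module.compHom _ (tensorAct X Y).toRingHom
  ModuleCat.of (Env k R) (tensorCarrier X Y)

/-- The element `x ⊗ y` of `X ⊗_R Y`. -/
def tm {X Y : BimoduleCat k R} (x : X) (y : Y) : tensorObj X Y :=
  BalTensor.mk (ract X) (lact Y) x y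

section
variable {X Y Z W X' Y' : BimoduleCat k R}

theorem tm_add_left (x x' : X) (y : Y) : tm (x + x') y = tm x y + tm x' y :=
  LinearMap.map_add₂ (BalTensor.mk (ract X) (lact Y)) x x' y

theorem tm_add_right (x : X) (y y' : Y) : tm x (y + y') = tm x y + tm x y' :=
  map_add (BalTensor.mk (ract X) (lact Y) x) y y'

theorem tm_balanced (x : X) (y : Y) (r : R) : tm (ract X r x) y = tm x (lact Y r y) :=
  BalTensor.mk_balanced _ _ _

theorem lact_tm (x : X) (y : Y) (r : R) : lact (tensorObj X Y) r (tm x y) = tm (lact X r x) y := by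
  have h : tensorAct X Y (r ⊗ₜ 1) = tensorActL X Y r :=
    (Algebra.TensorProduct.lift_tmul _ _ _ _ _).trans (by rw [map_one, mul_one])
  exact LinearMap.congr_fun h (BalTensor.mk _ _ x y)

theorem ract_tm (x : X) (y : Y) (r : R) : ract (tensorObj X Y) r (tm x y) = tm x (ract Y r y) := by
  have h : tensorAct X Y (1 ⊗ₜ op r) = tensorActR X Y (op r) :=
    (Algebra.TensorProduct.lift_tmul _ _ _ _ _).trans (by rw [map_one, one_mul])
  exact LinearMap.congr_fun h (BalTensor.mk _ _ x y)

@[elab_as_elim]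
theorem tm_ind {P : tensorObj X Y → Prop} (zero : P 0) (add : ∀ x y, P x → P y → P (x + y))
    (tmul : ∀ x y, P (tm x y)) (z : tensorObj X Y) : P z :=
  BalTensor.ind zero add tmul z

theorem base_smul_lact (X : BimoduleCat k R) (c : k) (x : X) :
    c • x = lact X (algebraMap k R c) x := rfl

theorem base_smul_ract (X : BimoduleCat k R) (c : k) (x : X) :
    c • x = ract X (algebraMap k R c) x := by
  rw [base_smul, ract_apply]
  congr 1
  exact Algebra.TensorProduct.algebraMap_apply' c

/-- Additive maps out of `X ⊗_R Y` from balanced biadditive maps. -/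
def tmLift {P : Type*} [AddCommGroup P] (f : X → Y → P)
    (hal : ∀ x x' y, f (x + x') y = f x y + f x' y) (har : ∀ x y y', f x (y + y') = f x y + f x y')
    (hf : ∀ r x y, f (ract X r x) y = f x (lact Y r y)) : tensorObj X Y →+ P :=
  BalTensor.liftAdd (ρ := ract X) (l := lact Y)
    (AddMonoidHom.mk' (fun x => AddMonoidHom.mk' (f x) (har x))
      (fun x x' => AddMonoidHom.ext fun y => hal x x' y))
    (fun c x y => by rw [base_smul_ract, base_smul_lact]; exact hf _ _ _) hf

@[simp]
theorem tmLift_tm {P : Type*} [AddCommGroup P] (f : X → Y → P) (hal har hf) (x : X) (y : Y) :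
    tmLift f hal har hf (tm x y) = f x y := rfl

/-- Bimodule maps out of `X ⊗_R Y` from balanced biadditive maps that are left and right linear. -/
def tmDesc (f : X → Y → Z)
    (hal : ∀ x x' y, f (x + x') y = f x y + f x' y) (har : ∀ x y y', f x (y + y') = f x y + f x y')
    (hf : ∀ r x y, f (ract X r x) y = f x (lact Y r y))
    (hl : ∀ r x y, f (lact X r x) y = lact Z r (f x y))
    (hr : ∀ r x y, f x (ract Y r y) = ract Z r (f x y)) : tensorObj X Y ⟶ Z :=
  mkHom (tmLift f hal har hf)
    (fun r z => by
      induction z using tm_ind with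
      | zero => simp
      | add a b ha hb => simp only [map_add, ha, hb]
      | tmul x y => rw [lact_tm, tmLift_tm, tmLift_tm, hl])
    (fun r z => by
      induction z using tm_ind with
      | zero => simp
      | add a b ha hb => simp only [map_add, ha, hb]
      | tmul x y => rw [ract_tm, tmLift_tm, tmLift_tm, hr])

@[simp]
theorem tmDesc_tm (f : X → Y → Z) (hal har hf hl hr) (x : X) (y : Y) :
    (tmDesc f hal har hf hl hr).hom (tm x y) = f x y := rfl

theorem tm_hom_ext {f g : tensorObj X Y ⟶ Z} (h : ∀ x y, f.hom (tm x y) = g.hom (tm x y)) :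
    f = g := by
  ext z
  induction z using tm_ind with
  | zero => simp
  | add a b ha hb => simp only [map_add, ha, hb]
  | tmul x y => exact h x y

/-- The tensor product of morphisms of bimodules. -/
def tensorMap (f : X ⟶ X') (g : Y ⟶ Y') : tensorObj X Y ⟶ tensorObj X' Y' :=
  tmDesc (fun x y => tm (f.hom x) (g.hom y))
    (fun x x' y => by rw [map_add, tm_add_left])
    (fun x y y' => by rw [map_add, tm_add_right])
    (fun r x y => by rw [hom_ract, hom_lact, tm_balanced])
    (fun r x y => by rw [hom_lact, lact_tm])
    (fun r x y => by rw [hom_ract, ract_tm])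

@[simp]
theorem tensorMap_tm (f : X ⟶ X') (g : Y ⟶ Y') (x : X) (y : Y) :
    (tensorMap f g).hom (tm x y) = tm (f.hom x) (g.hom y) := rfl

/-- The map `(x ⊗ y) ⊗ z ↦ x ⊗ (y ⊗ z)`. -/
def assocHom (X Y Z : BimoduleCat k R) :
    tensorObj (tensorObj X Y) Z ⟶ tensorObj X (tensorObj Y Z) :=
  tmDesc
    (fun w z => tmLift (fun x y => tm x (tm y z))
      (fun x x' y => tm_add_left _ _ _)
      (fun x y y' => by rw [tm_add_left, tm_add_right])
      (fun r x y => by rw [tm_balanced, lact_tm]) w)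
    (fun w w' z => map_add _ _ _)
    (fun w z z' => by
      induction w using tm_ind with
      | zero => simp
      | add a b ha hb => simp only [map_add, ha, hb]; abel
      | tmul x y => simp only [tmLift_tm, tm_add_right])
    (fun r w z => by
      induction w using tm_ind with
      | zero => simp
      | add a b ha hb => simp only [map_add, ha, hb]
      | tmul x y => simp only [ract_tm, tmLift_tm, tm_balanced])
    (fun r w z => by
      induction w using tm_ind with
      | zero => simp
      | add a b ha hb => simp only [map_add, ha, hb]
      | tmul x y => simp only [lact_tm, tmLift_tm])
    (fun r w z => by
      induction w using tm_ind with
      | zero => simp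
      | add a b ha hb => simp only [map_add, ha, hb]
      | tmul x y => simp only [ract_tm, tmLift_tm])

@[simp]
theorem assocHom_tm (x : X) (y : Y) (z : Z) :
    (assocHom X Y Z).hom (tm (tm x y) z) = tm x (tm y z) := rfl

/-- The map `x ⊗ (y ⊗ z) ↦ (x ⊗ y) ⊗ z`. -/
def assocInv (X Y Z : BimoduleCat k R) :
    tensorObj X (tensorObj Y Z) ⟶ tensorObj (tensorObj X Y) Z :=
  tmDesc
    (fun x w => tmLift (fun y z => tm (tm x y) z)
      (fun y y' z => by rw [tm_add_right, tm_add_left])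
      (fun y z z' => tm_add_right _ _ _)
      (fun r y z => by rw [← tm_balanced, ract_tm]) w)
    (fun x x' w => by
      induction w using tm_ind with
      | zero => simp
      | add a b ha hb => simp only [map_add, ha, hb]; abel
      | tmul y z => simp only [tmLift_tm, tm_add_left])
    (fun x w w' => map_add _ _ _)
    (fun r x w => by
      induction w using tm_ind with
      | zero => simp
      | add a b ha hb => simp only [map_add, ha, hb]
      | tmul y z => simp only [lact_tm, tmLift_tm, tm_balanced])
    (fun r x w => by
      induction w using tm_ind with
      | zero => simp
      | add a b ha hb => simp only [map_add, ha, hb]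
      | tmul y z => simp only [lact_tm, tmLift_tm])
    (fun r x w => by
      induction w using tm_ind with
      | zero => simp
      | add a b ha hb => simp only [map_add, ha, hb]
      | tmul y z => simp only [ract_tm, tmLift_tm])

@[simp]
theorem assocInv_tm (x : X) (y : Y) (z : Z) :
    (assocInv X Y Z).hom (tm x (tm y z)) = tm (tm x y) z := rfl

theorem tm_hom_ext₃ {f g : tensorObj (tensorObj X Y) Z ⟶ W}
    (h : ∀ x y z, f.hom (tm (tm x y) z) = g.hom (tm (tm x y) z)) : f = g :=
  tm_hom_ext fun w z => by
    induction w using tm_ind with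
    | zero =>
      have h0 : tm (0 : tensorObj X Y) z = 0 := by
        simpa using tm_add_left (0 : tensorObj X Y) 0 z
      rw [h0, map_zero, map_zero]
    | add a b ha hb => rw [tm_add_left, map_add, map_add, ha, hb]
    | tmul x y => exact h x y z

theorem tm_hom_ext₃' {f g : tensorObj X (tensorObj Y Z) ⟶ W}
    (h : ∀ x y z, f.hom (tm x (tm y z)) = g.hom (tm x (tm y z))) : f = g :=
  tm_hom_ext fun x w => by
    induction w using tm_ind with
    | zero =>
      have h0 : tm x (0 : tensorObj Y Z) = 0 := by
        simpa using tm_add_right x (0 : tensorObj Y Z) 0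
      rw [h0, map_zero, map_zero]
    | add a b ha hb => rw [tm_add_right, map_add, map_add, ha, hb]
    | tmul y z => exact h x y z

theorem tm_hom_ext₄ {V : BimoduleCat k R} {f g : tensorObj (tensorObj (tensorObj X Y) Z) W ⟶ V}
    (h : ∀ x y z w, f.hom (tm (tm (tm x y) z) w) = g.hom (tm (tm (tm x y) z) w)) : f = g :=
  tm_hom_ext₃ fun v z w => by
    induction v using tm_ind with
    | zero =>
      have h0 (z : Z) : tm (0 : tensorObj X Y) z = 0 := by
        simpa using tm_add_left (0 : tensorObj X Y) 0 z
      have h1 : tm (0 : tensorObj (tensorObj X Y) Z) w = 0 := by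
        simpa using tm_add_left (0 : tensorObj (tensorObj X Y) Z) 0 w
      rw [h0, h1, map_zero, map_zero]
    | add a b ha hb => rw [tm_add_left, tm_add_left, map_add, map_add, ha, hb]
    | tmul x y => exact h x y z w

variable (k R) in
/-- The action `(r ⊗ r') · x = r x r'` of the enveloping algebra on `R`. -/
def unitAct : Env k R →ₐ[k] Module.End k R :=
  Algebra.TensorProduct.lift (Algebra.lmul k R)
    (AlgHom.ofLinearMap
      ((LinearMap.mul k R).flip.comp (MulOpposite.opLinearEquiv k).symm.toLinearMap)
      (by ext; simp) (fun a b => by ext; simp [mul_assoc]))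
    (fun r r' => (by ext; simp [mul_assoc] : _ * _ = _ * _))

variable (k R) in
/-- The bimodule `R`. -/
def unitObj : BimoduleCat k R :=
  letI : Module (Env k R) R := Module.compHom _ (unitAct k R).toRingHom
  ModuleCat.of (Env k R) R

variable (k R) in
/-- The underlying group of the bimodule `R` is `R`. -/
def unitEquiv : R ≃+ unitObj k R := AddEquiv.refl R

theorem lact_unit (r x : R) :
    lact (unitObj k R) r (unitEquiv k R x) = unitEquiv k R (r * x) := by
  have h : unitAct k R (r ⊗ₜ 1) = Algebra.lmul k R r :=
    (Algebra.TensorProduct.lift_tmul _ _ _ _ _).trans (by rw [map_one, mul_one])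
  exact LinearMap.congr_fun h x

theorem ract_unit (r x : R) :
    ract (unitObj k R) r (unitEquiv k R x) = unitEquiv k R (x * r) := by
  have h : unitAct k R (1 ⊗ₜ op r) = (LinearMap.mul k R).flip r :=
    (Algebra.TensorProduct.lift_tmul _ _ _ _ _).trans (by rw [map_one, one_mul]; rfl)
  exact LinearMap.congr_fun h x

theorem unitEquiv_symm_lact (r : R) (x : unitObj k R) :
    (unitEquiv k R).symm (lact _ r x) = r * (unitEquiv k R).symm x := by
  obtain ⟨x, rfl⟩ := (unitEquiv k R).surjective x
  rw [lact_unit, AddEquiv.symm_apply_apply, AddEquiv.symm_apply_apply]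

theorem unitEquiv_symm_ract (r : R) (x : unitObj k R) :
    (unitEquiv k R).symm (ract _ r x) = (unitEquiv k R).symm x * r := by
  obtain ⟨x, rfl⟩ := (unitEquiv k R).surjective x
  rw [ract_unit, AddEquiv.symm_apply_apply, AddEquiv.symm_apply_apply]

theorem lact_mul_apply (X : BimoduleCat k R) (r r' : R) (x : X) :
    lact X (r * r') x = lact X r (lact X r' x) := by rw [lact_mul]; rfl

theorem ract_mul_apply (X : BimoduleCat k R) (r r' : R) (x : X) :
    ract X (r * r') x = ract X r' (ract X r x) := by rw [ract_mul]; rfl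

/-- The left unit isomorphism `r ⊗ x ↦ r · x`. -/
def leftUnit (X : BimoduleCat k R) : tensorObj (unitObj k R) X ≅ X where
  hom := tmDesc (fun r x => lact X ((unitEquiv k R).symm r) x)
    (fun r r' x => by rw [map_add, lact_add]; rfl)
    (fun r x x' => map_add _ _ _)
    (fun s r x => by rw [unitEquiv_symm_ract, lact_mul_apply])
    (fun s r x => by rw [unitEquiv_symm_lact, lact_mul_apply])
    (fun s r x => lact_ract _ _ _ _)
  inv := mkHom (AddMonoidHom.mk' (fun x => tm (unitEquiv k R 1) x)
      (fun x x' => tm_add_right _ _ _))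
    (fun r x => by
      simp only [AddMonoidHom.mk'_apply]
      rw [lact_tm, ← tm_balanced, lact_unit, ract_unit, one_mul, mul_one])
    (fun r x => by
      simp only [AddMonoidHom.mk'_apply]
      rw [ract_tm])
  hom_inv_id := tm_hom_ext fun r x => by
    change tm (unitEquiv k R 1) (lact X ((unitEquiv k R).symm r) x) = tm r x
    rw [← tm_balanced, ract_unit, one_mul, AddEquiv.apply_symm_apply]
  inv_hom_id := by
    ext x
    change lact X 1 x = x
    rw [lact_one]; rfl

/-- The right unit isomorphism `x ⊗ r ↦ x · r`. -/
def rightUnit (X : BimoduleCat k R) : tensorObj X (unitObj k R) ≅ X where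
  hom := tmDesc (fun x r => ract X ((unitEquiv k R).symm r) x)
    (fun x x' r => map_add _ _ _)
    (fun x r r' => by rw [map_add, ract_add]; rfl)
    (fun s x r => by rw [unitEquiv_symm_lact, ract_mul_apply])
    (fun s x r => (lact_ract _ _ _ _).symm)
    (fun s x r => by rw [unitEquiv_symm_ract, ract_mul_apply])
  inv := mkHom (AddMonoidHom.mk' (fun x => tm x (unitEquiv k R 1))
      (fun x x' => tm_add_left _ _ _))
    (fun r x => by
      simp only [AddMonoidHom.mk'_apply]
      rw [lact_tm])
    (fun r x => by
      simp only [AddMonoidHom.mk'_apply]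
      rw [ract_tm, tm_balanced, lact_unit, ract_unit, one_mul, mul_one])
  hom_inv_id := tm_hom_ext fun x r => by
    change tm (ract X ((unitEquiv k R).symm r) x) (unitEquiv k R 1) = tm x r
    rw [tm_balanced, lact_unit, mul_one, AddEquiv.apply_symm_apply]
  inv_hom_id := by
    ext x
    change ract X 1 x = x
    rw [ract_one]; rfl

end

instance : MonoidalCategoryStruct (BimoduleCat k R) where
  tensorObj := tensorObj
  whiskerLeft X _ _ f := tensorMap (𝟙 X) f
  whiskerRight f Y := tensorMap f (𝟙 Y)
  tensorHom f g := tensorMap f g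
  tensorUnit := unitObj k R
  associator X Y Z :=
    { hom := assocHom X Y Z
      inv := assocInv X Y Z
      hom_inv_id := tm_hom_ext₃ fun _ _ _ => rfl
      inv_hom_id := tm_hom_ext₃' fun _ _ _ => rfl }
  leftUnitor := leftUnit
  rightUnitor := rightUnit

instance : MonoidalCategory (BimoduleCat k R) where
  tensorHom_def _ _ := tm_hom_ext fun _ _ => rfl
  id_tensorHom_id _ _ := tm_hom_ext fun _ _ => rfl
  tensorHom_comp_tensorHom _ _ _ _ := tm_hom_ext fun _ _ => rfl
  whiskerLeft_id _ _ := tm_hom_ext fun _ _ => rfl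
  id_whiskerRight _ _ := tm_hom_ext fun _ _ => rfl
  associator_naturality _ _ _ := tm_hom_ext₃ fun _ _ _ => rfl
  leftUnitor_naturality f := tm_hom_ext fun r x => (hom_lact f ((unitEquiv k R).symm r) x).symm
  rightUnitor_naturality f := tm_hom_ext fun x r => (hom_ract f ((unitEquiv k R).symm r) x).symm
  pentagon _ _ _ _ := tm_hom_ext₄ fun _ _ _ _ => rfl
  triangle _ _ := tm_hom_ext₃ fun x r y => (tm_balanced x y ((unitEquiv k R).symm r)).symm

section
variable {X Y Z W X' Y' : BimoduleCat k R}

/-- The element `x ⊗ y` of `X ⊗ Y`. -/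
def tmul (x : X) (y : Y) : ↑(X ⊗ Y) := tm x y

theorem tmul_add_left (x x' : X) (y : Y) : tmul (x + x') y = tmul x y + tmul x' y :=
  tm_add_left x x' y

theorem tmul_add_right (x : X) (y y' : Y) : tmul x (y + y') = tmul x y + tmul x y' :=
  tm_add_right x y y'

theorem tmul_balanced (x : X) (y : Y) (r : R) : tmul (ract X r x) y = tmul x (lact Y r y) :=
  tm_balanced x y r

theorem lact_tmul (x : X) (y : Y) (r : R) : lact (X ⊗ Y) r (tmul x y) = tmul (lact X r x) y :=
  lact_tm x y r

theorem ract_tmul (x : X) (y : Y) (r : R) : ract (X ⊗ Y) r (tmul x y) = tmul x (ract Y r y) :=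
  ract_tm x y r

@[elab_as_elim]
theorem tmul_ind {P : ↑(X ⊗ Y) → Prop} (zero : P 0) (add : ∀ x y, P x → P y → P (x + y))
    (tmul : ∀ x y, P (tmul x y)) (z : ↑(X ⊗ Y)) : P z :=
  tm_ind zero add tmul z

/-- Additive maps out of `X ⊗ Y` from balanced biadditive maps. -/
def tmulLift {P : Type*} [AddCommGroup P] (f : X → Y → P)
    (hal : ∀ x x' y, f (x + x') y = f x y + f x' y) (har : ∀ x y y', f x (y + y') = f x y + f x y')
    (hf : ∀ r x y, f (ract X r x) y = f x (lact Y r y)) : ↑(X ⊗ Y) →+ P :=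
  tmLift f hal har hf

@[simp]
theorem tmulLift_tmul {P : Type*} [AddCommGroup P] (f : X → Y → P) (hal har hf) (x : X) (y : Y) :
    tmulLift f hal har hf (tmul x y) = f x y := rfl

theorem tmul_hom_ext {f g : X ⊗ Y ⟶ Z} (h : ∀ x y, f.hom (tmul x y) = g.hom (tmul x y)) :
    f = g := tm_hom_ext h

theorem tensorHom_tmul (f : X ⟶ X') (g : Y ⟶ Y') (x : X) (y : Y) :
    (f ⊗ₘ g).hom (tmul x y) = tmul (f.hom x) (g.hom y) := rfl

theorem whiskerRight_tmul (f : X ⟶ X') (x : X) (y : Y) :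
    (f ▷ Y).hom (tmul x y) = tmul (f.hom x) y := rfl

theorem whiskerLeft_tmul (g : Y ⟶ Y') (x : X) (y : Y) :
    (X ◁ g).hom (tmul x y) = tmul x (g.hom y) := rfl

theorem associator_tmul (x : X) (y : Y) (z : Z) :
    (α_ X Y Z).hom.hom (tmul (tmul x y) z) = tmul x (tmul y z) := rfl

variable (k R) in
/-- The underlying group of the tensor unit is `R`. -/
def unitEl : R ≃+ ↑(𝟙_ (BimoduleCat k R)) := unitEquiv k R

theorem lact_unitEl (r x : R) : lact (𝟙_ (BimoduleCat k R)) r (unitEl k R x) = unitEl k R (r * x) :=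
  lact_unit r x

theorem ract_unitEl (r x : R) : ract (𝟙_ (BimoduleCat k R)) r (unitEl k R x) = unitEl k R (x * r) :=
  ract_unit r x

theorem leftUnitor_tmul (r : R) (x : X) :
    (λ_ X).hom.hom (tmul (unitEl k R r) x) = lact X r x := rfl

theorem rightUnitor_tmul (x : X) (r : R) :
    (ρ_ X).hom.hom (tmul x (unitEl k R r)) = ract X r x := rfl

theorem tensorHom_add_left (f f' : X ⟶ X') (g : Y ⟶ Y') :
    (f + f') ⊗ₘ g = (f ⊗ₘ g) + (f' ⊗ₘ g) :=
  tmul_hom_ext fun x y => tmul_add_left (f.hom x) (f'.hom x) (g.hom y)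

theorem tensorHom_add_right (f : X ⟶ X') (g g' : Y ⟶ Y') :
    f ⊗ₘ (g + g') = (f ⊗ₘ g) + (f ⊗ₘ g') :=
  tmul_hom_ext fun x y => tmul_add_right (f.hom x) (g.hom y) (g'.hom y)

end

end Bimodules
/-- The `k`-linear structure on the category of modules over a `k`-algebra. -/
@[reducible]
def moduleLinear (k : Type w) [CommRing k] (E : Type u) [Ring E] [Algebra k E] :
    Linear k (ModuleCat.{u} E) :=
  letI (X : ModuleCat.{u} E) : Module k X := Module.compHom X (algebraMap k E)
  haveI (X : ModuleCat.{u} E) : SMulCommClass E k X :=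
    ⟨fun e c x => by
      change e • (algebraMap k E c • x) = algebraMap k E c • (e • x)
      rw [← mul_smul, ← mul_smul, Algebra.commutes]⟩
  { homModule := fun _ _ => inferInstance
    smul_comp := fun X Y Z c f g => by
      ext x
      exact g.hom.map_smul (algebraMap k E c) (f.hom x)
    comp_smul := fun _ _ _ _ _ _ => rfl }

instance (k : Type w) [CommRing k] (R : Type u) [Ring R] [Algebra k R] :
    Linear k (BimoduleCat k R) := moduleLinear k (Env k R)

/-- A `k`-algebra `A` with a `k`-algebra map `s ⊗ t : R ⊗ Rᵒᵖ → A`. -/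
structure EnvAlgebra (k : Type w) [CommRing k] (R : Type u) [Ring R] [Algebra k R] where
  /-- The underlying type of the algebra. -/
  carrier : Type u
  [ring : Ring carrier]
  [algebra : Algebra k carrier]
  /-- The map `s ⊗ t`. -/
  st : Env k R →ₐ[k] carrier

attribute [instance] EnvAlgebra.ring EnvAlgebra.algebra

namespace EnvAlgebra

variable {k : Type w} [CommRing k] {R : Type u} [Ring R] [Algebra k R] (A : EnvAlgebra k R)

/-- The source map. -/
def s (r : R) : A.carrier := A.st (r ⊗ₜ 1)

/-- The target map. -/
def t (r : R) : A.carrier := A.st (1 ⊗ₜ op r)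

/-- The category of left `A`-modules. -/
abbrev Mod : Type (u + 1) := ModuleCat.{u} A.carrier

instance : Linear k A.Mod := moduleLinear k A.carrier

/-- The forgetful functor from `A`-modules to bimodules, `r · v · r' = s(r) t(r') v`. -/
def forget : A.Mod ⥤ BimoduleCat k R := ModuleCat.restrictScalars A.st.toRingHom

instance : A.forget.Faithful := inferInstanceAs (ModuleCat.restrictScalars _).Faithful

/-- The underlying group does not change under the forgetful functor. -/
def toU (V : A.Mod) : V ≃+ A.forget.obj V := AddEquiv.refl V

variable {A}

@[simp]
theorem forget_map_toU {V W : A.Mod} (f : V ⟶ W) (v : V) :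
    (A.forget.map f).hom (A.toU V v) = A.toU W (f.hom v) := rfl

theorem smul_toU (V : A.Mod) (e : Env k R) (v : V) :
    e • A.toU V v = A.toU V (A.st e • v) := rfl

theorem lact_toU (V : A.Mod) (r : R) (v : V) :
    lact (A.forget.obj V) r (A.toU V v) = A.toU V (A.s r • v) := rfl

theorem ract_toU (V : A.Mod) (r : R) (v : V) :
    ract (A.forget.obj V) r (A.toU V v) = A.toU V (A.t r • v) := rfl

variable (A)

/-- `A` as an `R`-`R`-bimodule, `r · a · r' = s(r) t(r') a`. -/
def regular : BimoduleCat k R := A.forget.obj (ModuleCat.of A.carrier A.carrier)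

/-- Elements of `A` as elements of the bimodule `A`. -/
def el : A.carrier ≃+ A.regular := A.toU (ModuleCat.of A.carrier A.carrier)

/-- The morphism `a ↦ a • v` of bimodules. -/
def ev (V : A.Mod) (v : V) : A.regular ⟶ A.forget.obj V :=
  A.forget.map (ModuleCat.ofHom (LinearMap.toSpanSingleton A.carrier V v))

/-- The right multiplication `a ↦ a * b`, a morphism of bimodules. -/
def rmul (b : A.carrier) : A.regular ⟶ A.regular := A.ev (ModuleCat.of A.carrier A.carrier) b

variable {A}

@[simp]
theorem ev_el (V : A.Mod) (v : V) (a : A.carrier) :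
    (A.ev V v).hom (A.el a) = A.toU V (a • v) := rfl

@[simp]
theorem rmul_el (a b : A.carrier) : (A.rmul b).hom (A.el a) = A.el (a * b) := rfl

theorem lact_el (r : R) (a : A.carrier) : lact A.regular r (A.el a) = A.el (A.s r * a) := rfl

theorem ract_el (r : R) (a : A.carrier) : ract A.regular r (A.el a) = A.el (A.t r * a) := rfl

theorem ev_add (V : A.Mod) (v v' : V) : A.ev V (v + v') = A.ev V v + A.ev V v' := by
  ext a
  exact congrArg (A.toU V) (smul_add (A.el.symm a) v v')

theorem ev_smul (V : A.Mod) (b : A.carrier) (v : V) : A.ev V (b • v) = A.rmul b ≫ A.ev V v := by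
  ext a
  exact congrArg (A.toU V) (mul_smul (A.el.symm a) b v).symm

theorem ev_comp {V W : A.Mod} (f : V ⟶ W) (v : V) :
    A.ev V v ≫ A.forget.map f = A.ev W (f.hom v) := by
  ext a
  exact congrArg (A.toU W) (f.hom.map_smul (A.el.symm a) v)

/-- An element `z` of `A ⊗_R A` lies in `A ×_R A` if `z (t(r) ⊗ 1) = z (1 ⊗ s(r))` for
all `r`. -/
def IsTakeuchi (z : ↑(A.regular ⊗ A.regular)) : Prop :=
  ∀ r : R, (A.rmul (A.t r) ▷ A.regular).hom z = (A.regular ◁ A.rmul (A.s r)).hom z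

/-- Elements of `A ×_R A` act on `V ⊗_R W`, for `A`-modules `V` and `W`, by
`(∑ aᵢ ⊗ bᵢ) · (v ⊗ w) = ∑ aᵢ v ⊗ bᵢ w`. -/
def takeuchiAct {z : ↑(A.regular ⊗ A.regular)} (hz : IsTakeuchi z) (V W : A.Mod) :
    ↑(A.forget.obj V ⊗ A.forget.obj W) →+ ↑(A.forget.obj V ⊗ A.forget.obj W) :=
  tmulLift (fun v w => (A.ev V ((A.toU V).symm v) ⊗ₘ A.ev W ((A.toU W).symm w)).hom z)
    (fun v v' w => by rw [map_add, ev_add, tensorHom_add_left]; rfl)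
    (fun v w w' => by rw [map_add, ev_add, tensorHom_add_right]; rfl)
    (fun r v w => by
      obtain ⟨v, rfl⟩ := (A.toU V).surjective v
      obtain ⟨w, rfl⟩ := (A.toU W).surjective w
      rw [ract_toU, lact_toU]
      simp only [AddEquiv.symm_apply_apply]
      rw [ev_smul, ev_smul]
      have h1 : (A.rmul (A.t r) ≫ A.ev V v) ⊗ₘ A.ev W w =
        (A.rmul (A.t r) ▷ A.regular) ≫ (A.ev V v ⊗ₘ A.ev W w) := by simp [MonoidalCategory.tensorHom_def]
      have h2 : A.ev V v ⊗ₘ (A.rmul (A.s r) ≫ A.ev W w) =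
        (A.regular ◁ A.rmul (A.s r)) ≫ (A.ev V v ⊗ₘ A.ev W w) := by simp [MonoidalCategory.tensorHom_def']
      rw [h1, h2]
      exact congrArg (A.ev V v ⊗ₘ A.ev W w).hom (hz r))

@[simp]
theorem takeuchiAct_tmul {z : ↑(A.regular ⊗ A.regular)} (hz : IsTakeuchi z) (V W : A.Mod)
    (v : V) (w : W) :
    takeuchiAct hz V W (tmul (A.toU V v) (A.toU W w)) = (A.ev V v ⊗ₘ A.ev W w).hom z := rfl

variable (A) in
/-- The comultiplication of a comonoid structure on `A`, as a map of sets. -/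
def comul [ComonObj A.regular] (a : A.carrier) : ↑(A.regular ⊗ A.regular) :=
  (ComonObj.comul (X := A.regular)).hom (A.el a)

variable (A) in
/-- The counit of a comonoid structure on `A`, as a map of sets. -/
def counit [ComonObj A.regular] (a : A.carrier) : R :=
  (unitEl k R).symm ((ComonObj.counit (X := A.regular)).hom (A.el a))

end EnvAlgebra

/-- A left bialgebroid over `R`: a `k`-algebra `A` with a `k`-algebra map `s ⊗ t : R ⊗ Rᵒᵖ → A` and
a comonoid structure `(Δ, ε)` on the `R`-`R`-bimodule `A`. -/
structure LeftBialgebroid (k : Type w) [CommRing k] (R : Type u) [Ring R] [Algebra k R] extends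
    EnvAlgebra k R where
  /-- The comonoid structure on `A` in the monoidal category of `R`-`R`-bimodules. -/
  [comon : ComonObj toEnvAlgebra.regular]
  /-- The comultiplication takes values in `A ×_R A`. -/
  comul_takeuchi (a : carrier) : EnvAlgebra.IsTakeuchi (toEnvAlgebra.comul a)
  /-- `Δ(1) = 1 ⊗ 1`. -/
  comul_one : toEnvAlgebra.comul 1 = tmul (toEnvAlgebra.el 1) (toEnvAlgebra.el 1)
  /-- `Δ(ab) = Δ(a) Δ(b)`, for the product `(a ⊗ a') (b ⊗ b') = ab ⊗ a'b'` on `A ×_R A`. -/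
  comul_mul (a b : carrier) : toEnvAlgebra.comul (a * b) =
    EnvAlgebra.takeuchiAct (comul_takeuchi a) (ModuleCat.of carrier carrier)
      (ModuleCat.of carrier carrier) (toEnvAlgebra.comul b)
  /-- `ε(1) = 1`. -/
  counit_one : toEnvAlgebra.counit 1 = 1
  /-- `ε(a t(ε(b))) = ε(ab)`. -/
  counit_mul_t (a b : carrier) : toEnvAlgebra.counit (a * toEnvAlgebra.t (toEnvAlgebra.counit b)) =
    toEnvAlgebra.counit (a * b)
  /-- `ε(a s(ε(b))) = ε(ab)`. -/
  counit_mul_s (a b : carrier) : toEnvAlgebra.counit (a * toEnvAlgebra.s (toEnvAlgebra.counit b)) =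
    toEnvAlgebra.counit (a * b)

attribute [instance] LeftBialgebroid.comon

namespace EnvAlgebra

variable {k : Type w} [CommRing k] {R : Type u} [Ring R] [Algebra k R] {A : EnvAlgebra k R}

/-- A morphism of bimodules commuting with the actions of `A` is a morphism of `A`-modules. -/
def liftHom {V W : A.Mod} (f : A.forget.obj V ⟶ A.forget.obj W)
    (h : ∀ v : V, A.ev V v ≫ f = A.ev W ((A.toU W).symm (f.hom (A.toU V v)))) : V ⟶ W :=
  ModuleCat.ofHom
    { toFun := fun v => (A.toU W).symm (f.hom (A.toU V v))
      map_add' := fun v v' => by simp only [map_add]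
      map_smul' := fun a v => congrArg (fun g => (A.toU W).symm (g.hom (A.el a))) (h v) }

@[simp]
theorem forget_map_liftHom {V W : A.Mod} (f : A.forget.obj V ⟶ A.forget.obj W) (h) :
    A.forget.map (liftHom f h) = f := rfl

/-- An isomorphism of bimodules commuting with the actions of `A` is an isomorphism of
`A`-modules. -/
def liftIso {V W : A.Mod} (f : A.forget.obj V ≅ A.forget.obj W)
    (h : ∀ v : V, A.ev V v ≫ f.hom = A.ev W ((A.toU W).symm (f.hom.hom (A.toU V v)))) : V ≅ W where
  hom := liftHom f.hom h
  inv := liftHom f.inv (fun w => by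
    rw [← cancel_mono f.hom, Category.assoc, f.inv_hom_id, Category.comp_id, h]
    congr 1
    have := congrArg (fun g => (A.toU W).symm (g.hom (A.toU W w))) f.inv_hom_id
    exact this.symm)
  hom_inv_id := A.forget.map_injective (by simp)
  inv_hom_id := A.forget.map_injective (by simp)

@[simp]
theorem forget_map_liftIso_hom {V W : A.Mod} (f : A.forget.obj V ≅ A.forget.obj W) (h) :
    A.forget.map (liftIso f h).hom = f.hom := rfl

theorem takeuchiAct_natural {z : ↑(A.regular ⊗ A.regular)} (hz : IsTakeuchi z) {V W V' W' : A.Mod}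
    (f : V ⟶ V') (g : W ⟶ W') (x : ↑(A.forget.obj V ⊗ A.forget.obj W)) :
    takeuchiAct hz V' W' ((A.forget.map f ⊗ₘ A.forget.map g).hom x) =
      (A.forget.map f ⊗ₘ A.forget.map g).hom (takeuchiAct hz V W x) := by
  induction x using tmul_ind with
  | zero => simp
  | add x y hx hy => simp only [map_add, hx, hy]
  | tmul v w =>
    obtain ⟨v, rfl⟩ := (A.toU V).surjective v
    obtain ⟨w, rfl⟩ := (A.toU W).surjective w
    rw [tensorHom_tmul, forget_map_toU, forget_map_toU, takeuchiAct_tmul, takeuchiAct_tmul,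
      ← ev_comp, ← ev_comp, ← tensorHom_comp_tensorHom]
    rfl

end EnvAlgebra

/-- An additive isomorphism commuting with the two actions is an isomorphism of bimodules. -/
def mkIso {k : Type w} [CommRing k] {R : Type u} [Ring R] [Algebra k R] {X Y : BimoduleCat k R}
    (f : X ≃+ Y) (hl : ∀ r x, f (lact X r x) = lact Y r (f x))
    (hr : ∀ r x, f (ract X r x) = ract Y r (f x)) : X ≅ Y where
  hom := mkHom f.toAddMonoidHom hl hr
  inv := mkHom f.symm.toAddMonoidHom
    (fun r x => f.injective (by
      change f (f.symm _) = f (lact X r (f.symm x))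
      rw [hl, f.apply_symm_apply, f.apply_symm_apply]))
    (fun r x => f.injective (by
      change f (f.symm _) = f (ract X r (f.symm x))
      rw [hr, f.apply_symm_apply, f.apply_symm_apply]))
  hom_inv_id := by ext x; exact f.symm_apply_apply x
  inv_hom_id := by ext x; exact f.apply_symm_apply x

namespace LeftBialgebroid

open EnvAlgebra

variable {k : Type w} [CommRing k] {R : Type u} [Ring R] [Algebra k R] (A : LeftBialgebroid k R)

/-- The action `a · (v ⊗ w) = a₍₁₎ v ⊗ a₍₂₎ w`. -/
def tensorAct (V W : A.Mod) (a : A.carrier) :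
    ↑(A.forget.obj V ⊗ A.forget.obj W) →+ ↑(A.forget.obj V ⊗ A.forget.obj W) :=
  takeuchiAct (A.comul_takeuchi a) V W

variable {A}

theorem tensorAct_tmul (V W : A.Mod) (a : A.carrier) (v : V) (w : W) :
    A.tensorAct V W a (tmul (A.toU V v) (A.toU W w)) =
      (A.ev V v ⊗ₘ A.ev W w).hom (A.comul a) := rfl

theorem comul_add (a b : A.carrier) : A.comul (a + b) = A.comul a + A.comul b := by
  simp only [comul, map_add]

theorem ind₂ {V W : A.Mod} {P : ↑(A.forget.obj V ⊗ A.forget.obj W) → Prop} (zero : P 0)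
    (add : ∀ x y, P x → P y → P (x + y))
    (tmul : ∀ v w, P (tmul (A.toU V v) (A.toU W w))) (z) : P z :=
  tmul_ind zero add (fun v w => tmul ((A.toU V).symm v) ((A.toU W).symm w)) z

theorem tensorAct_one (V W : A.Mod) (z) : A.tensorAct V W 1 z = z := by
  induction z using ind₂ with
  | zero => simp
  | add x y hx hy => simp only [map_add, hx, hy]
  | tmul v w =>
    rw [tensorAct_tmul, A.comul_one, tensorHom_tmul, ev_el, ev_el, one_smul, one_smul]

theorem tensorAct_add (V W : A.Mod) (a b : A.carrier) (z) :
    A.tensorAct V W (a + b) z = A.tensorAct V W a z + A.tensorAct V W b z := by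
  induction z using ind₂ with
  | zero => simp
  | add x y hx hy => simp only [map_add, hx, hy]; abel
  | tmul v w => rw [tensorAct_tmul, tensorAct_tmul, tensorAct_tmul, comul_add, map_add]

theorem tensorAct_mul (V W : A.Mod) (a b : A.carrier) (z) :
    A.tensorAct V W (a * b) z = A.tensorAct V W a (A.tensorAct V W b z) := by
  induction z using ind₂ with
  | zero => simp
  | add x y hx hy => simp only [map_add, hx, hy]
  | tmul v w =>
    rw [tensorAct_tmul, tensorAct_tmul, A.comul_mul]
    exact (takeuchiAct_natural _ _ _ _).symm

variable (A) in
/-- The tensor product of `A`-modules. -/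
def tensorMod (V W : A.Mod) : A.Mod :=
  letI : Module A.carrier ↑(A.forget.obj V ⊗ A.forget.obj W) :=
    { smul := fun a z => A.tensorAct V W a z
      one_smul := tensorAct_one V W
      mul_smul := tensorAct_mul V W
      smul_zero := fun a => map_zero _
      smul_add := fun a => map_add _
      add_smul := tensorAct_add V W
      zero_smul := fun z => by
        change A.tensorAct V W 0 z = 0
        simpa using tensorAct_add V W 0 0 z }
  ModuleCat.of A.carrier ↑(A.forget.obj V ⊗ A.forget.obj W)

/-- The underlying group of the tensor product of `A`-modules is that of the tensor product of the
underlying bimodules. -/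
def tensorEquiv (V W : A.Mod) : ↑(A.forget.obj V ⊗ A.forget.obj W) ≃+ A.tensorMod V W :=
  AddEquiv.refl _

theorem smul_tensorEquiv (V W : A.Mod) (a : A.carrier) (z) :
    a • tensorEquiv V W z = tensorEquiv V W (A.tensorAct V W a z) := rfl

theorem comul_st (e : Env k R) : A.comul (A.st e) = e • tmul (A.el 1) (A.el 1) := by
  rw [← A.comul_one]
  have h : A.el (A.st e) = e • A.el 1 := by
    exact congrArg A.el (mul_one (A.st e)).symm
  rw [comul, h]
  exact (ComonObj.comul (X := A.regular)).hom.map_smul e _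

theorem tensorAct_st (V W : A.Mod) (e : Env k R) (z) : A.tensorAct V W (A.st e) z = e • z := by
  induction z using ind₂ with
  | zero => simp
  | add x y hx hy => simp only [map_add, hx, hy, smul_add]
  | tmul v w =>
    rw [tensorAct_tmul, comul_st]
    refine ((A.ev V v ⊗ₘ A.ev W w).hom.map_smul e _).trans ?_
    congr 1
    rw [tensorHom_tmul, ev_el, ev_el, one_smul, one_smul]

/-- The forgetful functor preserves tensor products: the identity as an isomorphism. -/
def forgetTensor (V W : A.Mod) :
    A.forget.obj V ⊗ A.forget.obj W ≅ A.forget.obj (A.tensorMod V W) :=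
  mkIso ((tensorEquiv V W).trans (A.toU _))
    (fun _ z => congrArg (fun y => A.toU _ (tensorEquiv V W y)) (tensorAct_st V W _ z).symm)
    (fun _ z => congrArg (fun y => A.toU _ (tensorEquiv V W y)) (tensorAct_st V W _ z).symm)

theorem forgetTensor_hom_apply (V W : A.Mod) (z) :
    (forgetTensor V W).hom.hom z = A.toU _ (tensorEquiv V W z) := rfl

theorem ev_tensor (V W : A.Mod) (v : V) (w : W) :
    A.ev (A.tensorMod V W) (tensorEquiv V W (tmul (A.toU V v) (A.toU W w))) =
      ComonObj.comul ≫ (A.ev V v ⊗ₘ A.ev W w) ≫ (forgetTensor V W).hom := rfl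

theorem counit_st (e : Env k R) (a : A.carrier) :
    (ComonObj.counit (X := A.regular)).hom (A.el (A.st e * a)) =
      e • (ComonObj.counit (X := A.regular)).hom (A.el a) :=
  (ComonObj.counit (X := A.regular)).hom.map_smul e (A.el a)

theorem counit_s (r : R) : A.counit (A.s r) = r := by
  have h := counit_st (A := A) (r ⊗ₜ 1) 1
  rw [mul_one] at h
  rw [counit, s, h]
  refine (congrArg (unitEl k R).symm ?_).trans ((unitEl k R).symm_apply_apply r)
  have h1 : (ComonObj.counit (X := A.regular)).hom (A.el 1) = unitEl k R 1 :=
    ((unitEl k R).symm_apply_eq).1 A.counit_one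
  rw [h1, ← lact_apply, lact_unitEl, mul_one]

theorem counit_add (a b : A.carrier) : A.counit (a + b) = A.counit a + A.counit b := by
  simp only [counit, map_add]

theorem s_add (r r' : R) : A.s (r + r') = A.s r + A.s r' := by
  simp only [s, TensorProduct.add_tmul, map_add]

theorem s_one : A.s 1 = 1 := map_one A.st

/-- `ε(a s(r)) = ε(a t(r))`. -/
theorem counit_mul_s_eq (a : A.carrier) (r : R) : A.counit (a * A.s r) = A.counit (a * A.t r) := by
  have h1 := A.counit_mul_s a (A.s r)
  have h2 := A.counit_mul_t a (A.s r)
  rw [counit_s] at h1 h2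
  rw [h2]

variable (A) in
/-- The unit `A`-module `R`, with `a · r = ε(a s(r))`. -/
def unitMod : A.Mod :=
  letI : Module A.carrier R :=
    { smul := fun a r => A.counit (a * A.s r)
      one_smul := fun r => by
        change A.counit (1 * A.s r) = r
        rw [one_mul, counit_s]
      mul_smul := fun a b r => by
        change A.counit (a * b * A.s r) = A.counit (a * A.s (A.counit (b * A.s r)))
        rw [A.counit_mul_s, mul_assoc]
      smul_zero := fun a => by
        change A.counit (a * A.s 0) = 0
        simp [s, counit]
      smul_add := fun a r r' => by
        change A.counit (a * A.s (r + r')) = A.counit (a * A.s r) + A.counit (a * A.s r')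
        rw [s_add, mul_add, counit_add]
      add_smul := fun a b r => by
        change A.counit ((a + b) * A.s r) = A.counit (a * A.s r) + A.counit (b * A.s r)
        rw [add_mul, counit_add]
      zero_smul := fun r => by
        change A.counit (0 * A.s r) = 0
        simp [counit] }
  ModuleCat.of A.carrier R

variable (A) in
/-- The underlying group of the unit `A`-module is that of the bimodule `R`. -/
def unitModEquiv : ↑(𝟙_ (BimoduleCat k R)) ≃+ A.unitMod := (unitEl k R).symm

theorem smul_unitModEquiv (a : A.carrier) (r : R) :
    a • A.unitModEquiv (unitEl k R r) = A.unitModEquiv (unitEl k R (A.counit (a * A.s r))) := rfl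

variable (A) in
/-- The forgetful functor preserves the unit: the identity as an isomorphism. -/
def forgetUnit : 𝟙_ (BimoduleCat k R) ≅ A.forget.obj A.unitMod :=
  mkIso (A.unitModEquiv.trans (A.toU _))
    (fun r x => by
      obtain ⟨x, rfl⟩ := (unitEl k R).surjective x
      rw [lact_unitEl, AddEquiv.trans_apply, AddEquiv.trans_apply, lact_toU, smul_unitModEquiv]
      have h : A.s r * A.s x = A.s (r * x) := by
        rw [s, s, s, ← map_mul, Algebra.TensorProduct.tmul_mul_tmul, one_mul]
      rw [h, counit_s])
    (fun r x => by
      obtain ⟨x, rfl⟩ := (unitEl k R).surjective x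
      rw [ract_unitEl, AddEquiv.trans_apply, AddEquiv.trans_apply, ract_toU, smul_unitModEquiv]
      congr 3
      have h1 : unitEl k R (A.counit (A.s x)) =
          (ComonObj.counit (X := A.regular)).hom (A.el (A.s x)) :=
        (unitEl k R).apply_symm_apply _
      rw [counit_s] at h1
      rw [counit, t, counit_st, ← h1, ← ract_apply, ract_unitEl]; rfl)

theorem ev_unit (r : R) :
    A.ev A.unitMod (A.unitModEquiv (unitEl k R r)) =
      A.rmul (A.s r) ≫ ComonObj.counit ≫ (forgetUnit A).hom := rfl

theorem ev_unit' (r : R) :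
    A.ev A.unitMod (A.unitModEquiv (unitEl k R r)) =
      A.rmul (A.t r) ≫ ComonObj.counit ≫ (forgetUnit A).hom := by
  ext a
  obtain ⟨a, rfl⟩ := A.el.surjective a
  exact congrArg (fun x => A.toU _ (A.unitModEquiv (unitEl k R x))) (counit_mul_s_eq a r)

theorem rmul_s_comul (r : R) : A.rmul (A.s r) ≫ ComonObj.comul =
    ComonObj.comul ≫ (A.rmul (A.s r) ▷ A.regular) := by
  ext a
  obtain ⟨a, rfl⟩ := A.el.surjective a
  change A.comul (a * A.s r) = (A.rmul (A.s r) ▷ A.regular).hom (A.comul a)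
  have h : A.comul (A.s r) = tmul (A.el (A.s r)) (A.el 1) := by
    rw [s, comul_st, ← lact_apply, lact_tmul, lact_el, mul_one, s]
  rw [A.comul_mul, h]
  refine (takeuchiAct_tmul (A.comul_takeuchi a) (ModuleCat.of A.carrier A.carrier)
    (ModuleCat.of A.carrier A.carrier) (A.s r) 1).trans ?_
  have h1 : A.ev (ModuleCat.of A.carrier A.carrier) (1 : A.carrier) = 𝟙 A.regular := by
    ext x
    exact congrArg A.el (mul_one (A.el.symm x))
  rw [h1]; rfl

theorem rmul_t_comul (r : R) : A.rmul (A.t r) ≫ ComonObj.comul =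
    ComonObj.comul ≫ (A.regular ◁ A.rmul (A.t r)) := by
  ext a
  obtain ⟨a, rfl⟩ := A.el.surjective a
  change A.comul (a * A.t r) = (A.regular ◁ A.rmul (A.t r)).hom (A.comul a)
  have h : A.comul (A.t r) = tmul (A.el 1) (A.el (A.t r)) := by
    rw [t, comul_st, ← ract_apply, ract_tmul, ract_el, mul_one, t]
  rw [A.comul_mul, h]
  refine (takeuchiAct_tmul (A.comul_takeuchi a) (ModuleCat.of A.carrier A.carrier)
    (ModuleCat.of A.carrier A.carrier) 1 (A.t r)).trans ?_
  have h1 : A.ev (ModuleCat.of A.carrier A.carrier) (1 : A.carrier) = 𝟙 A.regular := by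
    ext x
    exact congrArg A.el (mul_one (A.el.symm x))
  rw [h1]; rfl

/-- Linearity of a map out of a tensor product is checked on generators. -/
theorem lin_tensor {V W X : A.Mod} (f : A.forget.obj (A.tensorMod V W) ⟶ A.forget.obj X)
    (h : ∀ (v : V) (w : W),
      A.ev _ (tensorEquiv V W (tmul (A.toU V v) (A.toU W w))) ≫ f =
      A.ev X ((A.toU X).symm (f.hom (A.toU _ (tensorEquiv V W (tmul (A.toU V v) (A.toU W w)))))))
    (z : A.tensorMod V W) :
    A.ev _ z ≫ f = A.ev X ((A.toU X).symm (f.hom (A.toU _ z))) := by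
  obtain ⟨z, rfl⟩ := (tensorEquiv V W).surjective z
  induction z using ind₂ with
  | zero =>
    have h0 (Y : A.Mod) : A.ev Y 0 = 0 := by simpa using ev_add Y 0 0
    simp only [map_zero, h0, Limits.zero_comp]
  | add x y hx hy => simp only [map_add, ev_add, Preadditive.add_comp, hx, hy]
  | tmul v w => exact h v w

theorem tmul_zero_left {X Y : BimoduleCat k R} (y : Y) : tmul (0 : X) y = 0 := by
  simpa using tmul_add_left (0 : X) 0 y

/-- The tensor product of morphisms of `A`-modules. -/
def tensorModHom {V W V' W' : A.Mod} (f : V ⟶ V') (g : W ⟶ W') :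
    A.tensorMod V W ⟶ A.tensorMod V' W' :=
  liftHom ((forgetTensor V W).inv ≫ (A.forget.map f ⊗ₘ A.forget.map g) ≫
    (forgetTensor V' W').hom) (lin_tensor _ fun v w => by
      rw [ev_tensor]
      simp only [Category.assoc, Iso.hom_inv_id_assoc]
      rw [tensorHom_comp_tensorHom_assoc, ev_comp, ev_comp, ← ev_tensor]
      rfl)

theorem forget_map_tensorModHom {V W V' W' : A.Mod} (f : V ⟶ V') (g : W ⟶ W') :
    A.forget.map (tensorModHom f g) = (forgetTensor V W).inv ≫
      (A.forget.map f ⊗ₘ A.forget.map g) ≫ (forgetTensor V' W').hom := rfl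

/-- The associativity isomorphism of `A`-modules. -/
def assocMod (V W X : A.Mod) :
    A.tensorMod (A.tensorMod V W) X ≅ A.tensorMod V (A.tensorMod W X) :=
  liftIso (((forgetTensor _ _).symm ≪≫ ((forgetTensor _ _).symm ⊗ᵢ .refl _)) ≪≫
    α_ (A.forget.obj V) (A.forget.obj W) (A.forget.obj X) ≪≫
    ((.refl _ ⊗ᵢ forgetTensor _ _) ≪≫ forgetTensor _ _)) (lin_tensor _ fun z x => by
      obtain ⟨z, rfl⟩ := (tensorEquiv V W).surjective z
      induction z using ind₂ with
      | zero =>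
        have h0 (Y : A.Mod) : A.ev Y 0 = 0 := by simpa using ev_add Y 0 0
        simp only [map_zero, tmul_zero_left, h0, Limits.zero_comp]
      | add x y hx hy =>
        simp only [map_add, tmul_add_left, ev_add, Preadditive.add_comp, hx, hy]
      | tmul v w =>
        refine Eq.trans ?_ (ev_tensor V (A.tensorMod W X) v
          (tensorEquiv W X (tmul (A.toU W w) (A.toU X x)))).symm
        rw [ev_tensor, ev_tensor, ev_tensor]
        have e1 : ((ComonObj.comul ≫ (A.ev V v ⊗ₘ A.ev W w) ≫ (forgetTensor V W).hom) ⊗ₘ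
            A.ev X x) ≫ ((forgetTensor V W).inv ⊗ₘ 𝟙 (A.forget.obj X)) =
            (ComonObj.comul ▷ A.regular) ≫ ((A.ev V v ⊗ₘ A.ev W w) ⊗ₘ A.ev X x) := by
          rw [tensorHom_comp_tensorHom, Category.assoc, Category.assoc, Iso.hom_inv_id,
            Category.comp_id, Category.comp_id, ← tensorHom_id, tensorHom_comp_tensorHom,
            Category.id_comp]
        have e2 : (A.ev V v ⊗ₘ (ComonObj.comul ≫ (A.ev W w ⊗ₘ A.ev X x) ≫
            (forgetTensor W X).hom)) =
            (A.regular ◁ ComonObj.comul) ≫ (A.ev V v ⊗ₘ (A.ev W w ⊗ₘ A.ev X x)) ≫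
            (𝟙 (A.forget.obj V) ⊗ₘ (forgetTensor W X).hom) := by
          rw [tensorHom_comp_tensorHom, ← id_tensorHom, tensorHom_comp_tensorHom,
            Category.comp_id, Category.id_comp]
        simp only [Iso.trans_hom, Iso.symm_hom, tensorIso_hom, Iso.refl_hom, Category.assoc,
          Iso.hom_inv_id_assoc]
        rw [reassoc_of% e1, e2, associator_naturality_assoc]
        simp only [Category.assoc]
        rw [ComonObj.comul_assoc_assoc])

/-- The left unit isomorphism of `A`-modules. -/
def leftUnitMod (V : A.Mod) : A.tensorMod A.unitMod V ≅ V :=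
  liftIso (((forgetTensor _ _).symm ≪≫ ((forgetUnit A).symm ⊗ᵢ .refl _)) ≪≫ λ_ (A.forget.obj V))
    (lin_tensor _ fun r v => by
      obtain ⟨r, rfl⟩ := A.unitModEquiv.surjective r
      obtain ⟨r, rfl⟩ := (unitEl k R).surjective r
      refine Eq.trans ?_ (show A.rmul (A.s r) ≫ A.ev V v = _ from (ev_smul V (A.s r) v).symm)
      rw [ev_tensor, ev_unit]
      have e1 : ((A.rmul (A.s r) ≫ ComonObj.counit ≫ (forgetUnit A).hom) ⊗ₘ A.ev V v) ≫
          ((forgetUnit A).inv ⊗ₘ 𝟙 (A.forget.obj V)) =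
          (A.rmul (A.s r) ▷ A.regular) ≫ (ComonObj.counit ▷ A.regular) ≫
            (𝟙_ _ ◁ A.ev V v) := by
        rw [tensorHom_comp_tensorHom, ← tensorHom_id, ← tensorHom_id, ← id_tensorHom,
          tensorHom_comp_tensorHom, tensorHom_comp_tensorHom]
        simp only [Category.comp_id, Category.id_comp, Category.assoc, Iso.hom_inv_id]
      simp only [Iso.trans_hom, Iso.symm_hom, tensorIso_hom, Iso.refl_hom, Category.assoc,
        Iso.hom_inv_id_assoc]
      rw [reassoc_of% e1, leftUnitor_naturality, ← reassoc_of% (rmul_s_comul (A := A) r),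
        ComonObj.counit_comul_assoc, Iso.inv_hom_id_assoc])

/-- The right unit isomorphism of `A`-modules. -/
def rightUnitMod (V : A.Mod) : A.tensorMod V A.unitMod ≅ V :=
  liftIso (((forgetTensor _ _).symm ≪≫ (.refl _ ⊗ᵢ (forgetUnit A).symm)) ≪≫ ρ_ (A.forget.obj V))
    (lin_tensor _ fun v r => by
      obtain ⟨r, rfl⟩ := A.unitModEquiv.surjective r
      obtain ⟨r, rfl⟩ := (unitEl k R).surjective r
      refine Eq.trans ?_ (show A.rmul (A.t r) ≫ A.ev V v = _ from (ev_smul V (A.t r) v).symm)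
      rw [ev_tensor, ev_unit']
      have e1 : (A.ev V v ⊗ₘ (A.rmul (A.t r) ≫ ComonObj.counit ≫ (forgetUnit A).hom)) ≫
          (𝟙 (A.forget.obj V) ⊗ₘ (forgetUnit A).inv) =
          (A.regular ◁ A.rmul (A.t r)) ≫ (A.regular ◁ ComonObj.counit) ≫
            (A.ev V v ▷ 𝟙_ _) := by
        rw [tensorHom_comp_tensorHom, ← tensorHom_id, ← id_tensorHom, ← id_tensorHom,
          tensorHom_comp_tensorHom, tensorHom_comp_tensorHom]
        simp only [Category.comp_id, Category.id_comp, Category.assoc, Iso.hom_inv_id]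
      simp only [Iso.trans_hom, Iso.symm_hom, tensorIso_hom, Iso.refl_hom, Category.assoc,
        Iso.hom_inv_id_assoc]
      rw [reassoc_of% e1, rightUnitor_naturality, ← reassoc_of% (rmul_t_comul (A := A) r),
        ComonObj.comul_counit_assoc, Iso.inv_hom_id_assoc])

instance : MonoidalCategoryStruct A.Mod where
  tensorObj := A.tensorMod
  whiskerLeft V _ _ f := tensorModHom (𝟙 V) f
  whiskerRight f W := tensorModHom f (𝟙 W)
  tensorHom f g := tensorModHom f g
  tensorUnit := A.unitMod
  associator := assocMod
  leftUnitor := leftUnitMod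
  rightUnitor := rightUnitMod

variable (A) in
/-- The forgetful functor preserves the monoidal structure. -/
def inducingData : Monoidal.InducingFunctorData A.forget where
  μIso := forgetTensor
  εIso := forgetUnit A
  whiskerLeft_eq V _ _ f := by
    refine (forget_map_tensorModHom (𝟙 V) f).trans ?_
    rw [A.forget.map_id, id_tensorHom]
  whiskerRight_eq f W := by
    refine (forget_map_tensorModHom f (𝟙 W)).trans ?_
    rw [A.forget.map_id, tensorHom_id]
  tensorHom_eq _ _ := rfl
  associator_eq _ _ _ := rfl
  leftUnitor_eq _ := rfl
  rightUnitor_eq _ := rfl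

instance : MonoidalCategory A.Mod := Monoidal.induced A.forget A.inducingData

instance : A.forget.Monoidal := Monoidal.fromInducedMonoidal A.forget A.inducingData

end LeftBialgebroid
namespace EnvAlgebra

variable {k : Type w} [CommRing k] {R : Type u} [Ring R] [Algebra k R] (A : EnvAlgebra k R)

/-- The `k`-module `A ⊗_{R^e} X`, where `R^e = R ⊗ Rᵒᵖ` acts on `A` from the right through
`s ⊗ t`. -/
abbrev freeCarrier (X : BimoduleCat k R) : Type u :=
  BalTensor (fun e : Env k R => LinearMap.mulRight k (A.st e))
    (fun e : Env k R => Algebra.lsmul k k X e)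

/-- The universal balanced bilinear map `(a, x) ↦ a ⊗ x`. -/
def bmk (X : BimoduleCat k R) : A.carrier →ₗ[k] X →ₗ[k] A.freeCarrier X :=
  BalTensor.mk _ _

/-- The left action of `A` on `A ⊗_{R^e} X`. -/
def freeAct (X : BimoduleCat k R) : A.carrier →ₐ[k] Module.End k (A.freeCarrier X) :=
  AlgHom.ofLinearMap
    { toFun := fun a => BalTensor.map _ _ (LinearMap.mulLeft k a) LinearMap.id
        (fun e b => (mul_assoc a b (A.st e)).symm) (fun _ _ => rfl)
      map_add' := fun a b => BalTensor.hom_ext fun x y => by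
        change A.bmk X ((a + b) * x) y = A.bmk X (a * x) y + A.bmk X (b * x) y
        rw [add_mul]
        exact LinearMap.map_add₂ _ _ _ _
      map_smul' := fun c a => BalTensor.hom_ext fun x y => by
        change A.bmk X ((c • a) * x) y = c • A.bmk X (a * x) y
        rw [smul_mul_assoc]
        exact LinearMap.map_smul₂ _ _ _ _ }
    (BalTensor.hom_ext fun x y => by
      change A.bmk X (1 * x) y = A.bmk X x y
      rw [one_mul])
    (fun a b => BalTensor.hom_ext fun x y => by
      change A.bmk X (a * b * x) y = A.bmk X (a * (b * x)) y
      rw [mul_assoc])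

/-- The `A`-module `A ⊗_{R^e} X`. -/
def freeObj (X : BimoduleCat k R) : A.Mod :=
  letI : Module A.carrier (A.freeCarrier X) := Module.compHom _ (A.freeAct X).toRingHom
  ModuleCat.of A.carrier (A.freeCarrier X)

/-- The element `a ⊗ x` of `A ⊗_{R^e} X`. -/
def fr {X : BimoduleCat k R} (a : A.carrier) (x : X) : A.freeObj X := A.bmk X a x

variable {A}
variable {X Y : BimoduleCat k R}

theorem fr_add_left (a b : A.carrier) (x : X) : A.fr (a + b) x = A.fr a x + A.fr b x :=
  LinearMap.map_add₂ (A.bmk X) a b x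

theorem fr_add_right (a : A.carrier) (x y : X) : A.fr a (x + y) = A.fr a x + A.fr a y :=
  map_add (A.bmk X a) x y

theorem fr_balanced (a : A.carrier) (e : Env k R) (x : X) :
    A.fr (a * A.st e) x = A.fr a (e • x) :=
  BalTensor.mk_balanced (ρ := fun e : Env k R => LinearMap.mulRight k (A.st e))
    (l := fun e : Env k R => Algebra.lsmul k k X e) e a x

theorem smul_fr (a b : A.carrier) (x : X) : a • A.fr b x = A.fr (a * b) x := rfl

@[elab_as_elim]
theorem fr_ind {P : A.freeObj X → Prop} (zero : P 0) (add : ∀ x y, P x → P y → P (x + y))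
    (fr : ∀ a x, P (A.fr a x)) (z : A.freeObj X) : P z :=
  BalTensor.ind zero add fr z

theorem fr_hom_ext {V : A.Mod} {f g : A.freeObj X ⟶ V}
    (h : ∀ x, f.hom (A.fr 1 x) = g.hom (A.fr 1 x)) : f = g := by
  ext z
  induction z using fr_ind with
  | zero => simp
  | add x y hx hy => simp only [map_add, hx, hy]
  | fr a x => rw [← mul_one a, ← smul_fr, map_smul, map_smul, h]

/-- Additive maps out of `A ⊗_{R^e} X` from balanced biadditive maps. -/
def frLift {P : Type*} [AddCommGroup P] (f : A.carrier → X → P)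
    (hal : ∀ a b x, f (a + b) x = f a x + f b x) (har : ∀ a x y, f a (x + y) = f a x + f a y)
    (hf : ∀ a e x, f (a * A.st e) x = f a (e • x)) : A.freeObj X →+ P :=
  BalTensor.liftAdd (ρ := fun e : Env k R => LinearMap.mulRight k (A.st e))
    (l := fun e : Env k R => Algebra.lsmul k k X e)
    (AddMonoidHom.mk' (fun a => AddMonoidHom.mk' (f a) (har a))
      (fun a b => AddMonoidHom.ext fun x => hal a b x))
    (fun c a x => by
      change f (c • a) x = f a (c • x)
      rw [Algebra.smul_def, Algebra.commutes, ← A.st.commutes, hf, base_smul])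
    (fun e a x => hf a e x)

@[simp]
theorem frLift_fr {P : Type*} [AddCommGroup P] (f : A.carrier → X → P) (hal har hf) (a : A.carrier)
    (x : X) : frLift f hal har hf (A.fr a x) = f a x := rfl

/-- An additive map commuting with the actions, as a morphism of modules. -/
def linHom {E : Type u} [Ring E] {V W : ModuleCat.{u} E} (f : V →+ W)
    (h : ∀ (e : E) (v : V), f (e • v) = e • f v) : V ⟶ W :=
  ModuleCat.ofHom { f with map_smul' := h }

/-- An additive isomorphism commuting with the actions, as an isomorphism of modules. -/
def linIso {E : Type u} [Ring E] {V W : ModuleCat.{u} E} (f : V ≃+ W)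
    (h : ∀ (e : E) (v : V), f (e • v) = e • f v) : V ≅ W :=
  ({ f with map_smul' := h } : V ≃ₗ[E] W).toModuleIso

variable (A) in
/-- The morphism of `A`-modules `a ⊗ x ↦ a • f x`. -/
def freeDesc {V : A.Mod} (f : X ⟶ A.forget.obj V) : A.freeObj X ⟶ V :=
  linHom (frLift (fun a x => a • (A.toU V).symm (f.hom x))
      (fun a b x => add_smul a b _)
      (fun a x y => by rw [map_add, map_add, smul_add])
      (fun a e x => by
        rw [map_smul, mul_smul]
        rfl))
    (fun a z => by
      induction z using fr_ind with
      | zero => simp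
      | add x y hx hy => rw [smul_add, map_add, map_add, smul_add, hx, hy]
      | fr b x => exact mul_smul a b ((A.toU V).symm (f.hom x)))

@[simp]
theorem freeDesc_fr {V : A.Mod} (f : X ⟶ A.forget.obj V) (a : A.carrier) (x : X) :
    (A.freeDesc f).hom (A.fr a x) = a • (A.toU V).symm (f.hom x) := rfl

variable (A) in
/-- The morphism of bimodules `x ↦ 1 ⊗ x`. -/
def freeUnit (X : BimoduleCat k R) : X ⟶ A.forget.obj (A.freeObj X) :=
  linHom ((A.toU _).toAddMonoidHom.comp (AddMonoidHom.mk' (fun x => A.fr 1 x) (fr_add_right 1)))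
    (fun e x => by
      change A.toU _ (A.fr 1 (e • x)) = A.toU _ (A.st e • A.fr 1 x)
      rw [← fr_balanced, one_mul, smul_fr, mul_one])

@[simp]
theorem freeUnit_apply (x : X) : (A.freeUnit X).hom x = A.toU _ (A.fr 1 x) := rfl

variable (A)

/-- The functor `A ⊗_{R^e} (-)` from bimodules to `A`-modules. -/
def free : BimoduleCat k R ⥤ A.Mod where
  obj := A.freeObj
  map f := A.freeDesc (f ≫ A.freeUnit _)
  map_id X := fr_hom_ext fun x => one_smul A.carrier (A.fr 1 x)
  map_comp f g := fr_hom_ext fun x => by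
    change _ = (A.freeDesc (g ≫ A.freeUnit _)).hom ((A.freeDesc (f ≫ A.freeUnit _)).hom (A.fr 1 x))
    have h : (A.freeDesc (f ≫ A.freeUnit _)).hom (A.fr 1 x) = A.fr 1 (f.hom x) :=
      (freeDesc_fr _ 1 x).trans (one_smul A.carrier (A.fr 1 (f.hom x)))
    rw [h]
    rfl

variable {A} in
@[simp]
theorem free_map_fr (f : X ⟶ Y) (a : A.carrier) (x : X) :
    (A.free.map f).hom (A.fr a x) = A.fr a (f.hom x) := by
  refine (freeDesc_fr (f ≫ A.freeUnit Y) a x).trans ?_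
  exact (smul_fr a 1 (f.hom x)).trans (by rw [mul_one])

/-- The functor `A ⊗_{R^e} (-)` is left adjoint to the forgetful functor, with unit `x ↦ 1 ⊗ x`
and counit `a ⊗ v ↦ a • v`. -/
def adj : A.free ⊣ A.forget :=
  Adjunction.mkOfUnitCounit
    { unit :=
        { app := A.freeUnit
          naturality := fun X Y f => by
            ext x
            exact congrArg (A.toU _) (free_map_fr f 1 x).symm }
      counit :=
        { app := fun V => A.freeDesc (𝟙 (A.forget.obj V))
          naturality := fun V W f => fr_hom_ext fun x => by
            refine (congrArg (A.freeDesc (𝟙 (A.forget.obj W))).hom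
              (free_map_fr (A.forget.map f) 1 x)).trans ?_
            exact (f.hom.map_smul 1 ((A.toU V).symm x)).symm }
      left_triangle := by
        ext X : 2
        refine fr_hom_ext fun x => ?_
        exact (congrArg (A.freeDesc (𝟙 (A.forget.obj (A.freeObj X)))).hom
          (free_map_fr (A.freeUnit X) 1 x)).trans (one_smul A.carrier (A.fr 1 x))
      right_triangle := by
        ext V x
        exact one_smul A.carrier ((A.toU V).symm x) }

/-- The monad `A ⊗_{R^e} (-)` on the category of bimodules. -/
def monad : Monad (BimoduleCat k R) := A.adj.toMonad

/-- The underlying group of `A ⊗_{R^e} X`. -/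
def fm (X : BimoduleCat k R) : A.freeObj X ≃+ A.monad.obj X := A.toU (A.freeObj X)

variable {A}

/-- The unit of the monad is `x ↦ 1 ⊗ x`. -/
theorem monad_η (X : BimoduleCat k R) (x : X) :
    (A.monad.η.app X).hom x = A.fm X (A.fr 1 x) := rfl

/-- The multiplication of the monad is `a ⊗ (b ⊗ x) ↦ ab ⊗ x`. -/
theorem monad_μ (X : BimoduleCat k R) (a b : A.carrier) (x : X) :
    (A.monad.μ.app X).hom
      (A.fm (A.monad.obj X) (A.fr a (A.fm X (A.fr b x)))) =
      A.fm X (A.fr (a * b) x) := rfl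

theorem monad_map (f : X ⟶ Y) (a : A.carrier) (x : X) :
    (A.monad.map f).hom (A.fm X (A.fr a x)) = A.fm Y (A.fr a (f.hom x)) :=
  congrArg (A.fm Y) (free_map_fr f a x)

variable (A) in
/-- The structure map `a ⊗ v ↦ a • v` of the algebra over the monad given by an `A`-module. -/
def act (V : A.Mod) : A.monad.obj (A.forget.obj V) ⟶ A.forget.obj V :=
  A.forget.map (A.adj.counit.app V)

@[simp]
theorem act_fr (V : A.Mod) (a : A.carrier) (v : V) :
    (A.act V).hom (A.fm _ (A.fr a (A.toU V v))) = A.toU V (a • v) := rfl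

theorem monad_hom_ext {Z : BimoduleCat k R} {f g : A.monad.obj X ⟶ Z}
    (h : ∀ a x, f.hom (A.fm X (A.fr a x)) = g.hom (A.fm X (A.fr a x))) :
    f = g := by
  ext z
  obtain ⟨z, rfl⟩ := (A.fm X).surjective z
  induction z using fr_ind with
  | zero => rw [map_zero, map_zero, map_zero]
  | add x y hx hy => rw [map_add, map_add, map_add, hx, hy]
  | fr a x => exact h a x

theorem act_natural {V W : A.Mod} (f : V ⟶ W) :
    A.monad.map (A.forget.map f) ≫ A.act W = A.act V ≫ A.forget.map f :=
  (A.forget.map_comp _ _).symm.trans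
    ((congrArg A.forget.map (A.adj.counit.naturality f)).trans (A.forget.map_comp _ _))

/-- A morphism of bimodules commuting with the structure maps is a morphism of `A`-modules. -/
def homOfAct {V W : A.Mod} (f : A.forget.obj V ⟶ A.forget.obj W)
    (h : A.monad.map f ≫ A.act W = A.act V ≫ f) : V ⟶ W :=
  liftHom f fun v => by
    ext a
    have := congrArg (fun g => g.hom (A.fm _ (A.fr (A.el.symm a) (A.toU V v)))) h
    exact ((congrArg (A.act W).hom (monad_map f (A.el.symm a) (A.toU V v))).symm.trans this).symm

@[simp]
theorem forget_map_homOfAct {V W : A.Mod} (f : A.forget.obj V ⟶ A.forget.obj W) (h) :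
    A.forget.map (homOfAct f h) = f := rfl

variable (A) in
/-- An algebra over the monad `A ⊗_{R^e} (-)` as an `A`-module, with `a • y = p (a ⊗ y)`. -/
def ofAct (Y : BimoduleCat k R) (p : A.monad.obj Y ⟶ Y) (unit : A.monad.η.app Y ≫ p = 𝟙 Y)
    (assoc : A.monad.μ.app Y ≫ p = A.monad.map p ≫ p) : A.Mod :=
  letI : Module A.carrier Y :=
    { smul := fun a y => p.hom (A.fm Y (A.fr a y))
      one_smul := fun y => congrArg (fun g => g.hom y) unit
      mul_smul := fun a b y => (congrArg (fun g => g.hom (A.fm _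
        (A.fr a (A.fm Y (A.fr b y))))) assoc).trans
          (congrArg p.hom (monad_map p a (A.fm Y (A.fr b y))))
      smul_zero := fun a => by
        have h : A.fr a (0 : Y) = 0 := by simpa using fr_add_right a (0 : Y) 0
        change p.hom (A.fm Y (A.fr a 0)) = 0
        rw [h, map_zero, map_zero]
      smul_add := fun a x y => by
        change p.hom (A.fm Y (A.fr a (x + y))) =
          p.hom (A.fm Y (A.fr a x)) + p.hom (A.fm Y (A.fr a y))
        rw [fr_add_right, map_add, map_add]
      add_smul := fun a b y => by
        change p.hom (A.fm Y (A.fr (a + b) y)) =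
          p.hom (A.fm Y (A.fr a y)) + p.hom (A.fm Y (A.fr b y))
        rw [fr_add_left, map_add, map_add]
      zero_smul := fun y => by
        have h : A.fr 0 y = 0 := by simpa using fr_add_left (A := A) 0 0 y
        change p.hom (A.fm Y (A.fr 0 y)) = 0
        rw [h, map_zero, map_zero] }
  ModuleCat.of A.carrier Y

/-- The underlying bimodule of an algebra over the monad does not change: the identity as an
isomorphism. -/
def ofActIso (Y : BimoduleCat k R) (p : A.monad.obj Y ⟶ Y) (unit) (assoc) :
    A.forget.obj (A.ofAct Y p unit assoc) ≅ Y :=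
  linIso (AddEquiv.refl Y : A.forget.obj (A.ofAct Y p unit assoc) ≃+ Y) (fun e (y : Y) => by
    change p.hom (A.fm Y (A.fr (A.st e) y)) = e • y
    rw [← one_mul (A.st e), fr_balanced]
    exact congrArg (fun g => g.hom (e • y)) unit)

theorem act_ofAct (Y : BimoduleCat k R) (p : A.monad.obj Y ⟶ Y) (unit) (assoc) :
    A.act (A.ofAct Y p unit assoc) ≫ (ofActIso Y p unit assoc).hom =
      A.monad.map (ofActIso Y p unit assoc).hom ≫ p :=
  monad_hom_ext fun a x => (congrArg p.hom (monad_map (ofActIso Y p unit assoc).hom a x)).symm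

theorem act_unit (V : A.Mod) : A.monad.η.app (A.forget.obj V) ≫ A.act V = 𝟙 _ :=
  A.adj.right_triangle_components V

theorem act_assoc (V : A.Mod) :
    A.monad.μ.app (A.forget.obj V) ≫ A.act V = A.monad.map (A.act V) ≫ A.act V :=
  (act_natural (A.adj.counit.app V)).symm

end EnvAlgebra

section General

open Functor.LaxMonoidal Functor.OplaxMonoidal

variable {M N M' N' : Type*} [Category* M] [Category* N] [Category* M'] [Category* N']
  [MonoidalCategory M] [MonoidalCategory N] [MonoidalCategory M'] [MonoidalCategory N']

/-- For lax monoidal functors `G` and `H` and lax comonoidal functors `T` and `S`, the natural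
transformation `φ : SG → HT` is ambimonoidal. -/
structure Ambimonoidal {G : M ⥤ N} {H : M' ⥤ N'} {T : M ⥤ M'} {S : N ⥤ N'} [G.LaxMonoidal]
    [H.LaxMonoidal] [T.OplaxMonoidal] [S.OplaxMonoidal] (φ : G ⋙ S ⟶ T ⋙ H) : Prop where
  tensor (X Y : M) : S.map (μ G X Y) ≫ φ.app (X ⊗ Y) ≫ H.map (δ T X Y) =
    δ S (G.obj X) (G.obj Y) ≫ (φ.app X ⊗ₘ φ.app Y) ≫ μ H (T.obj X) (T.obj Y)
  unit : S.map (ε G) ≫ φ.app (𝟙_ M) ≫ H.map (η T) = η S ≫ ε H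

/-- For a monad `T` on `M` and a monad `S` on `N`, the pair of the functor `G` and the natural
transformation `φ : SG → GT` is a monad morphism. -/
structure IsMonadMorphism (T : Monad M) (S : Monad N) (G : M ⥤ N)
    (φ : G ⋙ S.toFunctor ⟶ T.toFunctor ⋙ G) : Prop where
  mul (X : M) : S.μ.app (G.obj X) ≫ φ.app X =
    S.map (φ.app X) ≫ φ.app (T.obj X) ≫ G.map (T.μ.app X)
  unit (X : M) : S.η.app (G.obj X) ≫ φ.app X = G.map (T.η.app X)

/-- Equality of lax monoidal functors: the underlying functors and the lax monoidal structures
coincide. -/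
def LaxMonoidalEq (F G : M ⥤ N) [F.LaxMonoidal] [G.LaxMonoidal] : Prop :=
  ∃ h : F = G, NatTrans.IsMonoidal (eqToHom h)

/-- The lax monoidal structure on `L` lifted from a lax monoidal structure on `PL`, for a faithful
monoidal functor `P`. -/
@[reducible]
def liftLaxMonoidal {L : M ⥤ N} {P : N ⥤ N'} [P.Faithful] [P.Monoidal] {Q : M ⥤ N'}
    [Q.LaxMonoidal] (i : L ⋙ P ≅ Q) (ε' : 𝟙_ N ⟶ L.obj (𝟙_ M))
    (μ' : ∀ X Y, L.obj X ⊗ L.obj Y ⟶ L.obj (X ⊗ Y))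
    (hε : P.map ε' ≫ i.hom.app _ = η P ≫ ε Q)
    (hμ : ∀ X Y, P.map (μ' X Y) ≫ i.hom.app _ =
      δ P _ _ ≫ (i.hom.app X ⊗ₘ i.hom.app Y) ≫ μ Q X Y) : L.LaxMonoidal where
  ε := ε'
  μ := μ'
  μ_natural_left {X Y} f Z := P.map_injective (by
    rw [← cancel_mono (i.hom.app _), Functor.map_comp, Functor.map_comp, Category.assoc,
      Category.assoc, hμ]
    have h := i.hom.naturality (f ▷ Z)
    have h2 := i.hom.naturality f
    dsimp at h h2
    rw [h, reassoc_of% (hμ X Z), ← δ_natural_left_assoc, ← μ_natural_left]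
    simp only [← tensorHom_id, tensorHom_comp_tensorHom_assoc, Category.id_comp, Category.comp_id,
      h2])
  μ_natural_right {X Y} Z f := P.map_injective (by
    rw [← cancel_mono (i.hom.app _), Functor.map_comp, Functor.map_comp, Category.assoc,
      Category.assoc, hμ]
    have h := i.hom.naturality (Z ◁ f)
    have h2 := i.hom.naturality f
    dsimp at h h2
    rw [h, reassoc_of% (hμ Z X), ← δ_natural_right_assoc, ← μ_natural_right]
    simp only [← id_tensorHom, tensorHom_comp_tensorHom_assoc, Category.id_comp, Category.comp_id,
      h2])
  associativity X Y Z := P.map_injective (by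
    have h := i.hom.naturality (α_ X Y Z).hom
    dsimp at h
    rw [← cancel_mono (i.hom.app _)]
    simp only [Functor.map_comp, Category.assoc, h, hμ, reassoc_of% hμ]
    rw [← δ_natural_left_assoc, ← δ_natural_right_assoc]
    have e1 : P.map (μ' X Y) ▷ P.obj (L.obj Z) ≫ (i.hom.app (X ⊗ Y) ⊗ₘ i.hom.app Z) =
        δ P _ _ ▷ P.obj (L.obj Z) ≫ ((i.hom.app X ⊗ₘ i.hom.app Y) ⊗ₘ i.hom.app Z) ≫
          μ Q X Y ▷ Q.obj Z := by
      simp only [← tensorHom_id, tensorHom_comp_tensorHom, Category.id_comp, Category.comp_id, hμ]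
    have e2 : P.obj (L.obj X) ◁ P.map (μ' Y Z) ≫ (i.hom.app X ⊗ₘ i.hom.app (Y ⊗ Z)) =
        P.obj (L.obj X) ◁ δ P _ _ ≫ (i.hom.app X ⊗ₘ (i.hom.app Y ⊗ₘ i.hom.app Z)) ≫
          Q.obj X ◁ μ Q Y Z := by
      simp only [← id_tensorHom, tensorHom_comp_tensorHom, Category.id_comp, Category.comp_id, hμ]
    rw [reassoc_of% e1, reassoc_of% e2, Functor.LaxMonoidal.associativity,
      ← Functor.OplaxMonoidal.associativity_assoc,
      associator_naturality_assoc])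
  left_unitality X := by
    rw [← cancel_epi (λ_ _).inv, Iso.inv_hom_id]
    refine P.map_injective ?_
    have h := i.hom.naturality (λ_ X).hom
    dsimp at h
    rw [← cancel_mono (i.hom.app _)]
    simp only [Functor.map_comp, Category.assoc, h, reassoc_of% hμ]
    rw [← δ_natural_left_assoc]
    have e1 : P.map ε' ▷ P.obj (L.obj X) ≫ (i.hom.app (𝟙_ M) ⊗ₘ i.hom.app X) =
        η P ▷ P.obj (L.obj X) ≫ 𝟙_ N' ◁ i.hom.app X ≫ ε Q ▷ Q.obj X := by
      simp only [← tensorHom_id, ← id_tensorHom, tensorHom_comp_tensorHom, Category.id_comp,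
        Category.comp_id, hε]
    rw [reassoc_of% e1, ← Functor.LaxMonoidal.left_unitality, leftUnitor_naturality,
      ← Functor.OplaxMonoidal.left_unitality_assoc, Iso.inv_hom_id_assoc, P.map_id,
      Category.id_comp]
  right_unitality X := by
    rw [← cancel_epi (ρ_ _).inv, Iso.inv_hom_id]
    refine P.map_injective ?_
    have h := i.hom.naturality (ρ_ X).hom
    dsimp at h
    rw [← cancel_mono (i.hom.app _)]
    simp only [Functor.map_comp, Category.assoc, h, reassoc_of% hμ]
    rw [← δ_natural_right_assoc]
    have e1 : P.obj (L.obj X) ◁ P.map ε' ≫ (i.hom.app X ⊗ₘ i.hom.app (𝟙_ M)) =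
        P.obj (L.obj X) ◁ η P ≫ i.hom.app X ▷ 𝟙_ N' ≫ Q.obj X ◁ ε Q := by
      simp only [← tensorHom_id, ← id_tensorHom, tensorHom_comp_tensorHom, Category.id_comp,
        Category.comp_id, hε]
    rw [reassoc_of% e1, ← Functor.LaxMonoidal.right_unitality, rightUnitor_naturality,
      ← Functor.OplaxMonoidal.right_unitality_assoc, Iso.inv_hom_id_assoc, P.map_id,
      Category.id_comp]

end General

namespace LeftBialgebroid

open EnvAlgebra Functor.LaxMonoidal Functor.OplaxMonoidal

section
variable {k : Type w} [CommRing k] {R : Type u} [Ring R] [Algebra k R] (A : LeftBialgebroid k R)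

/-- The lax comonoidal structure on `A ⊗_{R^e} (-)`, as the left adjoint of a monoidal functor. -/
instance : A.free.OplaxMonoidal := A.adj.leftAdjointOplaxMonoidal

instance : A.adj.IsMonoidal := inferInstance

/-- The lax comonoidal structure of the bimonad `A ⊗_{R^e} (-)`. -/
instance : A.monad.toFunctor.OplaxMonoidal := inferInstanceAs (A.free ⋙ A.forget).OplaxMonoidal

variable {A}

theorem δ_monad (X Y : BimoduleCat k R) : δ A.monad.toFunctor X Y =
    A.forget.map (δ A.free X Y) ≫ δ A.forget _ _ := rfl

theorem η_monad : η A.monad.toFunctor = A.forget.map (η A.free) ≫ η A.forget := rfl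

theorem homEquiv_symm_fr {X : BimoduleCat k R} {V : A.Mod} (f : X ⟶ A.forget.obj V) (a : A.carrier)
    (x : X) : ((A.adj.homEquiv X V).symm f).hom (A.fr a x) = a • (A.toU V).symm (f.hom x) := by
  rw [Adjunction.homEquiv_counit]
  exact congrArg (A.adj.counit.app V).hom (free_map_fr f a x)

/-- The lax comonoidal structure is `a ⊗ (x ⊗ y) ↦ (a₍₁₎ ⊗ x) ⊗ (a₍₂₎ ⊗ y)`. -/
theorem δ_monad_fr (X Y : BimoduleCat k R) (a : A.carrier) (x : X) (y : Y) :
    (δ A.monad.toFunctor X Y).hom (A.fm _ (A.fr a (tmul x y))) =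
      (A.ev (A.freeObj X) (A.fr 1 x) ⊗ₘ A.ev (A.freeObj Y) (A.fr 1 y)).hom (A.comul a) :=
  congrArg (fun z => (δ A.forget _ _).hom (A.toU _ z)) (homEquiv_symm_fr (A := A)
    ((A.adj.unit.app X ⊗ₘ A.adj.unit.app Y) ≫ μ A.forget (A.free.obj X) (A.free.obj Y)) a
    (tmul x y))

/-- The counit of the comonoidal structure is `a ⊗ r ↦ ε(a s(r))`. -/
theorem η_monad_fr (a : A.carrier) (r : R) :
    (η A.monad.toFunctor).hom (A.fm _ (A.fr a (unitEl k R r))) =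
      unitEl k R (A.counit (a * A.s r)) :=
  congrArg (fun z => (η A.forget).hom (A.toU _ z))
    (homEquiv_symm_fr (A := A) (ε A.forget) a (unitEl k R r))

theorem map_μ_act (V W : A.Mod) : A.monad.map (μ A.forget V W) ≫ A.act (V ⊗ W) =
    δ A.monad.toFunctor _ _ ≫ (A.act V ⊗ₘ A.act W) ≫ μ A.forget V W := by
  have h := congrArg A.forget.map (A.adj.map_μ_comp_counit_app_tensor V W)
  rw [Functor.map_comp, Functor.map_comp, ← Category.comp_id (A.forget.map (_ ⊗ₘ _)),
    ← Functor.Monoidal.δ_μ, ← δ_natural_assoc] at h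
  exact h.trans (Category.assoc _ _ _).symm

theorem map_ε_act : A.monad.map (ε A.forget) ≫ A.act (𝟙_ A.Mod) =
    η A.monad.toFunctor ≫ ε A.forget := by
  have h := congrArg A.forget.map A.adj.map_ε_comp_counit_app_unit
  rw [Functor.map_comp, ← Category.comp_id (A.forget.map (η A.free)),
    ← Functor.Monoidal.η_ε] at h
  exact h.trans (Category.assoc _ _ _).symm

end

end LeftBialgebroid

section Morphisms

open EnvAlgebra Functor.LaxMonoidal Functor.OplaxMonoidal

variable {k : Type w} [CommRing k] {R S : Type u} [Ring R] [Algebra k R] [Ring S] [Algebra k S]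

/-- A bialgebroid morphism `⟨G, φ⟩ : A → B`, for a lax monoidal functor `G`: an ambimonoidal monad
morphism `φ : B ⊗_{S^e} G(-) → G(A ⊗_{R^e} (-))`. -/
structure BialgebroidHom (A : LeftBialgebroid k R) (B : LeftBialgebroid k S)
    (G : BimoduleCat k R ⥤ BimoduleCat k S) [G.LaxMonoidal] where
  /-- The natural transformation. -/
  φ : G ⋙ B.monad.toFunctor ⟶ A.monad.toFunctor ⋙ G
  isMonadMorphism : IsMonadMorphism A.monad B.monad G φ
  ambimonoidal : Ambimonoidal φ

namespace BialgebroidHom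

variable {A : LeftBialgebroid k R} {B : LeftBialgebroid k S}
  {G : BimoduleCat k R ⥤ BimoduleCat k S} [G.LaxMonoidal] (f : BialgebroidHom A B G)

/-- The structure map of `G^φ V`. -/
def liftAct (V : A.Mod) : B.monad.obj (G.obj (A.forget.obj V)) ⟶ G.obj (A.forget.obj V) :=
  f.φ.app (A.forget.obj V) ≫ G.map (A.act V)

/-- The `B`-module `G^φ V`: the bimodule `G V` with the action
`B ⊗ G V → G (A ⊗ V) → G V` given by `φ` and the action of `A` on `V`. -/
def liftObj (V : A.Mod) : B.Mod :=
  B.ofAct (G.obj (A.forget.obj V)) (f.liftAct V)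
    (by
      rw [liftAct, ← Category.assoc, f.isMonadMorphism.unit, ← G.map_comp, act_unit]
      exact G.map_id _)
    (by
      have h := f.φ.naturality (A.act V)
      dsimp at h
      rw [liftAct, ← Category.assoc, f.isMonadMorphism.mul, Category.assoc, Category.assoc,
        ← G.map_comp, act_assoc, G.map_comp, ← reassoc_of% h, Functor.map_comp, Category.assoc])

/-- The underlying bimodule of `G^φ V` is `G V`. -/
def liftObjIso (V : A.Mod) : B.forget.obj (f.liftObj V) ≅ G.obj (A.forget.obj V) :=
  ofActIso _ _ _ _

theorem act_liftObj (V : A.Mod) : B.act (f.liftObj V) ≫ (f.liftObjIso V).hom =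
    B.monad.map (f.liftObjIso V).hom ≫ f.liftAct V :=
  act_ofAct _ _ _ _

/-- The functor `G^φ` from `A`-modules to `B`-modules, which is `G` on underlying bimodules. -/
def lift : A.Mod ⥤ B.Mod where
  obj := f.liftObj
  map {V W} g := homOfAct
    ((f.liftObjIso V).hom ≫ G.map (A.forget.map g) ≫ (f.liftObjIso W).inv) (by
      rw [← cancel_mono (f.liftObjIso W).hom, Category.assoc, act_liftObj, Functor.map_comp,
        Functor.map_comp]
      have h := f.φ.naturality (A.forget.map g)
      dsimp at h
      simp only [Category.assoc, Iso.inv_hom_id, Category.comp_id]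
      rw [reassoc_of% (f.act_liftObj V), ← Functor.map_comp_assoc B.monad.toFunctor
        (f.liftObjIso W).inv, Iso.inv_hom_id, CategoryTheory.Functor.map_id, Category.id_comp, liftAct, liftAct,
        reassoc_of% h, Category.assoc, ← G.map_comp, ← G.map_comp, act_natural])
  map_id V := B.forget.map_injective (by simp)
  map_comp g h := B.forget.map_injective (by simp)

/-- The functor `G^φ` lifts `G`. -/
def liftIso : f.lift ⋙ B.forget ≅ A.forget ⋙ G :=
  NatIso.ofComponents f.liftObjIso (fun {V W} g => by
    have h : B.forget.map (f.lift.map g) =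
      (f.liftObjIso V).hom ≫ G.map (A.forget.map g) ≫ (f.liftObjIso W).inv := rfl
    have h1 : ((f.liftObjIso V).hom ≫ G.map (A.forget.map g) ≫ (f.liftObjIso W).inv) ≫
        (f.liftObjIso W).hom = (f.liftObjIso V).hom ≫ G.map (A.forget.map g) := by
      simp only [Category.assoc, Iso.inv_hom_id, Category.comp_id]
    exact (congrArg (fun x => x ≫ (f.liftObjIso W).hom) h).trans h1)

theorem act_lift (V : A.Mod) : B.act (f.lift.obj V) ≫ f.liftIso.hom.app V =
    B.monad.map (f.liftIso.hom.app V) ≫ f.φ.app (A.forget.obj V) ≫ G.map (A.act V) :=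
  f.act_liftObj V

theorem act_unit_η : B.act (𝟙_ B.Mod) ≫ η B.forget =
    B.monad.map (η B.forget) ≫ η B.monad.toFunctor := by
  have h := LeftBialgebroid.map_ε_act (A := B)
  rw [← cancel_epi (B.monad.map (ε B.forget)), reassoc_of% h, Functor.Monoidal.ε_η,
    Category.comp_id, ← Functor.map_comp_assoc, Functor.Monoidal.ε_η, CategoryTheory.Functor.map_id,
    Category.id_comp]

theorem act_tensor_δ (V W : B.Mod) : B.act (V ⊗ W) ≫ δ B.forget V W =
    B.monad.map (δ B.forget V W) ≫ δ B.monad.toFunctor _ _ ≫ (B.act V ⊗ₘ B.act W) := by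
  have h := LeftBialgebroid.map_μ_act (A := B) V W
  rw [← cancel_epi (B.monad.map (μ B.forget V W)), reassoc_of% h, Functor.Monoidal.μ_δ,
    Category.comp_id, ← Functor.map_comp_assoc, Functor.Monoidal.μ_δ, CategoryTheory.Functor.map_id,
    Category.id_comp]

theorem lift_ε_aux : B.monad.map (η B.forget ≫ ε (A.forget ⋙ G) ≫ f.liftIso.inv.app (𝟙_ _)) ≫
    B.act (f.lift.obj (𝟙_ _)) =
      B.act (𝟙_ _) ≫ (η B.forget ≫ ε (A.forget ⋙ G) ≫ f.liftIso.inv.app (𝟙_ _)) := by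
  refine (Iso.cancel_iso_hom_right _ _ (f.liftIso.app (𝟙_ A.Mod))).1 ?_
  rw [Iso.app_hom]
  have h := f.φ.naturality (ε A.forget)
  dsimp at h
  have h1 := f.ambimonoidal.unit
  have h2 := congrArg G.map (LeftBialgebroid.map_ε_act (A := A))
  rw [G.map_comp, G.map_comp] at h2
  rw [Category.assoc, act_lift, ← Functor.map_comp_assoc]
  simp only [Category.assoc, Iso.inv_hom_id_app, Category.comp_id]
  rw [reassoc_of% (act_unit_η (B := B)), Functor.LaxMonoidal.comp_ε]
  simp only [Functor.map_comp, Category.assoc]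
  rw [reassoc_of% h, h2, reassoc_of% h1]

theorem lift_μ_aux (V W : A.Mod) :
    B.monad.map (δ B.forget _ _ ≫ (f.liftIso.hom.app V ⊗ₘ f.liftIso.hom.app W) ≫
      μ (A.forget ⋙ G) V W ≫ f.liftIso.inv.app (V ⊗ W)) ≫ B.act (f.lift.obj (V ⊗ W)) =
    B.act (f.lift.obj V ⊗ f.lift.obj W) ≫
      (δ B.forget _ _ ≫ (f.liftIso.hom.app V ⊗ₘ f.liftIso.hom.app W) ≫
        μ (A.forget ⋙ G) V W ≫ f.liftIso.inv.app (V ⊗ W)) := by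
  refine (Iso.cancel_iso_hom_right _ _ (f.liftIso.app (V ⊗ W))).1 ?_
  rw [Iso.app_hom]
  have h := f.φ.naturality (μ A.forget V W)
  dsimp at h
  have h1 := f.ambimonoidal.tensor (A.forget.obj V) (A.forget.obj W)
  have h2 := congrArg G.map (LeftBialgebroid.map_μ_act (A := A) V W)
  rw [G.map_comp, G.map_comp, G.map_comp] at h2
  rw [Category.assoc, act_lift, ← Functor.map_comp_assoc]
  simp only [Category.assoc, Iso.inv_hom_id_app, Category.comp_id]
  rw [reassoc_of% (act_tensor_δ (f.lift.obj V) (f.lift.obj W)), Functor.LaxMonoidal.comp_μ,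
    tensorHom_comp_tensorHom_assoc, act_lift, act_lift]
  simp only [Functor.map_comp, Category.assoc]
  rw [reassoc_of% h, h2, reassoc_of% h1, ← μ_natural_assoc]
  have hn := δ_natural B.monad.toFunctor (f.liftIso.hom.app V) (f.liftIso.hom.app W)
  dsimp only [Functor.comp_obj] at hn
  rw [← reassoc_of% hn, tensorHom_comp_tensorHom_assoc, tensorHom_comp_tensorHom_assoc,
    Category.assoc, Category.assoc]

/-- The lax monoidal structure on `G^φ` which is that of `G` on underlying bimodules. -/
instance : f.lift.LaxMonoidal :=
  liftLaxMonoidal f.liftIso (homOfAct _ f.lift_ε_aux) (fun V W => homOfAct _ (f.lift_μ_aux V W))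
    (by simp) (fun V W => by simp)

end BialgebroidHom

/-- A homomorphism of algebras over `R^e` as a morphism of bimodules. -/
def EnvAlgebra.regularMap {A B : EnvAlgebra k R} (e : A.carrier →ₐ[k] B.carrier)
    (he : ∀ r, e (A.st r) = B.st r) : A.regular ⟶ B.regular :=
  linHom (B.el.toAddMonoidHom.comp (e.toAddMonoidHom.comp A.el.symm.toAddMonoidHom))
    (fun r x => by
      obtain ⟨a, rfl⟩ := A.el.surjective x
      change B.el (e (A.st r * a)) = B.el (B.st r * e a)
      rw [map_mul, he])

/-- An isomorphism of bialgebroids over `R`: an isomorphism of algebras over `R^e` and of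
comonoids. -/
structure BialgebroidIso (A B : LeftBialgebroid k R) where
  /-- The isomorphism of algebras. -/
  e : A.carrier ≃ₐ[k] B.carrier
  map_st (r : Env k R) : e (A.st r) = B.st r
  isComonHom : IsComonHom (EnvAlgebra.regularMap e.toAlgHom map_st)

section Universal

variable {C : Type u₁} [Category.{v₁} C] [MonoidalCategory C]

/-- The universal property of a bialgebroid `A` with a monoidal functor `K` from `C` to `A`-modules
lifting `U`: for any bialgebroid `B` over any `k`-algebra `S` and any lax monoidal functors `F`
and `G`, with `G` being `k`-linear, such that `GU = U_B F`, there is a unique bialgebroid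
morphism `⟨G, φ⟩ : A → B` such that `G^φ K = F`. -/
def IsLaxUniversal (U : C ⥤ BimoduleCat k R) [U.LaxMonoidal] (A : LeftBialgebroid k R)
    (K : C ⥤ A.Mod) [K.LaxMonoidal] : Prop :=
  ∀ (S : Type u) [Ring S] [Algebra k S] (B : LeftBialgebroid k S)
    (F : C ⥤ B.Mod) [F.LaxMonoidal]
    (G : BimoduleCat k R ⥤ BimoduleCat k S) [G.LaxMonoidal] [G.Additive] [G.Linear k],
    LaxMonoidalEq (U ⋙ G) (F ⋙ B.forget) →
      ∃! f : BialgebroidHom A B G, LaxMonoidalEq (K ⋙ f.lift) F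

/-- The universal property, with the functors `F` and `G` restricted to be strong monoidal. -/
def IsStrongUniversal (U : C ⥤ BimoduleCat k R) [U.LaxMonoidal] (A : LeftBialgebroid k R)
    (K : C ⥤ A.Mod) [K.LaxMonoidal] : Prop :=
  ∀ (S : Type u) [Ring S] [Algebra k S] (B : LeftBialgebroid k S)
    (F : C ⥤ B.Mod) [F.Monoidal]
    (G : BimoduleCat k R ⥤ BimoduleCat k S) [G.Monoidal] [G.Additive] [G.Linear k],
    LaxMonoidalEq (U ⋙ G) (F ⋙ B.forget) →
      ∃! f : BialgebroidHom A B G, LaxMonoidalEq (K ⋙ f.lift) F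

end Universal

end Morphisms

end Bgd

end

open Bgd

/-!
Let `L` be the left adjoint of `U`. The object `P = L (R ⊗ Rᵒᵖ)` represents `U`: a morphism
`x̂ : P → X` is the same as an element `x` of `U X`, with `U(x̂)(1) = x` for the universal element
`1` of `U P` (`map_hat_univ`, `univ_hom_ext`). The reconstructed algebra is `A = U P`, that is, the
opposite of `End P`. It acts on `U X` by `a · x = U(x̂)(a)`, and its product is the action on `U P`.
This gives a lift `K` of `U` to `A`-modules which does not change the underlying bimodules. The
tensor structure of `U` makes `P` a comonoid, with comultiplication classifying `1 ⊗ 1` and counit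
classifying `1`, and this comonoid structure carries over to `A`. The bialgebroid axioms, and the
compatibility of the tensor structure of `U` with the action of `A`, all come from the formula
`a · (x ⊗ y) = a₍₁₎ x ⊗ a₍₂₎ y` in `U (X ⊗ Y)` (`takeuchiAct_recon`), which is read off from
`Δ ≫ (x̂ ⊗ ŷ)` being the morphism that classifies `x ⊗ y` (`univComul_tensorHom`).

The universal property rests on the comparison morphisms `A ⊗_{R^e} X → U L X` being isomorphisms
(`isLaxUniversal_of_comparison`). The existence of a right adjoint of `U` enters here: both sides
are left adjoints as functors of `X`, and a transformation between left adjoints on bimodules is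
invertible as soon as it is so at `R ⊗ Rᵒᵖ`, because its conjugate is a transformation between right
adjoints and morphisms out of `R ⊗ Rᵒᵖ` detect isomorphisms (`isIso_app_of_isIso_app_envObj`).
A lift `F` of `G U` to `B`-modules is the same as an action `ψ` of the monad `B ⊗_{S^e} (-)` on
`G U`, and `G^φ K = F` says that `ψ` is the composition of `φ` with the action of `A` on `U`
(`laxMonoidalEq_lift_iff`). Evaluating at `L X` and using the comparison isomorphism shows that `φ`
must be the composition of `B ⊗ G X → B ⊗ G U L X`, `ψ`, and `G U L X ≅ G (A ⊗ X)`, and conversely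
this formula defines a morphism of bialgebroids.

Finally, two universal bialgebroids over `R` have mutually inverse morphisms over the identity
functor, and such a pair comes from an isomorphism of bialgebroids (`BialgebroidHom.toIso`): by
naturality, a transformation `B ⊗ X → A ⊗ X` is determined by its component at `R ⊗ Rᵒᵖ`, which is
a map `B → A`.

Functors are compared strictly. Identities between objects are handled through isomorphisms that
are transports along equalities (`IsStrict`), so that an equality of lax monoidal functors is
a monoidal isomorphism with such components (`laxMonoidalEq_iff`).
-/

noncomputable section

namespace Bgd

open Functor.LaxMonoidal Functor.OplaxMonoidal

/-! ### Strict equality of functors -/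

section Strict

/-- A morphism that is the transport along an equality between its source and its target. -/
def IsStrict {M : Type*} [Category* M] {X Y : M} (f : X ⟶ Y) : Prop :=
  ∃ h : X = Y, f = eqToHom h

variable {M N : Type*} [Category* M] [Category* N]

theorem IsStrict.comp {X Y Z : M} {f : X ⟶ Y} {g : Y ⟶ Z} (hf : IsStrict f) (hg : IsStrict g) :
    IsStrict (f ≫ g) := by
  obtain ⟨rfl, rfl⟩ := hf
  obtain ⟨rfl, rfl⟩ := hg
  exact ⟨rfl, by simp⟩

theorem IsStrict.map {X Y : M} {f : X ⟶ Y} (hf : IsStrict f) (F : M ⥤ N) :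
    IsStrict (F.map f) := by
  obtain ⟨rfl, rfl⟩ := hf
  exact ⟨rfl, by simp⟩

theorem IsStrict.inv {X Y : M} {i : X ≅ Y} (hi : IsStrict i.hom) : IsStrict i.inv := by
  obtain ⟨rfl, h⟩ := hi
  refine ⟨rfl, ?_⟩
  rw [← cancel_epi i.hom, i.hom_inv_id, h]
  simp

theorem IsStrict.eq {X Y : M} {f g : X ⟶ Y} (hf : IsStrict f) (hg : IsStrict g) : f = g := by
  obtain ⟨_, rfl⟩ := hf
  obtain ⟨_, rfl⟩ := hg
  rfl

variable [MonoidalCategory M] [MonoidalCategory N]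

/-- An equality of lax monoidal functors is a monoidal isomorphism whose components are transports
along equalities. -/
theorem laxMonoidalEq_iff {F G : M ⥤ N} [F.LaxMonoidal] [G.LaxMonoidal] :
    LaxMonoidalEq F G ↔
      ∃ i : F ≅ G, NatTrans.IsMonoidal i.hom ∧ ∀ X, IsStrict (i.hom.app X) := by
  constructor
  · rintro ⟨h, hm⟩
    exact ⟨eqToIso h, by rwa [eqToIso.hom],
      fun X => ⟨congrArg (fun H => H.obj X) h, by rw [eqToIso.hom, eqToHom_app]⟩⟩
  · rintro ⟨i, hm, hs⟩
    have h : F = G := CategoryTheory.Functor.ext (fun X => (hs X).choose) (fun X Y f => by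
      have hX := (hs X).choose_spec
      have hY : i.inv.app Y = eqToHom (hs Y).choose.symm :=
        (IsStrict.inv (i := i.app Y) (hs Y)).eq ⟨_, rfl⟩
      refine Eq.trans ?_ (congrArg₂ (fun p q => p ≫ G.map f ≫ q) hX hY)
      rw [← i.hom.naturality_assoc, Iso.hom_inv_id_app, Category.comp_id])
    have hi : i.hom = eqToHom h := by
      ext X
      exact (hs X).eq ⟨congrArg (fun H => H.obj X) h, eqToHom_app _ _⟩
    exact ⟨h, hi ▸ hm⟩

/-- Monoidality of a natural transformation is checked after a faithful monoidal functor. -/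
theorem isMonoidal_of_whiskerRight {M' : Type*} [Category* M'] [MonoidalCategory M'] {F G : M ⥤ N}
    [F.LaxMonoidal] [G.LaxMonoidal] (P : N ⥤ M') [P.Monoidal] [P.Faithful] (τ : F ⟶ G)
    [hτ : NatTrans.IsMonoidal (Functor.whiskerRight τ P)] : NatTrans.IsMonoidal τ where
  unit := P.map_injective (by
    have h := hτ.unit
    rw [Functor.LaxMonoidal.comp_ε, Functor.LaxMonoidal.comp_ε, Category.assoc] at h
    rw [P.map_comp]
    exact (cancel_epi _).1 h)
  tensor X Y := P.map_injective (by
    have h := hτ.tensor X Y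
    rw [Functor.LaxMonoidal.comp_μ, Functor.LaxMonoidal.comp_μ, Category.assoc,
      Functor.whiskerRight_app, Functor.whiskerRight_app, Functor.whiskerRight_app,
      μ_natural_assoc] at h
    rw [P.map_comp, P.map_comp]
    exact (cancel_epi _).1 h)

theorem moduleCat_eq {E : Type u} [Ring E] {V W : ModuleCat.{u} E} (hc : V.carrier = W.carrier)
    (ha : V.isAddCommGroup ≍ W.isAddCommGroup)
    (hs : ∀ (e : E) (v : V) (w : W), v ≍ w → e • v ≍ e • w) : V = W := by
  obtain @⟨V, aV, mV⟩ := V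
  obtain @⟨W, aW, mW⟩ := W
  change V = W at hc
  subst hc
  obtain rfl : aV = aW := eq_of_heq ha
  obtain rfl : mV = mW := Module.ext' _ _ fun e v => eq_of_heq (hs e v v HEq.rfl)
  rfl

/-- A linear map between modules on the same abelian group which is the identity on elements is a
transport along an equality of modules. -/
theorem isStrict_of_heq {E : Type u} [Ring E] {V W : ModuleCat.{u} E}
    (hc : V.carrier = W.carrier) (ha : V.isAddCommGroup ≍ W.isAddCommGroup) (f : V ⟶ W)
    (hf : ∀ v : V, f.hom v ≍ v) : IsStrict f := by
  -- Linearity of the identity map forces the two scalar multiplications to agree.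
  have h : V = W := moduleCat_eq hc ha fun e v w hvw => by
    obtain rfl : f.hom v = w := eq_of_heq ((hf v).trans hvw)
    rw [← map_smul]
    exact (hf _).symm
  subst h
  exact ⟨rfl, ModuleCat.hom_ext (LinearMap.ext fun v => eq_of_heq (hf v))⟩

theorem IsStrict.heq {E : Type u} [Ring E] {V W : ModuleCat.{u} E} {f : V ⟶ W} (hf : IsStrict f)
    (v : V) : f.hom v ≍ v := by
  obtain ⟨rfl, rfl⟩ := hf
  rfl

end Strict

section StrictModules

variable {k : Type w} [CommRing k] {R : Type u} [Ring R] [Algebra k R] {A : EnvAlgebra k R}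

/-- A morphism of `A`-modules is an identity as soon as the underlying morphism of bimodules is. -/
theorem isStrict_of_forget {V W : A.Mod} (f : V ⟶ W) (hf : IsStrict (A.forget.map f)) :
    IsStrict f :=
  isStrict_of_heq (V := V) (W := W) (congrArg (fun X : BimoduleCat k R => X.carrier) hf.choose)
    (congr_arg_heq (fun X : BimoduleCat k R => X.isAddCommGroup) hf.choose) f hf.heq

/-- A module over the monad and the corresponding `A`-module have the same underlying bimodule. -/
theorem isStrict_ofActIso (Y : BimoduleCat k R) (p : A.monad.obj Y ⟶ Y) (unit) (assoc) :
    IsStrict (EnvAlgebra.ofActIso Y p unit assoc).hom :=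
  isStrict_of_heq (V := A.forget.obj (A.ofAct Y p unit assoc)) (W := Y) rfl HEq.rfl
    (EnvAlgebra.ofActIso Y p unit assoc).hom fun _ => HEq.rfl

end StrictModules

/-! ### Functors to modules as functors to bimodules with an action of the monad -/

section Action

variable {k : Type w} [CommRing k] {R : Type u} [Ring R] [Algebra k R]
  {C : Type u₁} [Category.{v₁} C]

section
variable {A : EnvAlgebra k R} {F : C ⥤ A.Mod} {Q : C ⥤ BimoduleCat k R} (j : F ⋙ A.forget ≅ Q)

/-- The action of the monad `A ⊗_{R^e} (-)` on a functor `Q` to bimodules that lifts to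
a functor to `A`-modules. -/
def actOn : Q ⋙ A.monad.toFunctor ⟶ Q where
  app X := A.monad.map (j.inv.app X) ≫ A.act (F.obj X) ≫ j.hom.app X
  naturality X Y f := by
    have h := j.inv.naturality f
    have h' := j.hom.naturality f
    have h2 := EnvAlgebra.act_natural (F.map f)
    dsimp at h h' ⊢
    rw [← Functor.map_comp_assoc, h, Functor.map_comp_assoc, reassoc_of% h2, h']
    simp only [Category.assoc]

theorem actOn_app (X : C) : (actOn j).app X =
    A.monad.map (j.inv.app X) ≫ A.act (F.obj X) ≫ j.hom.app X := rfl

/-- The defining property of `actOn`: `j` identifies it with the action on the modules `F X`. -/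
theorem map_hom_actOn (X : C) : A.monad.map (j.hom.app X) ≫ (actOn j).app X =
    A.act (F.obj X) ≫ j.hom.app X := by
  rw [actOn_app, ← Functor.map_comp_assoc, Iso.hom_inv_id_app, CategoryTheory.Functor.map_id,
    Category.id_comp]

theorem actOn_natural {X Y : C} (f : X ⟶ Y) :
    A.monad.map (Q.map f) ≫ (actOn j).app Y = (actOn j).app X ≫ Q.map f :=
  (actOn j).naturality f

theorem η_actOn (X : C) : A.monad.η.app (Q.obj X) ≫ (actOn j).app X = 𝟙 _ := by
  have h := A.monad.η.naturality (j.inv.app X)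
  dsimp at h
  rw [actOn_app, ← reassoc_of% h, reassoc_of% (EnvAlgebra.act_unit (F.obj X)),
    Iso.inv_hom_id_app]
  rfl

theorem μ_actOn (X : C) : A.monad.μ.app (Q.obj X) ≫ (actOn j).app X =
    A.monad.map ((actOn j).app X) ≫ (actOn j).app X := by
  have h := A.monad.μ.naturality (j.inv.app X)
  dsimp at h
  rw [actOn_app, ← reassoc_of% h, reassoc_of% (EnvAlgebra.act_assoc (F.obj X)),
    ← Functor.map_comp_assoc, ← Functor.map_comp_assoc]
  simp only [Category.assoc, Iso.hom_inv_id_app, Functor.comp_obj, Category.comp_id]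

end

section
variable {A : LeftBialgebroid k R} {Q : C ⥤ BimoduleCat k R}
  {S : Type u} [Ring S] [Algebra k S] {B : LeftBialgebroid k S}
  {G : BimoduleCat k R ⥤ BimoduleCat k S} [G.LaxMonoidal]

/-- The functor `G^φ K` lifts `G Q` if `K` lifts `Q`. -/
def liftCompIso (f : BialgebroidHom A B G) {K : C ⥤ A.Mod} (j : K ⋙ A.forget ≅ Q) :
    (K ⋙ f.lift) ⋙ B.forget ≅ Q ⋙ G :=
  Functor.isoWhiskerLeft K f.liftIso ≪≫ Functor.isoWhiskerRight j G

theorem liftCompIso_app (f : BialgebroidHom A B G) {K : C ⥤ A.Mod} (j : K ⋙ A.forget ≅ Q) (X : C) :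
    (liftCompIso f j).hom.app X = f.liftIso.hom.app (K.obj X) ≫ G.map (j.hom.app X) := rfl

/-- The action of `B` on `G Q` that comes from `G^φ K` is the composition of `φ` with the action of
`A` on `Q`. -/
theorem actOn_liftCompIso (f : BialgebroidHom A B G) {K : C ⥤ A.Mod} (j : K ⋙ A.forget ≅ Q)
    (X : C) : (actOn (liftCompIso f j)).app X =
      f.φ.app (Q.obj X) ≫ G.map ((actOn j).app X) := by
  rw [← cancel_epi (B.monad.map ((liftCompIso f j).hom.app X)), map_hom_actOn, liftCompIso_app]
  have h := f.φ.naturality (j.hom.app X)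
  dsimp at h
  rw [Functor.map_comp, Category.assoc, reassoc_of% h, ← G.map_comp, map_hom_actOn, G.map_comp]
  exact (reassoc_of% (f.act_lift (K.obj X))) _

theorem isStrict_liftCompIso (f : BialgebroidHom A B G) {K : C ⥤ A.Mod} (j : K ⋙ A.forget ≅ Q)
    (hj : ∀ X, IsStrict (j.hom.app X)) (X : C) : IsStrict ((liftCompIso f j).hom.app X) :=
  IsStrict.comp (isStrict_ofActIso _ _ _ _) ((hj X).map G)

end

variable [MonoidalCategory C] {A : LeftBialgebroid k R} {Q : C ⥤ BimoduleCat k R} [Q.LaxMonoidal]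

/-- The action on a lax monoidal functor is compatible with the comonoidal structure of the monad,
because `A` acts diagonally on tensor products. -/
theorem actOn_μ {F : C ⥤ A.Mod} [F.LaxMonoidal] (j : F ⋙ A.forget ≅ Q)
    [hj : NatTrans.IsMonoidal j.hom] (X Y : C) :
    A.monad.map (μ Q X Y) ≫ (actOn j).app (X ⊗ Y) =
      δ A.monad.toFunctor _ _ ≫ ((actOn j).app X ⊗ₘ (actOn j).app Y) ≫ μ Q X Y := by
  have h1 : μ Q X Y = (j.inv.app X ⊗ₘ j.inv.app Y) ≫ μ A.forget _ _ ≫ A.forget.map (μ F X Y) ≫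
      j.hom.app _ := by
    have := hj.tensor X Y
    rw [Functor.LaxMonoidal.comp_μ, Category.assoc] at this
    rw [this, tensorHom_comp_tensorHom_assoc, Iso.inv_hom_id_app, Iso.inv_hom_id_app,
      id_tensorHom_id, Category.id_comp]
  have h2 := LeftBialgebroid.map_μ_act (A := A) (F.obj X) (F.obj Y)
  have h3 := EnvAlgebra.act_natural (μ F X Y)
  have h4 := δ_natural A.monad.toFunctor (j.inv.app X) (j.inv.app Y)
  dsimp only [Functor.comp_obj] at h4
  have h5 : (actOn j).app X ⊗ₘ (actOn j).app Y =
      (A.monad.map (j.inv.app X) ⊗ₘ A.monad.map (j.inv.app Y)) ≫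
        (A.act (F.obj X) ⊗ₘ A.act (F.obj Y)) ≫ (j.hom.app X ⊗ₘ j.hom.app Y) := by
    rw [tensorHom_comp_tensorHom, tensorHom_comp_tensorHom]
    rfl
  have h6 : (j.hom.app X ⊗ₘ j.hom.app Y) ≫ μ Q X Y =
      μ A.forget _ _ ≫ A.forget.map (μ F X Y) ≫ j.hom.app _ := by
    rw [← hj.tensor, Functor.LaxMonoidal.comp_μ, Category.assoc]
  rw [h5, Category.assoc, Category.assoc, h6, reassoc_of% h4, ← reassoc_of% h2, h1]
  simp only [Functor.map_comp, Category.assoc]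
  rw [map_hom_actOn, reassoc_of% h3]

theorem actOn_ε {F : C ⥤ A.Mod} [F.LaxMonoidal] (j : F ⋙ A.forget ≅ Q)
    [hj : NatTrans.IsMonoidal j.hom] :
    A.monad.map (ε Q) ≫ (actOn j).app (𝟙_ C) = η A.monad.toFunctor ≫ ε Q := by
  have h1 : ε Q = ε A.forget ≫ A.forget.map (ε F) ≫ j.hom.app _ := by
    have := hj.unit
    rw [Functor.LaxMonoidal.comp_ε, Category.assoc] at this
    exact this.symm
  have h2 := LeftBialgebroid.map_ε_act (A := A)
  have h3 := EnvAlgebra.act_natural (ε F)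
  rw [h1, Functor.map_comp, Functor.map_comp, Category.assoc, Category.assoc, map_hom_actOn,
    reassoc_of% h3, reassoc_of% h2]

/-- Two lax monoidal lifts to modules of the same lax monoidal functor to bimodules coincide if and
only if they define the same action of the monad. -/
theorem laxMonoidalEq_iff_actOn {F F' : C ⥤ A.Mod} [F.LaxMonoidal] [F'.LaxMonoidal]
    (j : F ⋙ A.forget ≅ Q) (j' : F' ⋙ A.forget ≅ Q) [NatTrans.IsMonoidal j.hom]
    [NatTrans.IsMonoidal j'.hom] (hj : ∀ X, IsStrict (j.hom.app X))
    (hj' : ∀ X, IsStrict (j'.hom.app X)) : LaxMonoidalEq F' F ↔ actOn j = actOn j' := by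
  constructor
  · intro h
    obtain ⟨i, -, hi⟩ := laxMonoidalEq_iff.1 h
    have h1 (X : C) : A.forget.map (i.hom.app X) ≫ j.hom.app X = j'.hom.app X :=
      (((hi X).map A.forget).comp (hj X)).eq (hj' X)
    ext X : 2
    rw [← cancel_epi (A.monad.map (j'.hom.app X)), map_hom_actOn, ← h1, Functor.map_comp,
      Category.assoc, map_hom_actOn, reassoc_of% (EnvAlgebra.act_natural (i.hom.app X))]
  · intro h
    have h1 (X : C) : A.monad.map (j'.hom.app X ≫ j.inv.app X) ≫ A.act (F.obj X) =
        A.act (F'.obj X) ≫ j'.hom.app X ≫ j.inv.app X := by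
      have := map_hom_actOn j' X
      rw [← h] at this
      rw [← reassoc_of% this, actOn_app]
      simp
    -- Equal actions make the identities of underlying bimodules `A`-linear.
    let τ : F' ⟶ F :=
      { app X := EnvAlgebra.homOfAct (j'.hom.app X ≫ j.inv.app X) (h1 X)
        naturality X Y f := A.forget.map_injective (by
          rw [Functor.map_comp, Functor.map_comp]
          exact (j'.hom ≫ j.inv).naturality f) }
    have e : Functor.whiskerRight τ A.forget = j'.hom ≫ j.inv := rfl
    have : NatTrans.IsMonoidal (Functor.whiskerRight τ A.forget) := by
      rw [e]
      infer_instance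
    have := isMonoidal_of_whiskerRight A.forget τ
    have (X : C) : IsStrict (τ.app X) :=
      isStrict_of_forget _ ((hj' X).comp (IsStrict.inv (i := j.app X) (hj X)))
    have (X : C) : IsIso (τ.app X) := by
      obtain ⟨_, h⟩ := this X
      rw [h]
      infer_instance
    have := NatIso.isIso_of_isIso_app τ
    exact laxMonoidalEq_iff.2 ⟨asIso τ, ‹_›, ‹_›⟩

variable {S : Type u} [Ring S] [Algebra k S] {B : LeftBialgebroid k S}
  {G : BimoduleCat k R ⥤ BimoduleCat k S} [G.LaxMonoidal]

instance (f : BialgebroidHom A B G) : NatTrans.IsMonoidal f.liftIso.hom where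
  unit := by
    have h : B.forget.map (ε f.lift) = η B.forget ≫ ε (A.forget ⋙ G) ≫ f.liftIso.inv.app _ := rfl
    rw [Functor.LaxMonoidal.comp_ε, Category.assoc, h]
    simp
  tensor X Y := by
    have h : B.forget.map (μ f.lift X Y) = δ B.forget _ _ ≫
      (f.liftIso.hom.app X ⊗ₘ f.liftIso.hom.app Y) ≫
        μ (A.forget ⋙ G) X Y ≫ f.liftIso.inv.app (X ⊗ Y) := rfl
    rw [Functor.LaxMonoidal.comp_μ, Category.assoc, h]
    simp

instance (f : BialgebroidHom A B G) {K : C ⥤ A.Mod} [K.LaxMonoidal] (j : K ⋙ A.forget ≅ Q)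
    [NatTrans.IsMonoidal j.hom] : NatTrans.IsMonoidal (liftCompIso f j).hom := by
  have h : (liftCompIso f j).hom = (Functor.associator K f.lift B.forget).hom ≫
      Functor.whiskerLeft K f.liftIso.hom ≫ (Functor.associator K A.forget G).inv ≫
        Functor.whiskerRight j.hom G := by
    ext X : 2
    simp [liftCompIso]
  rw [h]
  infer_instance

/-- The condition `G^φ K = F` in terms of the actions. -/
theorem laxMonoidalEq_lift_iff (f : BialgebroidHom A B G) {K : C ⥤ A.Mod} [K.LaxMonoidal]
    {F : C ⥤ B.Mod} [F.LaxMonoidal] (j : K ⋙ A.forget ≅ Q) (j' : F ⋙ B.forget ≅ Q ⋙ G)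
    [NatTrans.IsMonoidal j.hom] [NatTrans.IsMonoidal j'.hom] (hj : ∀ X, IsStrict (j.hom.app X))
    (hj' : ∀ X, IsStrict (j'.hom.app X)) :
    LaxMonoidalEq (K ⋙ f.lift) F ↔
      ∀ X, f.φ.app (Q.obj X) ≫ G.map ((actOn j).app X) = (actOn j').app X := by
  rw [laxMonoidalEq_iff_actOn j' (liftCompIso f j) hj' (isStrict_liftCompIso f j hj)]
  constructor
  · intro h X
    rw [h, actOn_liftCompIso]
  · intro h
    ext X : 2
    rw [← h, actOn_liftCompIso]

end Action

/-! ### The universal property -/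

theorem BialgebroidHom.ext_φ {k : Type w} [CommRing k] {R S : Type u} [Ring R] [Algebra k R]
    [Ring S] [Algebra k S] {A : LeftBialgebroid k R} {B : LeftBialgebroid k S}
    {G : BimoduleCat k R ⥤ BimoduleCat k S} [G.LaxMonoidal] {f g : BialgebroidHom A B G}
    (h : ∀ X, f.φ.app X = g.φ.app X) : f = g := by
  obtain ⟨φ, _, _⟩ := f
  obtain ⟨φ', _, _⟩ := g
  obtain rfl : φ = φ' := NatTrans.ext (funext h)
  rfl

section Universality

variable {k : Type w} [CommRing k] {R : Type u} [Ring R] [Algebra k R]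
  {C : Type u₁} [Category.{v₁} C] {U : C ⥤ BimoduleCat k R} {L : BimoduleCat k R ⥤ C}
  (adj : L ⊣ U)

/-- The comparison morphism `A ⊗_{R^e} X → U L X` from the free `A`-module on `X` induced by
an action of `A` on `U`. -/
def comparison {A : EnvAlgebra k R} {K : C ⥤ A.Mod} (j : K ⋙ A.forget ≅ U) (X : BimoduleCat k R) :
    A.monad.obj X ⟶ U.obj (L.obj X) :=
  A.monad.map (adj.unit.app X) ≫ (actOn j).app (L.obj X)

section
variable {A : EnvAlgebra k R} {K : C ⥤ A.Mod} (j : K ⋙ A.forget ≅ U)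

theorem comparison_natural {X Y : BimoduleCat k R} (f : X ⟶ Y) :
    A.monad.map f ≫ comparison adj j Y = comparison adj j X ≫ U.map (L.map f) := by
  have h := adj.unit.naturality f
  dsimp at h
  rw [comparison, comparison, ← Functor.map_comp_assoc, h, Category.assoc, ← actOn_natural,
    Functor.map_comp_assoc]

/-- The comparison morphism turns `f : L X → Y` into the action of `A` on `U Y` along the transpose
of `f`. -/
theorem comparison_homEquiv {X : BimoduleCat k R} {Y : C} (f : L.obj X ⟶ Y) :
    comparison adj j X ≫ U.map f = A.monad.map (adj.homEquiv X Y f) ≫ (actOn j).app Y := by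
  rw [comparison, Category.assoc, ← actOn_natural, ← Functor.map_comp_assoc,
    Adjunction.homEquiv_unit]

end

section
variable {A : EnvAlgebra k R} {K : C ⥤ A.Mod} (j : K ⋙ A.forget ≅ U)
  {S : Type u} [Ring S] [Algebra k S] {B : EnvAlgebra k S} {F : C ⥤ B.Mod}
  {G : BimoduleCat k R ⥤ BimoduleCat k S} (j' : F ⋙ B.forget ≅ U ⋙ G)
  (hc : ∀ X, IsIso (comparison adj j X))

/-- The natural transformation `B ⊗ G X → G (A ⊗ X)` obtained from the action of `B` on
`G U L X`. -/
def mateHom : G ⋙ B.monad.toFunctor ⟶ A.monad.toFunctor ⋙ G where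
  app X := B.monad.map (G.map (adj.unit.app X)) ≫ (actOn j').app (L.obj X) ≫
    G.map (@inv _ _ _ _ (comparison adj j X) (hc X))
  naturality X Y f := by
    have := hc X
    have := hc Y
    have h1 := adj.unit.naturality f
    have h2 := actOn_natural j' (L.map f)
    dsimp at h1 h2 ⊢
    rw [← cancel_mono (G.map (comparison adj j Y))]
    simp only [Category.assoc, ← G.map_comp, comparison_natural, IsIso.inv_hom_id,
      IsIso.inv_hom_id_assoc, CategoryTheory.Functor.map_id]
    erw [Category.comp_id]
    rw [← h2, ← Functor.map_comp_assoc, ← G.map_comp, h1, G.map_comp, Functor.map_comp_assoc]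

theorem mateHom_comparison (X : BimoduleCat k R) :
    (mateHom adj j j' hc).app X ≫ G.map (comparison adj j X) =
      B.monad.map (G.map (adj.unit.app X)) ≫ (actOn j').app (L.obj X) := by
  have := hc X
  simp only [mateHom, Category.assoc, ← G.map_comp, IsIso.inv_hom_id, G.map_id]
  erw [Category.comp_id]

/-- Composed with any `A ⊗ X → U Y` induced by a morphism `f : X → U Y`, the transformation
`mateHom` becomes the action of `B` on `G U Y` along `G f`. All axioms of a morphism of bialgebroids
follow from this. -/
theorem mateHom_map {X : BimoduleCat k R} {Y : C} (f : X ⟶ U.obj Y) :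
    (mateHom adj j j' hc).app X ≫ G.map (A.monad.map f ≫ (actOn j).app Y) =
      B.monad.map (G.map f) ≫ (actOn j').app Y := by
  obtain ⟨f, rfl⟩ := (adj.homEquiv X Y).surjective f
  rw [← comparison_homEquiv, G.map_comp, ← Category.assoc, mateHom_comparison, Category.assoc,
    Adjunction.homEquiv_unit, G.map_comp, Functor.map_comp_assoc]
  exact congrArg _ (actOn_natural j' f).symm

theorem mateHom_actOn (Y : C) :
    (mateHom adj j j' hc).app (U.obj Y) ≫ G.map ((actOn j).app Y) = (actOn j').app Y := by
  simpa using mateHom_map adj j j' hc (𝟙 (U.obj Y))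

end

variable [MonoidalCategory C] [U.Monoidal] {A : LeftBialgebroid k R} {K : C ⥤ A.Mod}
  [K.LaxMonoidal] (j : K ⋙ A.forget ≅ U) [NatTrans.IsMonoidal j.hom]
  {S : Type u} [Ring S] [Algebra k S] {B : LeftBialgebroid k S} {F : C ⥤ B.Mod} [F.LaxMonoidal]
  {G : BimoduleCat k R ⥤ BimoduleCat k S} [G.LaxMonoidal] (j' : F ⋙ B.forget ≅ U ⋙ G)
  [NatTrans.IsMonoidal j'.hom]

/-- The morphism of bialgebroids corresponding to a lift of `G U` to `B`-modules. -/
def mateBialgebroidHom (hc : ∀ X, IsIso (comparison adj j X)) : BialgebroidHom A B G where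
  φ := mateHom adj j j' hc
  isMonadMorphism :=
    { unit := fun X => by
        have := hc X
        have h1 := A.monad.η.naturality (adj.unit.app X)
        have h2 := B.monad.η.naturality (G.map (adj.unit.app X))
        dsimp at h1 h2
        rw [← cancel_mono (G.map (comparison adj j X)), Category.assoc, mateHom_comparison,
          ← reassoc_of% h2, ← G.map_comp, comparison, ← reassoc_of% h1, η_actOn]
        refine (congrArg (fun x => _ ≫ x) (η_actOn j' (L.obj X))).trans ?_
        simp
      mul := fun X => by
        have := hc X
        have h1 := A.monad.μ.naturality (adj.unit.app X)
        have h2 := B.monad.μ.naturality (G.map (adj.unit.app X))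
        have h3 := μ_actOn j' (L.obj X)
        have h4 := mateHom_map adj j j' hc (comparison adj j X)
        dsimp at h1 h2 h3
        -- The comparison morphism is a morphism of modules over the monad.
        have h5 : A.monad.μ.app X ≫ comparison adj j X =
            A.monad.map (comparison adj j X) ≫ (actOn j).app (L.obj X) := by
          rw [comparison, ← reassoc_of% h1, μ_actOn, Functor.map_comp_assoc]
        rw [← cancel_mono (G.map (comparison adj j X)), Category.assoc, mateHom_comparison,
          ← reassoc_of% h2, h3, Category.assoc, Category.assoc, ← G.map_comp, h5, h4,
          ← Functor.map_comp_assoc, ← Functor.map_comp_assoc, mateHom_comparison] }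
  ambimonoidal :=
    { unit := by
        have h1 := actOn_ε j
        have h2 := actOn_ε j'
        have h3 := mateHom_map adj j j' hc (ε U)
        rw [h1, G.map_comp] at h3
        rw [Functor.LaxMonoidal.comp_ε, Functor.map_comp, Category.assoc] at h2
        rw [← cancel_mono (G.map (ε U)), Category.assoc, Category.assoc, h3, Category.assoc]
        exact h2
      tensor := fun X Y => by
        have := hc X
        have := hc Y
        have h1 := mateHom_map adj j j' hc
          ((adj.unit.app X ⊗ₘ adj.unit.app Y) ≫ μ U (L.obj X) (L.obj Y))
        -- The comparison morphisms are compatible with the comonoidal structure of the monad.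
        have h2 : A.monad.map ((adj.unit.app X ⊗ₘ adj.unit.app Y) ≫ μ U (L.obj X) (L.obj Y)) ≫
            (actOn j).app (L.obj X ⊗ L.obj Y) = δ A.monad.toFunctor X Y ≫
              (comparison adj j X ⊗ₘ comparison adj j Y) ≫ μ U (L.obj X) (L.obj Y) := by
          have hn := δ_natural A.monad.toFunctor (adj.unit.app X) (adj.unit.app Y)
          dsimp only [Functor.comp_obj, Functor.id_obj] at hn
          rw [Functor.map_comp, Category.assoc, actOn_μ j, ← reassoc_of% hn,
            tensorHom_comp_tensorHom_assoc]
          rfl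
        have h3 : (((mateHom adj j j' hc).app X ⊗ₘ (mateHom adj j j' hc).app Y) ≫
              μ G (A.monad.obj X) (A.monad.obj Y)) ≫
            G.map ((comparison adj j X ⊗ₘ comparison adj j Y) ≫ μ U (L.obj X) (L.obj Y)) =
            (B.monad.map (G.map (adj.unit.app X)) ⊗ₘ B.monad.map (G.map (adj.unit.app Y))) ≫
              ((actOn j').app (L.obj X) ⊗ₘ (actOn j').app (L.obj Y)) ≫
                μ (U ⋙ G) (L.obj X) (L.obj Y) := by
          rw [G.map_comp, Category.assoc, ← μ_natural_assoc, tensorHom_comp_tensorHom_assoc,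
            mateHom_comparison, mateHom_comparison, Functor.LaxMonoidal.comp_μ,
            tensorHom_comp_tensorHom_assoc]
        dsimp only [Functor.id_obj] at h1
        have h4 := actOn_μ j' (L.obj X) (L.obj Y)
        have h5 := δ_natural B.monad.toFunctor (G.map (adj.unit.app X)) (G.map (adj.unit.app Y))
        dsimp only [Functor.comp_obj, Functor.id_obj] at h4 h5
        rw [← cancel_mono (G.map ((comparison adj j X ⊗ₘ comparison adj j Y) ≫
          μ U (L.obj X) (L.obj Y)))]
        simp only [Category.assoc] at h3 ⊢
        rw [h3, ← G.map_comp, ← h2, h1, reassoc_of% h5, ← h4, ← Functor.map_comp_assoc,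
          ← Functor.map_comp_assoc, G.map_comp, Functor.LaxMonoidal.comp_μ, ← μ_natural_assoc]
        rfl }

/-- A bialgebroid has the universal property as soon as the comparison morphisms
`A ⊗_{R^e} X → U L X` are isomorphisms. -/
theorem isLaxUniversal_of_comparison (hj : ∀ X, IsStrict (j.hom.app X))
    (hc : ∀ X, IsIso (comparison adj j X)) : IsLaxUniversal U A K := by
  intro S _ _ B F _ G _ _ _ h
  obtain ⟨i, hi, hs⟩ := laxMonoidalEq_iff.1 h
  have hi' : NatTrans.IsMonoidal i.symm.hom := inferInstanceAs (NatTrans.IsMonoidal i.inv)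
  have hs' (X : C) : IsStrict (i.symm.hom.app X) := IsStrict.inv (i := i.app X) (hs X)
  refine ⟨mateBialgebroidHom adj j i.symm hc, ?_, ?_⟩
  · exact (laxMonoidalEq_lift_iff _ j i.symm hj hs').2 (mateHom_actOn adj j i.symm hc)
  · intro f hf
    -- Naturality of `f.φ` at the unit of the adjunction determines it through its components at `U`.
    have hf := (laxMonoidalEq_lift_iff _ j i.symm hj hs').1 hf
    refine BialgebroidHom.ext_φ fun X => ?_
    have := hc X
    rw [← cancel_mono (G.map (comparison adj j X))]
    refine Eq.trans ?_ (mateHom_comparison adj j i.symm hc X).symm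
    have hn := f.φ.naturality (adj.unit.app X)
    dsimp at hn
    rw [comparison, G.map_comp, ← reassoc_of% hn, hf]

end Universality

/-! ### Reduction of the comparison morphisms to the enveloping algebra -/

section EnvObj

variable (k : Type w) [CommRing k] (R : Type u) [Ring R] [Algebra k R]

/-- The bimodule `R ⊗ Rᵒᵖ`, free of rank one. -/
abbrev envObj : BimoduleCat k R := ModuleCat.of (Env k R) (Env k R)

variable {k R}

/-- The morphism of bimodules `R ⊗ Rᵒᵖ → X` sending `1` to `x`. -/
def pt {X : BimoduleCat k R} (x : X) : envObj k R ⟶ X :=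
  ModuleCat.ofHom (LinearMap.toSpanSingleton (Env k R) X x)

theorem pt_one {X : BimoduleCat k R} (x : X) : (pt x).hom (1 : Env k R) = x := one_smul _ x

theorem envObj_hom_ext {X : BimoduleCat k R} {f g : envObj k R ⟶ X}
    (h : f.hom (1 : Env k R) = g.hom (1 : Env k R)) : f = g :=
  ModuleCat.hom_ext (LinearMap.ext_ring h)

theorem pt_comp {X Y : BimoduleCat k R} (x : X) (f : X ⟶ Y) : pt x ≫ f = pt (f.hom x) :=
  envObj_hom_ext (by rw [pt_one]; exact congrArg f.hom (pt_one x))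

/-- Morphisms out of `R ⊗ Rᵒᵖ` detect isomorphisms, being the elements of the target. -/
theorem isIso_of_bijective_comp {X Y : BimoduleCat k R} (f : X ⟶ Y)
    (h : Function.Bijective fun g : envObj k R ⟶ X => g ≫ f) : IsIso f := by
  rw [ConcreteCategory.isIso_iff_bijective]
  constructor
  · intro x x' hx
    have h1 : pt x ≫ f = pt x' ≫ f := by
      rw [pt_comp, pt_comp]
      exact congrArg pt hx
    rw [← pt_one x, h.1 h1, pt_one]
  · intro y
    obtain ⟨g, hg⟩ := h.2 (pt y)
    refine ⟨g.hom (1 : Env k R), ?_⟩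
    exact (congrArg (fun p => p.hom (1 : Env k R)) hg).trans (pt_one y)

/-- A natural transformation between endofunctors of the category of bimodules which are left
adjoints is an isomorphism as soon as it is one at `R ⊗ Rᵒᵖ`. -/
theorem isIso_app_of_isIso_app_envObj {T T' W W' : BimoduleCat k R ⥤ BimoduleCat k R}
    (adj : T ⊣ W) (adj' : T' ⊣ W') (κ : T ⟶ T') (h : IsIso (κ.app (envObj k R)))
    (X : BimoduleCat k R) : IsIso (κ.app X) := by
  have h1 (Y : BimoduleCat k R) : IsIso ((conjugateEquiv adj' adj κ).app Y) := by
    refine isIso_of_bijective_comp _ ?_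
    -- On morphisms out of `R ⊗ Rᵒᵖ` the conjugate acts as precomposition with `κ` at `R ⊗ Rᵒᵖ`.
    have h2 : (fun g => g ≫ (conjugateEquiv adj' adj κ).app Y) =
        adj.homEquiv (envObj k R) Y ∘ (fun g => κ.app _ ≫ g) ∘
          (adj'.homEquiv (envObj k R) Y).symm := by
      funext g
      obtain ⟨g, rfl⟩ := (adj'.homEquiv (envObj k R) Y).surjective g
      have h3 := unit_conjugateEquiv adj' adj κ (envObj k R)
      have h4 := (conjugateEquiv adj' adj κ).naturality g
      simp only [Function.comp_apply, Equiv.symm_apply_apply]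
      rw [Adjunction.homEquiv_unit, Adjunction.homEquiv_unit, Category.assoc, h4,
        reassoc_of% h3, Functor.map_comp]
    rw [h2]
    refine (Equiv.bijective _).comp (Function.Bijective.comp ?_ (Equiv.bijective _))
    exact ⟨fun g g' hg => (IsIso.epi_of_iso (κ.app (envObj k R))).left_cancellation g g' hg,
      fun g => ⟨inv (κ.app (envObj k R)) ≫ g, IsIso.hom_inv_id_assoc _ g⟩⟩
  have h2 : IsIso (conjugateEquiv adj' adj κ) := @NatIso.isIso_of_isIso_app _ _ _ _ _ _ _ h1
  have h3 : IsIso κ := @conjugateEquiv_of_iso _ _ _ _ _ _ _ _ adj' adj κ h2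
  exact @NatIso.isIso_app_of_isIso _ _ _ _ _ _ κ h3 X

variable {A : EnvAlgebra k R}

/-- `a ⊗ e = a (s ⊗ t)(e) ⊗ 1` in `A ⊗_{R^e} R^e`. -/
theorem fr_env (a : A.carrier) (e : Env k R) :
    A.fr (X := envObj k R) a e = A.fr (X := envObj k R) (a * A.st e) (1 : Env k R) := by
  rw [EnvAlgebra.fr_balanced]
  exact congrArg (A.fr (X := envObj k R) a) (mul_one e).symm

theorem exists_fr_one (z : A.monad.obj (envObj k R)) :
    ∃ a, A.fm _ (A.fr (X := envObj k R) a (1 : Env k R)) = z := by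
  obtain ⟨z, rfl⟩ := (A.fm (envObj k R)).surjective z
  induction z using EnvAlgebra.fr_ind with
  | zero =>
    have h := EnvAlgebra.fr_add_left (X := envObj k R) (0 : A.carrier) 0 (1 : Env k R)
    rw [add_zero, left_eq_add] at h
    exact ⟨0, congrArg _ h⟩
  | add x y hx hy =>
    obtain ⟨a, ha⟩ := hx
    obtain ⟨b, hb⟩ := hy
    exact ⟨a + b, by rw [EnvAlgebra.fr_add_left, map_add, map_add, ha, hb]⟩
  | fr a e => exact ⟨a * A.st e, congrArg _ (fr_env a e).symm⟩

theorem fr_one_injective {a b : A.carrier}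
    (h : A.fr (X := envObj k R) a (1 : Env k R) = A.fr (X := envObj k R) b (1 : Env k R)) :
    a = b := by
  -- The map `a ⊗ e ↦ a (s ⊗ t)(e)` is a left inverse of `a ↦ a ⊗ 1`.
  have h1 := congrArg (EnvAlgebra.frLift (A := A) (X := envObj k R)
    (fun a (e : Env k R) => a * A.st e) (fun a b e => add_mul a b (A.st e))
    (fun a e e' => by
      change a * A.st (HAdd.hAdd (α := Env k R) e e') = _
      rw [map_add, mul_add])
    (fun a e e' => by
      change _ = a * A.st (HMul.hMul (α := Env k R) e e')
      rw [map_mul, mul_assoc])) h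
  simpa using h1

end EnvObj

section

variable {k : Type w} [CommRing k] {R : Type u} [Ring R] [Algebra k R]
  {C : Type u₁} [Category.{v₁} C] {U : C ⥤ BimoduleCat k R} {L : BimoduleCat k R ⥤ C}
  (adj : L ⊣ U) {A : EnvAlgebra k R} {K : C ⥤ A.Mod}
  (j : K ⋙ A.forget ≅ U)

/-- If `U` has a right adjoint, the comparison morphisms are isomorphisms as soon as the one at
`R ⊗ Rᵒᵖ` is: both sides are left adjoints, since restriction of scalars has the coextension of
scalars as a right adjoint. -/
theorem isIso_comparison {W : BimoduleCat k R ⥤ C} (adj' : U ⊣ W)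
    (h : IsIso (comparison adj j (envObj k R))) (X : BimoduleCat k R) :
    IsIso (comparison adj j X) :=
  isIso_app_of_isIso_app_envObj
    (A.adj.comp (ModuleCat.restrictCoextendScalarsAdj.{u} A.st.toRingHom)) (adj.comp adj')
    { app := comparison adj j, naturality := fun _ _ => comparison_natural adj j } h X

end

/-! ### The algebra of a functor with a left adjoint -/

section Reconstruction

variable {k : Type w} [CommRing k] {R : Type u} [Ring R] [Algebra k R]
  {C : Type u₁} [Category.{v₁} C] {U : C ⥤ BimoduleCat k R} {L : BimoduleCat k R ⥤ C}
  (adj : L ⊣ U)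

/-- The universal element of `U P`, where `P = L (R ⊗ Rᵒᵖ)` represents the functor `U`. -/
def univ : U.obj (L.obj (envObj k R)) := (adj.unit.app (envObj k R)).hom (1 : Env k R)

/-- The morphism `P → X` that classifies an element of `U X`. -/
def hat {X : C} (x : U.obj X) : L.obj (envObj k R) ⟶ X := (adj.homEquiv _ X).symm (pt x)

theorem map_hat_univ {X : C} (x : U.obj X) : (U.map (hat adj x)).hom (univ adj) = x := by
  have h : adj.unit.app (envObj k R) ≫ U.map (hat adj x) = pt x :=
    (adj.homEquiv_unit _ _ _).symm.trans (Equiv.apply_symm_apply _ _)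
  exact (congrArg (fun p => p.hom (1 : Env k R)) h).trans (pt_one x)

theorem map_comp_univ {X Y : C} (f : L.obj (envObj k R) ⟶ X) (g : X ⟶ Y) :
    (U.map (f ≫ g)).hom (univ adj) = (U.map g).hom ((U.map f).hom (univ adj)) := by
  rw [U.map_comp]
  rfl

variable {adj} in
theorem univ_hom_ext {X : C} {f g : L.obj (envObj k R) ⟶ X}
    (h : (U.map f).hom (univ adj) = (U.map g).hom (univ adj)) : f = g := by
  refine (adj.homEquiv _ X).injective ?_
  rw [adj.homEquiv_unit, adj.homEquiv_unit]
  exact envObj_hom_ext h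

theorem hat_comp {X Y : C} (x : U.obj X) (f : X ⟶ Y) :
    hat adj x ≫ f = hat adj ((U.map f).hom x) :=
  univ_hom_ext (adj := adj) (by
    rw [map_hat_univ, U.map_comp]
    exact congrArg (U.map f).hom (map_hat_univ adj x))

theorem hat_univ : hat adj (univ adj) = 𝟙 _ :=
  univ_hom_ext (adj := adj) (by rw [map_hat_univ, U.map_id]; rfl)

/-- The underlying type of the reconstructed algebra, that of `U P`. -/
def Recon (_ : L ⊣ U) : Type u := U.obj (L.obj (envObj k R))

instance : AddCommGroup (Recon adj) :=
  inferInstanceAs (AddCommGroup (U.obj (L.obj (envObj k R))))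

/-- The identity between elements of the reconstructed algebra and elements of `U P`. -/
def Recon.val : Recon adj ≃+ U.obj (L.obj (envObj k R)) := AddEquiv.refl _

/-- An element `a` of `U P` acts on `U X` by `a · x = U(x̂)(a)`, for the morphism `x̂ : P → X` that
classifies `x`. -/
def reconAct {X : C} (a : Recon adj) (x : U.obj X) : U.obj X :=
  (U.map (hat adj x)).hom (Recon.val adj a)

/-- Morphisms in the image of `U` commute with the action. -/
theorem map_reconAct {X Y : C} (f : X ⟶ Y) (a : Recon adj) (x : U.obj X) :
    (U.map f).hom (reconAct adj a x) = reconAct adj a ((U.map f).hom x) := by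
  rw [reconAct, reconAct, ← hat_comp, U.map_comp]
  rfl

theorem add_reconAct {X : C} (a b : Recon adj) (x : U.obj X) :
    reconAct adj (a + b) x = reconAct adj a x + reconAct adj b x := by
  rw [reconAct, map_add, map_add]
  rfl

theorem reconAct_univ (a : Recon adj) : reconAct adj a (univ adj) = Recon.val adj a := by
  rw [reconAct, hat_univ, U.map_id]
  rfl

theorem zero_reconAct {X : C} (x : U.obj X) : reconAct adj 0 x = 0 := by
  simpa using add_reconAct adj 0 0 x

theorem hat_smul [Preadditive C] [Linear k C] [U.Linear k] {X : C} (c : k) (x : U.obj X) : hat adj (c • x) = c • hat adj x :=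
  univ_hom_ext (adj := adj) (by
    rw [map_hat_univ, U.map_smul]
    exact (congrArg (fun y => c • y) (map_hat_univ adj x)).symm)

variable [Preadditive C] [U.Additive]

theorem hat_add {X : C} (x y : U.obj X) : hat adj (x + y) = hat adj x + hat adj y :=
  univ_hom_ext (adj := adj) (by
    rw [map_hat_univ, U.map_add]
    exact (congrArg₂ (· + ·) (map_hat_univ adj x) (map_hat_univ adj y)).symm)

theorem reconAct_add {X : C} (a : Recon adj) (x y : U.obj X) :
    reconAct adj a (x + y) = reconAct adj a x + reconAct adj a y := by
  rw [reconAct, hat_add, U.map_add]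
  rfl

theorem reconAct_zero {X : C} (a : Recon adj) : reconAct adj a (0 : U.obj X) = 0 := by
  simpa using reconAct_add adj a (0 : U.obj X) 0

instance : Ring (Recon adj) :=
  { (inferInstance : AddCommGroup (Recon adj)) with
    mul := fun a b => (Recon.val adj).symm (reconAct adj a (Recon.val adj b))
    one := (Recon.val adj).symm (univ adj)
    one_mul := fun a => map_hat_univ adj _
    mul_one := fun a => reconAct_univ adj a
    mul_assoc := fun a b c => (map_reconAct adj (hat adj (Recon.val adj c)) a _)
    left_distrib := fun a b c => reconAct_add adj a _ _
    right_distrib := fun a b c => add_reconAct adj a b _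
    zero_mul := fun a => zero_reconAct adj _
    mul_zero := fun a => reconAct_zero adj a }

theorem Recon.val_mul (a b : Recon adj) :
    Recon.val adj (a * b) = reconAct adj a (Recon.val adj b) := rfl

theorem Recon.val_one : Recon.val adj 1 = univ adj := rfl

/-- The action of the reconstructed algebra on `U X`. -/
abbrev reconModule (X : C) : Module (Recon adj) (U.obj X) where
  smul a x := reconAct adj a x
  one_smul x := map_hat_univ adj x
  mul_smul a _ x := map_reconAct adj (hat adj x) a _
  smul_zero := reconAct_zero adj
  smul_add := reconAct_add adj
  add_smul := add_reconAct adj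
  zero_smul := zero_reconAct adj

/-- The map `e ↦ e · 1` from `R ⊗ Rᵒᵖ`. -/
def reconUnit : Env k R →+* Recon adj where
  toFun e := (Recon.val adj).symm (e • univ adj)
  map_one' := one_smul _ (univ adj)
  map_mul' e e' := by
    refine (mul_smul e e' (univ adj)).trans ?_
    refine Eq.symm ((map_smul (U.map (hat adj (e' • univ adj))).hom e (univ adj)).trans ?_)
    rw [map_hat_univ]
  map_zero' := zero_smul (Env k R) (univ adj)
  map_add' e e' := add_smul e e' (univ adj)

theorem reconAct_reconUnit {X : C} (e : Env k R) (x : U.obj X) :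
    reconAct adj (reconUnit adj e) x = e • x := by
  refine (map_smul (U.map (hat adj x)).hom e (univ adj)).trans ?_
  rw [map_hat_univ]

variable [Linear k C] [U.Linear k]

instance : Algebra k (Recon adj) :=
  -- `k` is central because `c · 1` is classified by the scalar endomorphism `c` of `P`.
  ((reconUnit adj).comp (algebraMap k (Env k R))).toAlgebra' (fun c a => by
    refine (reconAct_reconUnit adj _ _).trans (Eq.symm ?_)
    change (U.map (hat adj (c • univ adj))).hom (Recon.val adj a) = c • Recon.val adj a
    rw [hat_smul, hat_univ, U.map_smul, U.map_id]
    rfl)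

/-- The reconstructed algebra over `R ⊗ Rᵒᵖ`. -/
def reconEnvAlgebra : EnvAlgebra k R where
  carrier := Recon adj
  st := { reconUnit adj with commutes' := fun _ => rfl }

/-- The lift of `U` to modules over the reconstructed algebra. -/
def reconFunctor : C ⥤ (reconEnvAlgebra adj).Mod where
  obj X := letI := reconModule adj X; ModuleCat.of (Recon adj) (U.obj X)
  map {X Y} f := EnvAlgebra.linHom (E := Recon adj)
    (V := letI := reconModule adj X; ModuleCat.of (Recon adj) (U.obj X))
    (W := letI := reconModule adj Y; ModuleCat.of (Recon adj) (U.obj Y))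
    (U.map f).hom.toAddMonoidHom (map_reconAct adj f)
  map_id X := by
    ext x
    exact congrArg (fun f => f.hom x) (U.map_id X)
  map_comp f g := by
    ext x
    exact congrArg (fun f => f.hom x) (U.map_comp f g)

/-- The lift of `U` to modules agrees with `U` on underlying bimodules. -/
def reconFunctorIso : reconFunctor adj ⋙ (reconEnvAlgebra adj).forget ≅ U :=
  NatIso.ofComponents (fun X => EnvAlgebra.linIso
    (V := (reconEnvAlgebra adj).forget.obj ((reconFunctor adj).obj X))
    (AddEquiv.refl (U.obj X)) (reconAct_reconUnit adj)) (fun _ => rfl)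

theorem isStrict_reconFunctorIso (X : C) : IsStrict ((reconFunctorIso adj).hom.app X) :=
  isStrict_of_heq (V := (reconEnvAlgebra adj).forget.obj ((reconFunctor adj).obj X))
    (W := U.obj X) rfl HEq.rfl ((reconFunctorIso adj).hom.app X) fun _ => HEq.rfl

/-- The bimodule underlying the reconstructed algebra is `U P`. -/
def reconRegularIso : (reconEnvAlgebra adj).regular ≅ U.obj (L.obj (envObj k R)) :=
  (reconFunctorIso adj).app (L.obj (envObj k R))

instance : (reconFunctor adj).Additive where
  map_add {X Y f g} := by
    ext x
    exact congrArg (fun f => f.hom x) (U.map_add (f := f) (g := g))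

instance : (reconFunctor adj).Linear k where
  map_smul {X Y} f c := by
    ext x
    refine (congrArg (fun f => f.hom x) (U.map_smul c f)).trans ?_
    exact (reconAct_reconUnit adj (algebraMap k (Env k R) c) ((U.map f).hom x)).symm

/-- Elements of `U X` as elements of the module lifting `U X`. -/
def toRecon (X : C) : U.obj X ≃+ (reconFunctor adj).obj X := AddEquiv.refl _

theorem ev_toRecon {X : C} (x : U.obj X) :
    (reconEnvAlgebra adj).ev ((reconFunctor adj).obj X) (toRecon adj X x) =
      (reconRegularIso adj).hom ≫ U.map (hat adj x) ≫ (reconFunctorIso adj).inv.app X := rfl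

theorem rmul_recon (a : Recon adj) :
    (reconEnvAlgebra adj).rmul a =
      (reconRegularIso adj).hom ≫ U.map (hat adj (Recon.val adj a)) ≫
        (reconRegularIso adj).inv := rfl

theorem rmul_recon_one : (reconEnvAlgebra adj).rmul (1 : Recon adj) = 𝟙 _ := by
  ext a
  exact mul_one ((reconEnvAlgebra adj).el.symm a)

/-- The comparison morphism at `R ⊗ Rᵒᵖ` is `a ⊗ 1 ↦ a`. -/
theorem comparison_envObj_fr (a : Recon adj) :
    (comparison adj (reconFunctorIso adj) (envObj k R)).hom
      ((reconEnvAlgebra adj).fm _ ((reconEnvAlgebra adj).fr a (1 : Env k R))) =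
        Recon.val adj a :=
  (congrArg ((actOn (reconFunctorIso adj)).app (L.obj (envObj k R))).hom
    (EnvAlgebra.monad_map (A := reconEnvAlgebra adj)
      (adj.unit.app (envObj k R)) a (1 : Env k R))).trans
  ((congrArg ((reconEnvAlgebra adj).act _ ≫ (reconFunctorIso adj).hom.app _).hom
    (EnvAlgebra.monad_map (A := reconEnvAlgebra adj)
      ((reconFunctorIso adj).inv.app _) a (univ adj))).trans
    (reconAct_univ adj a))

end Reconstruction

/-! ### The bialgebroid of a monoidal functor with a left adjoint -/

section

variable {M : Type*} [Category* M] [MonoidalCategory M]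

/-- The transport of a comonoid structure along an isomorphism. -/
abbrev comonObjOfIso {X Y : M} (e : X ≅ Y) [ComonObj Y] : ComonObj X where
  counit := e.hom ≫ ComonObj.counit
  comul := e.hom ≫ ComonObj.comul ≫ (e.inv ⊗ₘ e.inv)
  counit_comul := by
    have h : (e.inv ⊗ₘ e.inv) ≫ (e.hom ≫ ComonObj.counit) ▷ X =
        ComonObj.counit ▷ Y ≫ 𝟙_ M ◁ e.inv := by
      simp only [← tensorHom_id, ← id_tensorHom, tensorHom_comp_tensorHom, Iso.inv_hom_id_assoc,
        Category.comp_id, Category.id_comp]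
    simp only [Category.assoc]
    rw [h, ComonObj.counit_comul_assoc, ← leftUnitor_inv_naturality, Iso.hom_inv_id_assoc]
  comul_counit := by
    have h : (e.inv ⊗ₘ e.inv) ≫ X ◁ (e.hom ≫ ComonObj.counit) =
        Y ◁ ComonObj.counit ≫ e.inv ▷ 𝟙_ M := by
      simp only [← tensorHom_id, ← id_tensorHom, tensorHom_comp_tensorHom, Iso.inv_hom_id_assoc,
        Category.comp_id, Category.id_comp]
    simp only [Category.assoc]
    rw [h, ComonObj.comul_counit_assoc, ← rightUnitor_inv_naturality, Iso.hom_inv_id_assoc]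
  comul_assoc := by
    have h : (e.inv ⊗ₘ e.inv) ≫ X ◁ (e.hom ≫ ComonObj.comul ≫ (e.inv ⊗ₘ e.inv)) =
        Y ◁ ComonObj.comul ≫ (e.inv ⊗ₘ (e.inv ⊗ₘ e.inv)) := by
      simp only [← id_tensorHom, tensorHom_comp_tensorHom, Iso.inv_hom_id_assoc, Category.comp_id,
        Category.id_comp]
    have h' : (e.inv ⊗ₘ e.inv) ≫ (e.hom ≫ ComonObj.comul ≫ (e.inv ⊗ₘ e.inv)) ▷ X =
        ComonObj.comul ▷ Y ≫ ((e.inv ⊗ₘ e.inv) ⊗ₘ e.inv) := by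
      simp only [← tensorHom_id, tensorHom_comp_tensorHom, Iso.inv_hom_id_assoc, Category.comp_id,
        Category.id_comp]
    simp only [Category.assoc]
    rw [h, reassoc_of% h', associator_naturality, ComonObj.comul_assoc_assoc]

end

section Reconstruction

variable {k : Type w} [CommRing k] {R : Type u} [Ring R] [Algebra k R]
  {C : Type u₁} [Category.{v₁} C] [MonoidalCategory C] {U : C ⥤ BimoduleCat k R} [U.Monoidal]
  {L : BimoduleCat k R ⥤ C} (adj : L ⊣ U)

theorem map_tensorHom_μ {X Y X' Y' : C} (f : X ⟶ X') (g : Y ⟶ Y') (x : U.obj X) (y : U.obj Y) :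
    (U.map (f ⊗ₘ g)).hom ((μ U X Y).hom (tmul x y)) =
      (μ U X' Y').hom (tmul ((U.map f).hom x) ((U.map g).hom y)) :=
  (congrArg (fun p => p.hom (tmul x y)) (μ_natural U f g)).symm

theorem map_whiskerRight_μ {X Y X' : C} (f : X ⟶ X') (x : U.obj X) (y : U.obj Y) :
    (U.map (f ▷ Y)).hom ((μ U X Y).hom (tmul x y)) =
      (μ U X' Y).hom (tmul ((U.map f).hom x) y) :=
  (congrArg (fun p => p.hom (tmul x y)) (μ_natural_left U f Y)).symm

theorem map_whiskerLeft_μ {X Y Y' : C} (g : Y ⟶ Y') (x : U.obj X) (y : U.obj Y) :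
    (U.map (X ◁ g)).hom ((μ U X Y).hom (tmul x y)) =
      (μ U X Y').hom (tmul x ((U.map g).hom y)) :=
  (congrArg (fun p => p.hom (tmul x y)) (μ_natural_right U X g)).symm

theorem ε_unitEl_injective {r r' : R} (h : (ε U).hom (unitEl k R r) = (ε U).hom (unitEl k R r')) :
    r = r' :=
  (unitEl k R).injective ((ConcreteCategory.bijective_of_isIso (ε U)).1 h)

/-- The comultiplication of the object `P` representing `U`, which classifies `1 ⊗ 1`. -/
def univComul : L.obj (envObj k R) ⟶ L.obj (envObj k R) ⊗ L.obj (envObj k R) :=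
  hat adj ((μ U _ _).hom (tmul (univ adj) (univ adj)))

/-- The counit of the object `P` representing `U`, which classifies `1`. -/
def univCounit : L.obj (envObj k R) ⟶ 𝟙_ C := hat adj ((ε U).hom (unitEl k R 1))

theorem map_univComul : (U.map (univComul adj)).hom (univ adj) =
    (μ U _ _).hom (tmul (univ adj) (univ adj)) := map_hat_univ adj _

theorem map_univCounit : (U.map (univCounit adj)).hom (univ adj) =
    (ε U).hom (unitEl k R 1) := map_hat_univ adj _

/-- The object representing `U` is a comonoid. -/
@[reducible]
def univComon : ComonObj (L.obj (envObj k R)) where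
  counit := univCounit adj
  comul := univComul adj
  counit_comul := by
    refine univ_hom_ext (adj := adj) ?_
    rw [map_comp_univ, map_univComul, map_whiskerRight_μ, map_univCounit]
    exact congrArg (fun p => p.hom (univ adj)) (Functor.LaxMonoidal.left_unitality_inv U _)
  comul_counit := by
    refine univ_hom_ext (adj := adj) ?_
    rw [map_comp_univ, map_univComul, map_whiskerLeft_μ, map_univCounit]
    exact congrArg (fun p => p.hom (univ adj)) (Functor.LaxMonoidal.right_unitality_inv U _)
  comul_assoc := by
    refine univ_hom_ext (adj := adj) ?_
    have h := congrArg (fun p => p.hom (tmul (tmul (univ adj) (univ adj)) (univ adj)))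
      (Functor.LaxMonoidal.associativity (F := U) (L.obj (envObj k R)) (L.obj (envObj k R))
        (L.obj (envObj k R)))
    rw [map_comp_univ, map_comp_univ, map_univComul, map_whiskerLeft_μ, U.map_comp]
    refine Eq.trans ?_ (congrArg (U.map (α_ _ _ _).hom).hom
      (map_whiskerRight_μ (univComul adj) (univ adj) (univ adj))).symm
    rw [map_univComul]
    exact h.symm

/-- The comultiplication of `P` followed by `x̂ ⊗ ŷ` classifies `x ⊗ y`. -/
theorem univComul_tensorHom {X Y : C} (x : U.obj X) (y : U.obj Y) :
    univComul adj ≫ (hat adj x ⊗ₘ hat adj y) = hat adj ((μ U X Y).hom (tmul x y)) := by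
  rw [univComul, hat_comp, map_tensorHom_μ, map_hat_univ, map_hat_univ]

variable [Preadditive C] [U.Additive] [Linear k C] [U.Linear k]

/-- The comonoid structure on the reconstructed algebra, as the image of `P` under `U`. -/
instance reconComon : ComonObj (reconEnvAlgebra adj).regular :=
  letI := univComon adj
  letI := Functor.obj.instComonObj (L.obj (envObj k R)) U
  comonObjOfIso (reconRegularIso adj)

/-- The map `a ↦ a₍₁₎ x ⊗ a₍₂₎ y` corresponds to `a ↦ a · (x ⊗ y)`. -/
theorem comul_ev {X Y : C} (x : U.obj X) (y : U.obj Y) :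
    ComonObj.comul ≫ ((reconEnvAlgebra adj).ev _ (toRecon adj X x) ⊗ₘ
      (reconEnvAlgebra adj).ev _ (toRecon adj Y y)) =
    (reconRegularIso adj).hom ≫ U.map (hat adj ((μ U X Y).hom (tmul x y))) ≫ δ U X Y ≫
      ((reconFunctorIso adj).inv.app X ⊗ₘ (reconFunctorIso adj).inv.app Y) := by
  have h : ComonObj.comul (X := (reconEnvAlgebra adj).regular) =
      (reconRegularIso adj).hom ≫ (U.map (univComul adj) ≫ δ U _ _) ≫
        ((reconRegularIso adj).inv ⊗ₘ (reconRegularIso adj).inv) := rfl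
  rw [h, ← univComul_tensorHom, ev_toRecon, ev_toRecon, U.map_comp]
  simp only [Category.assoc, tensorHom_comp_tensorHom, Iso.inv_hom_id_assoc]
  rw [← δ_natural_assoc, tensorHom_comp_tensorHom]

/-- The comultiplication of the reconstructed algebra corresponds to the comultiplication of `P`. -/
theorem comul_recon (a : Recon adj) : (reconEnvAlgebra adj).comul a =
    ((reconRegularIso adj).inv ⊗ₘ (reconRegularIso adj).inv).hom
      ((δ U _ _).hom ((U.map (univComul adj)).hom (Recon.val adj a))) := rfl

/-- The counit of the reconstructed algebra corresponds to the counit of `P`. -/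
theorem counit_recon (a : Recon adj) :
    (ε U).hom (unitEl k R ((reconEnvAlgebra adj).counit a)) =
      (U.map (univCounit adj)).hom (Recon.val adj a) :=
  congrArg (fun p => p.hom ((U.map (univCounit adj)).hom (Recon.val adj a)))
    (Functor.Monoidal.η_ε U)

theorem comul_rmul (a b : Recon adj) :
    ComonObj.comul ≫ ((reconEnvAlgebra adj).rmul a ⊗ₘ (reconEnvAlgebra adj).rmul b) =
    (reconRegularIso adj).hom ≫
      U.map (hat adj ((μ U _ _).hom (tmul (Recon.val adj a) (Recon.val adj b)))) ≫ δ U _ _ ≫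
        ((reconRegularIso adj).inv ⊗ₘ (reconRegularIso adj).inv) :=
  comul_ev adj (Recon.val adj a) (Recon.val adj b)

theorem recon_takeuchi (a : Recon adj) :
    EnvAlgebra.IsTakeuchi ((reconEnvAlgebra adj).comul a) := by
  intro r
  have h1 := comul_rmul adj ((reconEnvAlgebra adj).t r) 1
  have h2 := comul_rmul adj 1 ((reconEnvAlgebra adj).s r)
  have h3 : (tmul (Recon.val adj ((reconEnvAlgebra adj).t r)) (univ adj) :
      ↑(U.obj (L.obj (envObj k R)) ⊗ U.obj (L.obj (envObj k R)))) =
        tmul (univ adj) (Recon.val adj ((reconEnvAlgebra adj).s r)) := tmul_balanced _ _ r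
  rw [Recon.val_one, rmul_recon_one, tensorHom_id, h3] at h1
  rw [Recon.val_one, rmul_recon_one, id_tensorHom, ← h1] at h2
  exact congrArg (fun p => p.hom ((reconEnvAlgebra adj).el a)) h2.symm

/-- The isomorphism `U X ⊗_R U Y ≅ U (X ⊗ Y)`, for the modules lifting `U X` and `U Y`. -/
def reconμ (X Y : C) : (reconEnvAlgebra adj).forget.obj ((reconFunctor adj).obj X) ⊗
    (reconEnvAlgebra adj).forget.obj ((reconFunctor adj).obj Y) ≅ U.obj (X ⊗ Y) :=
  ((reconFunctorIso adj).app X ⊗ᵢ (reconFunctorIso adj).app Y) ≪≫ Functor.Monoidal.μIso U X Y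

theorem comul_ev_reconμ {X Y : C} (x : U.obj X) (y : U.obj Y) :
    ComonObj.comul ≫ ((reconEnvAlgebra adj).ev _ (toRecon adj X x) ⊗ₘ
      (reconEnvAlgebra adj).ev _ (toRecon adj Y y)) ≫ (reconμ adj X Y).hom =
        (reconRegularIso adj).hom ≫ U.map (hat adj ((μ U X Y).hom (tmul x y))) := by
  have h : ComonObj.comul ≫ ((reconEnvAlgebra adj).ev _ (toRecon adj X x) ⊗ₘ
      (reconEnvAlgebra adj).ev _ (toRecon adj Y y)) = (reconRegularIso adj).hom ≫
        U.map (hat adj ((μ U X Y).hom (tmul x y))) ≫ (reconμ adj X Y).inv := comul_ev adj x y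
  rw [reassoc_of% h, Iso.inv_hom_id, Category.comp_id]

/-- The comultiplication is compatible with the actions of the reconstructed algebra:
`a · (x ⊗ y) = a₍₁₎ x ⊗ a₍₂₎ y` in `U (X ⊗ Y)`. -/
theorem takeuchiAct_recon (a : Recon adj) (X Y : C) (z) :
    (reconμ adj X Y).hom.hom (EnvAlgebra.takeuchiAct (recon_takeuchi adj a)
      ((reconFunctor adj).obj X) ((reconFunctor adj).obj Y) z) =
      reconAct adj a ((reconμ adj X Y).hom.hom z) := by
  induction z using tmul_ind with
  | zero => rw [map_zero, map_zero, reconAct_zero]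
  | add x y hx hy => rw [map_add, map_add, map_add, hx, hy, reconAct_add]
  | tmul x y =>
    exact congrArg (fun p => p.hom ((reconEnvAlgebra adj).el a)) (comul_ev_reconμ adj x y)

theorem reconμ_comul (a : Recon adj) :
    (reconμ adj _ _).hom.hom ((reconEnvAlgebra adj).comul a) =
      (U.map (univComul adj)).hom (Recon.val adj a) :=
  congrArg (fun p => p.hom ((U.map (univComul adj)).hom (Recon.val adj a)))
    (reconμ adj (L.obj (envObj k R)) (L.obj (envObj k R))).inv_hom_id

theorem map_univCounit_s (r : R) : (U.map (univCounit adj)).hom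
    (Recon.val adj ((reconEnvAlgebra adj).s r)) = (ε U).hom (unitEl k R r) := by
  have h := hom_lact (U.map (univCounit adj)) r (univ adj)
  rw [map_univCounit, ← hom_lact, lact_unitEl, mul_one] at h
  exact h

theorem map_univCounit_t (r : R) : (U.map (univCounit adj)).hom
    (Recon.val adj ((reconEnvAlgebra adj).t r)) = (ε U).hom (unitEl k R r) := by
  have h := hom_ract (U.map (univCounit adj)) r (univ adj)
  rw [map_univCounit, ← hom_ract, ract_unitEl, one_mul] at h
  exact h

/-- The counit is a morphism of modules to `U 𝟙`, so `ε(ab)` depends on `b` only through `ε(b)`. -/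
theorem counit_mul_eq_of (a : Recon adj) {b b' : Recon adj}
    (h : (U.map (univCounit adj)).hom (Recon.val adj b) =
      (U.map (univCounit adj)).hom (Recon.val adj b')) :
    (reconEnvAlgebra adj).counit (a * b) = (reconEnvAlgebra adj).counit (a * b') :=
  ε_unitEl_injective (U := U) (by
    rw [counit_recon, counit_recon, Recon.val_mul, Recon.val_mul, map_reconAct, map_reconAct, h])

/-- The bialgebroid reconstructed from a monoidal functor with a left adjoint. -/
def reconBialgebroid : LeftBialgebroid k R where
  toEnvAlgebra := reconEnvAlgebra adj
  comul_takeuchi := recon_takeuchi adj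
  comul_one := by
    refine (comul_recon adj 1).trans ?_
    refine (congrArg (fun z => ((reconRegularIso adj).inv ⊗ₘ (reconRegularIso adj).inv).hom
      ((δ U _ _).hom z)) (map_univComul adj)).trans ?_
    exact congrArg (fun p => ((reconRegularIso adj).inv ⊗ₘ (reconRegularIso adj).inv).hom
      (p.hom (tmul (univ adj) (univ adj)))) (Functor.Monoidal.μ_δ U _ _)
  comul_mul a b := by
    refine (ConcreteCategory.bijective_of_isIso (reconμ adj (L.obj (envObj k R))
      (L.obj (envObj k R))).hom).1 ?_
    refine (reconμ_comul adj _).trans (Eq.trans ?_ (takeuchiAct_recon adj a _ _ _).symm)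
    refine Eq.trans ?_ (congrArg (reconAct adj a) (reconμ_comul adj b)).symm
    exact map_reconAct adj (univComul adj) a (Recon.val adj b)
  counit_one := ε_unitEl_injective ((counit_recon adj 1).trans (map_univCounit adj))
  counit_mul_t a b := counit_mul_eq_of adj a
    ((map_univCounit_t adj _).trans (counit_recon adj b))
  counit_mul_s a b := counit_mul_eq_of adj a
    ((map_univCounit_s adj _).trans (counit_recon adj b))

/-! ### The monoidal structure of the lift -/

theorem ev_tensor_δ {A : LeftBialgebroid k R} {V W : A.Mod} (v : V) (w : W) :
    A.ev (A.tensorMod V W) (LeftBialgebroid.tensorEquiv V W (tmul (A.toU V v) (A.toU W w))) ≫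
      δ A.forget V W = ComonObj.comul ≫ (A.ev V v ⊗ₘ A.ev W w) := by
  have h : (LeftBialgebroid.forgetTensor V W).hom ≫ δ A.forget V W = 𝟙 _ :=
    Functor.Monoidal.μ_δ A.forget V W
  rw [LeftBialgebroid.ev_tensor, Category.assoc, Category.assoc]
  exact congrArg (fun p => ComonObj.comul ≫ p)
    ((congrArg (fun p => (A.ev V v ⊗ₘ A.ev W w) ≫ p) h).trans (Category.comp_id _))

theorem ev_unit_η {A : LeftBialgebroid k R} (r : R) :
    A.ev A.unitMod (A.unitModEquiv (unitEl k R r)) ≫ η A.forget =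
      A.rmul (A.s r) ≫ ComonObj.counit := by
  have h : (LeftBialgebroid.forgetUnit A).hom ≫ η A.forget = 𝟙 _ :=
    Functor.Monoidal.ε_η A.forget
  rw [LeftBialgebroid.ev_unit, Category.assoc, Category.assoc]
  exact congrArg (fun p => A.rmul (A.s r) ≫ p)
    ((congrArg (fun p => ComonObj.counit ≫ p) h).trans (Category.comp_id _))

theorem rmul_counit_recon (r : R) :
    ((reconEnvAlgebra adj).rmul ((reconEnvAlgebra adj).s r) ≫ ComonObj.counit) ≫ ε U =
      (reconRegularIso adj).hom ≫ U.map (hat adj ((ε U).hom (unitEl k R r))) := by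
  have h : ComonObj.counit (X := (reconEnvAlgebra adj).regular) =
      (reconRegularIso adj).hom ≫ U.map (univCounit adj) ≫ η U := rfl
  have h1 := rmul_recon adj ((reconEnvAlgebra adj).s r)
  rw [← map_univCounit_s adj r, ← hat_comp, h1, h]
  simp

/-- The lift of `U` to modules over the reconstructed bialgebroid. -/
def reconLift : C ⥤ (reconBialgebroid adj).Mod := reconFunctor adj

/-- The lift of `U` to modules agrees with `U` on underlying bimodules. -/
def reconLiftIso : reconLift adj ⋙ (reconBialgebroid adj).forget ≅ U := reconFunctorIso adj

theorem isStrict_reconLiftIso (X : C) : IsStrict ((reconLiftIso adj).hom.app X) :=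
  isStrict_reconFunctorIso adj X

/-- The structure morphism `K X ⊗ K Y → K (X ⊗ Y)` of the lift `K` of `U`, which is that of `U`. -/
def reconLiftμ (X Y : C) :
    (reconLift adj).obj X ⊗ (reconLift adj).obj Y ⟶ (reconLift adj).obj (X ⊗ Y) :=
  EnvAlgebra.liftHom (δ (reconBialgebroid adj).forget _ _ ≫
      ((reconLiftIso adj).hom.app X ⊗ₘ (reconLiftIso adj).hom.app Y) ≫ μ U X Y ≫
        (reconLiftIso adj).inv.app (X ⊗ Y))
    (LeftBialgebroid.lin_tensor _ fun x y => by
      refine (congrArg (fun p => p ≫ (reconμ adj X Y).hom ≫ (reconLiftIso adj).inv.app (X ⊗ Y))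
        (ev_tensor_δ (A := reconBialgebroid adj) (toRecon adj X x) (toRecon adj Y y))).trans ?_
      exact congrArg (fun p => p ≫ (reconLiftIso adj).inv.app (X ⊗ Y))
        (comul_ev_reconμ adj (X := X) (Y := Y) x y))

/-- The structure morphism `𝟙 → K 𝟙` of the lift `K` of `U`, which is that of `U`. -/
def reconLiftε : 𝟙_ (reconBialgebroid adj).Mod ⟶ (reconLift adj).obj (𝟙_ C) :=
  EnvAlgebra.liftHom (η (reconBialgebroid adj).forget ≫ ε U ≫ (reconLiftIso adj).inv.app (𝟙_ C))
    (fun r => by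
      refine (congrArg (fun p => p ≫ ε U ≫ (reconLiftIso adj).inv.app (𝟙_ C))
        (ev_unit_η (A := reconBialgebroid adj) r)).trans ?_
      exact congrArg (fun p => p ≫ (reconLiftIso adj).inv.app (𝟙_ C))
        (rmul_counit_recon adj r))

theorem forget_map_reconLiftε : (reconBialgebroid adj).forget.map (reconLiftε adj) =
    η (reconBialgebroid adj).forget ≫ ε U ≫ (reconLiftIso adj).inv.app (𝟙_ C) := rfl

theorem forget_map_reconLiftμ (X Y : C) :
    (reconBialgebroid adj).forget.map (reconLiftμ adj X Y) =
      δ (reconBialgebroid adj).forget _ _ ≫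
        ((reconLiftIso adj).hom.app X ⊗ₘ (reconLiftIso adj).hom.app Y) ≫ μ U X Y ≫
          (reconLiftIso adj).inv.app (X ⊗ Y) := rfl

instance : (reconLift adj).LaxMonoidal :=
  liftLaxMonoidal (reconLiftIso adj) (reconLiftε adj) (reconLiftμ adj)
    (by rw [forget_map_reconLiftε]; simp) (fun X Y => by rw [forget_map_reconLiftμ]; simp)

instance : NatTrans.IsMonoidal (reconLiftIso adj).hom where
  unit := by
    have h : ε (reconLift adj) = reconLiftε adj := rfl
    rw [Functor.LaxMonoidal.comp_ε, Category.assoc, h, forget_map_reconLiftε]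
    simp
  tensor X Y := by
    have h : μ (reconLift adj) X Y = reconLiftμ adj X Y := rfl
    rw [Functor.LaxMonoidal.comp_μ, Category.assoc, h, forget_map_reconLiftμ]
    simp

theorem isIso_of_forget {A : EnvAlgebra k R} {V W : A.Mod} (f : V ⟶ W)
    [h : IsIso (A.forget.map f)] : IsIso f := by
  rw [ConcreteCategory.isIso_iff_bijective] at h ⊢
  exact h

instance : (reconLift adj).Monoidal :=
  haveI : IsIso (ε (reconLift adj)) :=
    haveI : IsIso ((reconBialgebroid adj).forget.map (ε (reconLift adj))) :=
      inferInstanceAs (IsIso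
        (η (reconBialgebroid adj).forget ≫ ε U ≫ (reconLiftIso adj).inv.app (𝟙_ C)))
    isIso_of_forget _
  haveI (X Y : C) : IsIso (μ (reconLift adj) X Y) :=
    haveI : IsIso ((reconBialgebroid adj).forget.map (μ (reconLift adj) X Y)) :=
      inferInstanceAs (IsIso (δ (reconBialgebroid adj).forget _ _ ≫
        ((reconLiftIso adj).hom.app X ⊗ₘ (reconLiftIso adj).hom.app Y) ≫ μ U X Y ≫
          (reconLiftIso adj).inv.app (X ⊗ Y)))
    isIso_of_forget _
  Functor.Monoidal.ofLaxMonoidal _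

instance : (reconLift adj).Additive := inferInstanceAs (reconFunctor adj).Additive

instance : (reconLift adj).Linear k := inferInstanceAs ((reconFunctor adj).Linear k)

theorem isIso_comparison_recon {W : BimoduleCat k R ⥤ C} (adj' : U ⊣ W) (X : BimoduleCat k R) :
    IsIso (comparison adj (reconLiftIso adj) X) := by
  refine isIso_comparison adj (reconLiftIso adj) adj' ?_ X
  rw [ConcreteCategory.isIso_iff_bijective]
  constructor
  · intro z z' h
    obtain ⟨a, rfl⟩ := exists_fr_one z
    obtain ⟨b, rfl⟩ := exists_fr_one z'
    have h1 := ((comparison_envObj_fr adj a).symm.trans h).trans (comparison_envObj_fr adj b)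
    rw [(Recon.val adj).injective h1]
  · exact fun x => ⟨_, comparison_envObj_fr adj x⟩

theorem recon_isLaxUniversal {W : BimoduleCat k R ⥤ C} (adj' : U ⊣ W) :
    IsLaxUniversal U (reconBialgebroid adj) (reconLift adj) :=
  isLaxUniversal_of_comparison adj (reconLiftIso adj) (isStrict_reconLiftIso adj)
    (isIso_comparison_recon adj adj')

end Reconstruction

/-! ### Morphisms of bialgebroids over a fixed base -/

section Base

variable {k : Type w} [CommRing k] {R : Type u} [Ring R] [Algebra k R]
  {A B D : LeftBialgebroid k R}

namespace BialgebroidHom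

/-- The ambimonoidal condition over the identity functor, whose structure maps are identities. -/
theorem map_tensor_id (f : BialgebroidHom A B (𝟭 (BimoduleCat k R))) (X Y : BimoduleCat k R) :
    f.φ.app (X ⊗ Y) ≫ δ A.monad.toFunctor X Y =
      δ B.monad.toFunctor X Y ≫ (f.φ.app X ⊗ₘ f.φ.app Y) := by
  have h := f.ambimonoidal.tensor X Y
  rw [Functor.LaxMonoidal.id_μ, Functor.LaxMonoidal.id_μ] at h
  erw [Category.comp_id, CategoryTheory.Functor.map_id, Category.id_comp] at h
  exact h

theorem map_unit_id (f : BialgebroidHom A B (𝟭 (BimoduleCat k R))) :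
    f.φ.app (𝟙_ _) ≫ η A.monad.toFunctor = η B.monad.toFunctor := by
  have h := f.ambimonoidal.unit
  rw [Functor.LaxMonoidal.id_ε] at h
  erw [Category.comp_id, CategoryTheory.Functor.map_id, Category.id_comp] at h
  exact h

/-- A morphism of comonoidal monads over the identity functor, from its components. -/
def ofComponents (φ : ∀ X, B.monad.obj X ⟶ A.monad.obj X)
    (nat : ∀ {X Y : BimoduleCat k R} (f : X ⟶ Y),
      B.monad.map f ≫ φ Y = φ X ≫ A.monad.map f)
    (mul : ∀ X, B.monad.μ.app X ≫ φ X =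
      B.monad.map (φ X) ≫ φ (A.monad.obj X) ≫ A.monad.μ.app X)
    (unit : ∀ X, B.monad.η.app X ≫ φ X = A.monad.η.app X)
    (tensor : ∀ X Y, φ (X ⊗ Y) ≫ δ A.monad.toFunctor X Y =
      δ B.monad.toFunctor X Y ≫ (φ X ⊗ₘ φ Y))
    (counit : φ (𝟙_ _) ≫ η A.monad.toFunctor = η B.monad.toFunctor) :
    BialgebroidHom A B (𝟭 (BimoduleCat k R)) where
  φ := { app := φ, naturality := fun _ _ f => nat f }
  isMonadMorphism := ⟨mul, unit⟩
  ambimonoidal :=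
    { unit := by
        rw [Functor.LaxMonoidal.id_ε]
        erw [Category.comp_id, CategoryTheory.Functor.map_id, Category.id_comp]
        exact counit
      tensor := fun X Y => by
        rw [Functor.LaxMonoidal.id_μ, Functor.LaxMonoidal.id_μ]
        erw [Category.comp_id, CategoryTheory.Functor.map_id, Category.id_comp]
        exact tensor X Y }

variable (A) in
/-- The identity morphism of a bialgebroid. -/
def idHom : BialgebroidHom A A (𝟭 (BimoduleCat k R)) :=
  ofComponents (fun X => 𝟙 _) (by simp) (by simp) (by simp) (by simp) (by simp)

/-- The composition of morphisms of bialgebroids over the identity functor. -/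
def compHom (f : BialgebroidHom A B (𝟭 (BimoduleCat k R)))
    (g : BialgebroidHom B D (𝟭 (BimoduleCat k R))) :
    BialgebroidHom A D (𝟭 (BimoduleCat k R)) :=
  ofComponents (fun X => g.φ.app X ≫ f.φ.app X)
    (fun h => by
      have h1 := f.φ.naturality h
      have h2 := g.φ.naturality h
      dsimp at h1 h2
      rw [reassoc_of% h2, h1, Category.assoc])
    (fun X => by
      have h1 := f.isMonadMorphism.mul X
      have h2 := g.isMonadMorphism.mul X
      have h3 := g.φ.naturality (f.φ.app X)
      dsimp at h1 h2 h3
      rw [reassoc_of% h2, h1, Functor.map_comp, Category.assoc, Category.assoc, reassoc_of% h3])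
    (fun X => by
      have h1 := f.isMonadMorphism.unit X
      have h2 := g.isMonadMorphism.unit X
      dsimp at h1 h2
      rw [reassoc_of% h2, h1])
    (fun X Y => by
      have h1 := f.map_tensor_id X Y
      have h2 := g.map_tensor_id X Y
      rw [Category.assoc, h1, reassoc_of% h2, tensorHom_comp_tensorHom])
    (by
      have h1 := f.map_unit_id
      have h2 := g.map_unit_id
      rw [Category.assoc, h1, h2])

theorem compHom_app (f : BialgebroidHom A B (𝟭 (BimoduleCat k R)))
    (g : BialgebroidHom B D (𝟭 (BimoduleCat k R))) (X : BimoduleCat k R) :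
    (compHom f g).φ.app X = g.φ.app X ≫ f.φ.app X := rfl

variable (f : BialgebroidHom A B (𝟭 (BimoduleCat k R)))

/-- The map `i` of algebras with `φ (b ⊗ x) = i(b) ⊗ x`. -/
def toMap (b : B.carrier) : A.carrier :=
  (exists_fr_one ((f.φ.app (envObj k R)).hom
    (B.fm _ (B.fr (X := envObj k R) b (1 : Env k R))))).choose

/-- By naturality along `R ⊗ Rᵒᵖ → X`, `1 ↦ x`, the transformation is determined by `toMap`. -/
theorem φ_fr (X : BimoduleCat k R) (b : B.carrier) (x : X) :
    (f.φ.app X).hom (B.fm X (B.fr b x)) = A.fm X (A.fr (f.toMap b) x) := by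
  have h : A.fm _ (A.fr (X := envObj k R) (f.toMap b) (1 : Env k R)) =
      (f.φ.app (envObj k R)).hom (B.fm _ (B.fr (X := envObj k R) b (1 : Env k R))) :=
    (exists_fr_one ((f.φ.app (envObj k R)).hom
      (B.fm _ (B.fr (X := envObj k R) b (1 : Env k R))))).choose_spec
  have h1 := congrArg (fun p => p.hom (B.fm _ (B.fr (X := envObj k R) b (1 : Env k R))))
    (f.φ.naturality (pt x))
  have h2 := congrArg (A.monad.map (pt x)).hom h
  rw [EnvAlgebra.monad_map] at h2
  have h3 := congrArg (f.φ.app X).hom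
    (EnvAlgebra.monad_map (A := B.toEnvAlgebra) (pt x) b (1 : Env k R))
  rw [pt_one] at h2 h3
  exact h3.symm.trans (h1.trans h2.symm)

theorem eq_toMap {a : A.carrier} {b : B.carrier}
    (h : (f.φ.app (envObj k R)).hom (B.fm _ (B.fr (X := envObj k R) b (1 : Env k R))) =
      A.fm _ (A.fr (X := envObj k R) a (1 : Env k R))) : f.toMap b = a :=
  fr_one_injective ((A.fm _).injective ((f.φ_fr (envObj k R) b (1 : Env k R)).symm.trans h))

theorem toMap_add (b b' : B.carrier) : f.toMap (b + b') = f.toMap b + f.toMap b' :=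
  f.eq_toMap (by
    rw [EnvAlgebra.fr_add_left, EnvAlgebra.fr_add_left, map_add, map_add, map_add]
    exact congrArg₂ _ (f.φ_fr _ _ _) (f.φ_fr _ _ _))

theorem toMap_one : f.toMap 1 = 1 :=
  f.eq_toMap (congrArg (fun p => p.hom (1 : Env k R)) (f.isMonadMorphism.unit (envObj k R)))

theorem toMap_st (e : Env k R) : f.toMap (B.st e) = A.st e :=
  f.eq_toMap (by
    have h := fr_env (A := B.toEnvAlgebra) 1 e
    have h' := fr_env (A := A.toEnvAlgebra) 1 e
    rw [one_mul] at h h'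
    rw [← h, ← h']
    refine (f.φ_fr (envObj k R) 1 e).trans ?_
    rw [toMap_one])

theorem toMap_toMap (g : BialgebroidHom B A (𝟭 (BimoduleCat k R)))
    (h : g.φ.app (envObj k R) ≫ f.φ.app (envObj k R) = 𝟙 _) (a : A.carrier) :
    f.toMap (g.toMap a) = a :=
  f.eq_toMap (by
    have h1 := g.φ_fr (envObj k R) a (1 : Env k R)
    have h2 := congrArg (fun p => p.hom (A.fm _ (A.fr (X := envObj k R) a (1 : Env k R)))) h
    exact (congrArg (f.φ.app (envObj k R)).hom h1).symm.trans h2)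

/-- The map of algebras over `R ⊗ Rᵒᵖ` given by a morphism of bialgebroids over the identity
functor. -/
def toAlgHom : B.carrier →ₐ[k] A.carrier where
  toFun := f.toMap
  map_one' := f.toMap_one
  map_mul' b b' := f.eq_toMap (by
    have h := congrArg (fun p => p.hom (B.fm _ (B.fr b (B.fm _ (B.fr (X := envObj k R) b'
      (1 : Env k R)))))) (f.isMonadMorphism.mul (envObj k R))
    refine h.trans ?_
    have h1 := EnvAlgebra.monad_map (A := B.toEnvAlgebra) (f.φ.app (envObj k R)) b
      (B.fm _ (B.fr (X := envObj k R) b' (1 : Env k R)))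
    have h2 : (f.φ.app (envObj k R)).hom (B.fm _ (B.fr (X := envObj k R) b' (1 : Env k R))) =
        A.fm _ (A.fr (X := envObj k R) (f.toMap b') (1 : Env k R)) := f.φ_fr _ _ _
    rw [h2] at h1
    exact (congrArg (fun z => (A.monad.μ.app (envObj k R)).hom
      ((f.φ.app (A.monad.obj (envObj k R))).hom z)) h1).trans
        (congrArg (A.monad.μ.app (envObj k R)).hom (f.φ_fr _ _ _)))
  map_zero' := by
    have h := f.toMap_add 0 0
    rwa [add_zero, left_eq_add] at h
  map_add' := f.toMap_add
  commutes' c := by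
    rw [← B.st.commutes, ← A.st.commutes]
    exact f.toMap_st _

end BialgebroidHom

variable (A) in
/-- The isomorphism `a ↦ a ⊗ 1` of `A` with `A ⊗_{R^e} R^e`. -/
def regularToFree : A.regular ⟶ A.monad.obj (envObj k R) :=
  A.ev (A.freeObj (envObj k R)) (A.fr (X := envObj k R) 1 (1 : Env k R))

theorem regularToFree_el (a : A.carrier) :
    (regularToFree A).hom (A.el a) = A.fm _ (A.fr (X := envObj k R) a (1 : Env k R)) :=
  congrArg (fun b => A.fm _ (A.fr (X := envObj k R) b (1 : Env k R))) (mul_one a)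

instance : IsIso (regularToFree A) := by
  rw [ConcreteCategory.isIso_iff_bijective]
  constructor
  · intro x y h
    obtain ⟨a, rfl⟩ := A.el.surjective x
    obtain ⟨b, rfl⟩ := A.el.surjective y
    have h1 := ((regularToFree_el a).symm.trans h).trans (regularToFree_el b)
    rw [fr_one_injective ((A.fm _).injective h1)]
  · intro z
    obtain ⟨a, rfl⟩ := exists_fr_one z
    exact ⟨A.el a, regularToFree_el a⟩

/-- The comultiplication of `A` is the comonoidal structure of the monad at `R ⊗ Rᵒᵖ`. -/
theorem δ_fr_one (a : A.carrier) :
    (δ A.monad.toFunctor (envObj k R) (envObj k R)).hom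
      (A.fm _ (A.fr a (tmul (X := envObj k R) (Y := envObj k R) (1 : Env k R) (1 : Env k R)))) =
        (regularToFree A ⊗ₘ regularToFree A).hom (A.comul a) :=
  LeftBialgebroid.δ_monad_fr _ _ _ _ _

theorem η_fr_one (a : A.carrier) :
    (η A.monad.toFunctor).hom (A.fm _ (A.fr a (unitEl k R 1))) = unitEl k R (A.counit a) := by
  rw [LeftBialgebroid.η_monad_fr, LeftBialgebroid.s_one, mul_one]

/-- Mutually inverse morphisms of bialgebroids over the identity functor give an isomorphism of
bialgebroids. -/
def BialgebroidHom.toIso (f : BialgebroidHom A B (𝟭 (BimoduleCat k R)))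
    (g : BialgebroidHom B A (𝟭 (BimoduleCat k R)))
    (hfg : ∀ X, g.φ.app X ≫ f.φ.app X = 𝟙 _) (hgf : ∀ X, f.φ.app X ≫ g.φ.app X = 𝟙 _) :
    BialgebroidIso B A where
  e := AlgEquiv.ofAlgHom f.toAlgHom g.toAlgHom
    (AlgHom.ext (f.toMap_toMap g (hfg _))) (AlgHom.ext (g.toMap_toMap f (hgf _)))
  map_st := f.toMap_st
  isComonHom :=
    { hom_counit := by
        ext b
        obtain ⟨b, rfl⟩ := B.el.surjective b
        refine (unitEl k R).symm.injective ?_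
        change A.counit (f.toMap b) = B.counit b
        refine (unitEl k R).injective ?_
        rw [← η_fr_one, ← η_fr_one, ← f.map_unit_id]
        exact congrArg (η A.monad.toFunctor).hom (f.φ_fr _ _ _).symm
      hom_comul := by
        rw [← cancel_mono (regularToFree A ⊗ₘ regularToFree A), Category.assoc, Category.assoc,
          tensorHom_comp_tensorHom]
        have h : EnvAlgebra.regularMap f.toAlgHom f.toMap_st ≫ regularToFree A =
            regularToFree B ≫ f.φ.app (envObj k R) := by
          ext b
          obtain ⟨b, rfl⟩ := B.el.surjective b
          refine (regularToFree_el (f.toMap b)).trans ?_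
          exact (f.φ_fr _ _ _).symm.trans
            (congrArg (f.φ.app (envObj k R)).hom (regularToFree_el b)).symm
        refine Eq.trans ?_ (congrArg (fun p => ComonObj.comul ≫ (p ⊗ₘ p)) h).symm
        rw [← tensorHom_comp_tensorHom]
        ext b
        obtain ⟨b, rfl⟩ := B.el.surjective b
        refine (δ_fr_one (f.toMap b)).symm.trans ?_
        refine (congrArg (δ A.monad.toFunctor (envObj k R) (envObj k R)).hom
          (f.φ_fr _ _ _)).symm.trans ?_
        refine (congrArg (fun p => p.hom (B.fm _ (B.fr b
          (tmul (X := envObj k R) (Y := envObj k R) (1 : Env k R) (1 : Env k R)))))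
          (f.map_tensor_id (envObj k R) (envObj k R))).trans ?_
        exact congrArg (f.φ.app (envObj k R) ⊗ₘ f.φ.app (envObj k R)).hom (δ_fr_one b) }

end Base

/-! ### Uniqueness of the bialgebroid -/

section Uniqueness

variable {k : Type w} [CommRing k] {R : Type u} [Ring R] [Algebra k R]
  {C : Type u₁} [Category.{v₁} C] [MonoidalCategory C] {Q : C ⥤ BimoduleCat k R} [Q.LaxMonoidal]
  {A B : LeftBialgebroid k R} {K : C ⥤ A.Mod} [K.LaxMonoidal] {F : C ⥤ B.Mod} [F.LaxMonoidal]

theorem exists_iso_of_laxMonoidalEq (h : LaxMonoidalEq Q (K ⋙ A.forget)) :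
    ∃ j : K ⋙ A.forget ≅ Q, NatTrans.IsMonoidal j.hom ∧ ∀ X, IsStrict (j.hom.app X) := by
  obtain ⟨i, hi, hs⟩ := laxMonoidalEq_iff.1 h
  exact ⟨i.symm, inferInstanceAs (NatTrans.IsMonoidal i.inv),
    fun X => IsStrict.inv (i := i.app X) (hs X)⟩

theorem LaxMonoidalEq.comp_id (h : LaxMonoidalEq Q (K ⋙ A.forget)) :
    LaxMonoidalEq (Q ⋙ 𝟭 (BimoduleCat k R)) (K ⋙ A.forget) := by
  obtain ⟨i, hi, hs⟩ := laxMonoidalEq_iff.1 h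
  exact laxMonoidalEq_iff.2 ⟨Q.rightUnitor ≪≫ i,
    inferInstanceAs (NatTrans.IsMonoidal (Q.rightUnitor.hom ≫ i.hom)),
    fun X => IsStrict.comp ⟨rfl, rfl⟩ (hs X)⟩

theorem laxMonoidalEq_lift_id_iff (j : K ⋙ A.forget ≅ Q) (j' : F ⋙ B.forget ≅ Q)
    [NatTrans.IsMonoidal j.hom] [NatTrans.IsMonoidal j'.hom] (hj : ∀ X, IsStrict (j.hom.app X))
    (hj' : ∀ X, IsStrict (j'.hom.app X)) (f : BialgebroidHom A B (𝟭 (BimoduleCat k R))) :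
    LaxMonoidalEq (K ⋙ f.lift) F ↔
      ∀ X, f.φ.app (Q.obj X) ≫ (actOn j).app X = (actOn j').app X := by
  have : NatTrans.IsMonoidal (j' ≪≫ Q.rightUnitor.symm).hom :=
    inferInstanceAs (NatTrans.IsMonoidal (j'.hom ≫ Q.rightUnitor.inv))
  rw [laxMonoidalEq_lift_iff f j (j' ≪≫ Q.rightUnitor.symm) hj
    (fun X => IsStrict.comp (hj' X) ⟨rfl, rfl⟩)]
  have h (X : C) : (actOn (j' ≪≫ Q.rightUnitor.symm)).app X = (actOn j').app X := by
    simp [actOn_app]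
  simp only [h]
  rfl

/-- Two bialgebroids over `R` with the universal property are isomorphic. -/
theorem exists_bialgebroidIso {U : C ⥤ BimoduleCat k R} [U.Monoidal] {K : C ⥤ A.Mod} [K.Monoidal]
    {K' : C ⥤ B.Mod} [K'.Monoidal] (hK : LaxMonoidalEq U (K ⋙ A.forget))
    (hK' : LaxMonoidalEq U (K' ⋙ B.forget)) (hA : IsStrongUniversal U A K)
    (hB : IsStrongUniversal U B K') :
    ∃ (i : BialgebroidIso B A) (f : BialgebroidHom A B (𝟭 (BimoduleCat k R))),
      (∀ (X : BimoduleCat k R) (b : B.carrier) (x : X),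
        (f.φ.app X).hom (B.fm X (B.fr b x)) = A.fm X (A.fr (i.e b) x)) ∧
      LaxMonoidalEq (K ⋙ f.lift) K' := by
  have hAB := hA R B K' (𝟭 _) hK'.comp_id
  have hBA := hB R A K (𝟭 _) hK.comp_id
  have hAA := hA R A K (𝟭 _) hK.comp_id
  have hBB := hB R B K' (𝟭 _) hK'.comp_id
  obtain ⟨f, hf, -⟩ := hAB
  obtain ⟨g, hg, -⟩ := hBA
  obtain ⟨j, _, hj⟩ := exists_iso_of_laxMonoidalEq hK
  obtain ⟨j', _, hj'⟩ := exists_iso_of_laxMonoidalEq hK'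
  have hf' := (laxMonoidalEq_lift_id_iff j j' hj hj' f).1 hf
  have hg' := (laxMonoidalEq_lift_id_iff j' j hj' hj g).1 hg
  have h1 : BialgebroidHom.compHom f g = BialgebroidHom.idHom A := hAA.unique
    ((laxMonoidalEq_lift_id_iff j j hj hj _).2 fun X => by
      rw [BialgebroidHom.compHom_app, Category.assoc, hf', hg'])
    ((laxMonoidalEq_lift_id_iff j j hj hj _).2 fun X => Category.id_comp _)
  have h2 : BialgebroidHom.compHom g f = BialgebroidHom.idHom B := hBB.unique
    ((laxMonoidalEq_lift_id_iff j' j' hj' hj' _).2 fun X => by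
      rw [BialgebroidHom.compHom_app, Category.assoc, hg', hf'])
    ((laxMonoidalEq_lift_id_iff j' j' hj' hj' _).2 fun X => Category.id_comp _)
  refine ⟨f.toIso g (fun X => ?_) (fun X => ?_), f, f.φ_fr, hf⟩
  · exact congrArg (fun p => p.φ.app X) h1
  · exact congrArg (fun p => p.φ.app X) h2

end Uniqueness

end Bgd

end

theorem mainTheorem11 {k : Type w} [CommRing k] {R : Type u} [Ring R] [Algebra k R]
    {C : Type u₁} [Category.{v₁} C] [Preadditive C] [Linear k C] [MonoidalCategory C]
    (U : C ⥤ BimoduleCat k R) [U.Additive] [U.Linear k] [U.Monoidal]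
    [U.IsRightAdjoint] [U.IsLeftAdjoint] :
    ∃ (A : LeftBialgebroid k R) (K : C ⥤ A.Mod) (_ : K.Monoidal) (_ : K.Additive),
      K.Linear k ∧
      LaxMonoidalEq U (K ⋙ A.forget) ∧
      IsLaxUniversal U A K ∧
      IsStrongUniversal U A K ∧
      ∀ (A' : LeftBialgebroid k R) (K' : C ⥤ A'.Mod) [K'.Monoidal],
        LaxMonoidalEq U (K' ⋙ A'.forget) → IsStrongUniversal U A' K' →
          ∃ (i : BialgebroidIso A' A) (f : BialgebroidHom A A' (𝟭 (BimoduleCat k R))),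
            (∀ (X : BimoduleCat k R) (a : A'.carrier) (x : X),
              (f.φ.app X).hom (A'.fm X (A'.fr a x)) = A.fm X (A.fr (i.e a) x)) ∧
            LaxMonoidalEq (K ⋙ f.lift) K' := by
  let adj := Adjunction.ofIsRightAdjoint U
  have hK : LaxMonoidalEq U (reconLift adj ⋙ (reconBialgebroid adj).forget) :=
    laxMonoidalEq_iff.2 ⟨(reconLiftIso adj).symm,
      inferInstanceAs (NatTrans.IsMonoidal (reconLiftIso adj).inv),
      fun X => IsStrict.inv (i := (reconLiftIso adj).app X) (isStrict_reconLiftIso adj X)⟩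
  have hA : IsLaxUniversal U (reconBialgebroid adj) (reconLift adj) :=
    recon_isLaxUniversal adj (Adjunction.ofIsLeftAdjoint U)
  have hA' : IsStrongUniversal U (reconBialgebroid adj) (reconLift adj) :=
    fun S _ _ B F _ G _ _ _ h => hA S B F G h
  exact ⟨reconBialgebroid adj, reconLift adj, inferInstance, inferInstance, inferInstance, hK, hA,
    hA', fun A' K' _ hK' hB => exists_bialgebroidIso hK hK' hA' hB⟩
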